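/- **Setting.** Let $\|\cdot\|$ be a norm on $\mathbb{R}^n$ with dual norm $\|\cdot\|_\star$, let $X\subset\mathbb{R}^n$ be convex and compact with $\|x_1-x_2\|\le D_X$ on $X$, let $0<c\le 1$, and let $F(x,\xi)$ be continuous and convex in $x\in X$. Put $f(x)=\mathbb{E}[F(x,\xi)]$, $g(x)=\mathbb{E}[(F(x,\xi)-f(x))_+^2]$ and consider $$\min_{x\in X}\ h(x)=f(x)+c\,g(x)^{1/2}.$$ An oracle returns, for independent copies of $\xi$, the value $F(x,\xi)$ and a subgradient $F'(x,\xi)$ of $F(\cdot,\xi)$ at $x$. With $f'(x)=\mathbb{E}[F'(x,\xi)]$ assume for all $x\in X$: $f$ is $L_f$-Lipschitz on $X$ and $\|f'(x)\|_\star\le L_f$; $\mathbb{E}\|F'(x,\xi)-f'(x)\|_\star^2\le\sigma_f^2$; $\mathbb{E}(F(x,\xi)-f(x))^2\le\beta^2$. Assume further 1. $\mathbb{E}[(F(x,\xi)-f(x))_+^4]\le M_f^4$ for all $x\in X$; 2. $\mathbb{E}\|G'(x,\xi)\|_\star^2\le L_G^2$ for all $x\in X$, where $G'(x,\xi)=2(F(x,\xi)-f(x))_+(F'(x,\xi)-f'(x))$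 is the subgradient of $G(x,\xi)=(F(x,\xi)-f(x))_+^2$, and $L_G>0$. Let $x^*$ be any minimizer of $h$ on $X$ and $z^*=2g(x^*)^{1/2}$. Let $x_0\in X$, $\delta>0$, $R=L_fD_X+\delta$, let $y_0=\frac1m\sum_{i=1}^mF(x_0,\xi_i)$ be a preliminary estimate, computed independently beforehand, and suppose (i.e. condition on the event) that $|f(x)-y_0|\le R$ for all $x\in X$. Put $Y_\delta=[y_0-R,y_0+R]$ and $U=X\times Y_\delta\times[0,1]$. **Inner method (stochastic mirror descent).** Let $V(u,u')=V_1(x,x')+V_2(y,y')+V_3(\lambda,\lambda')$ be the sum of the Bregman divergences of $1$-strongly convex, $L_v$-smooth functions on $X$, $Y_\delta$, $[0,1]$. For $z>0$, an integer $T\ge1$ and $\gamma>0$, start at $u_0=(x_0,y_0,0)$ and iterate $u_{t+1}=\arg\min_{u\in U}\gamma\langle l'_z(u_t,\xi_t),u\rangle+V(u_t,u)$, where $$l'_z(x,y,\lambda,\xi)=\Big(\tfrac{2c}{z}(F(x,\xi)-y)_+F'(x,\xi)+\lambda F'(x,\xi),\ -\tfrac{2c}{z}(F(x,\xi)-y)_++1-\lambda,\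 -F(x,\xi)+y\Big).$$ Output $\bar x=\frac1T\sum_{t<T}x_t$ and $\zeta=\frac1T\sum_{t<T}\big(-\frac{c}{z^2}(F(x_t,\xi'_t)-y_t)_+^2+\frac c4\big)$. All $\xi_t,\xi'_t$ are independent copies of $\xi$, fresh in each call, so that a call uses $2T$ samples. **Outer method (probabilistic bisection).** Start with $a=0$, $b=z_0>0$. In outer iteration $k=0,1,\dots$ run the inner method at $z=z_k$, with $T=T_k$ and $\gamma=\gamma_k$, obtaining $\bar x_k,\zeta_k$. Doubling phase: $z_k=b$; if $\zeta_k<0$ replace $b$ by $2b$, otherwise pass to the bisection phase with the current $a,b$. Bisection phase: $z_k=(a+b)/2$; if $\zeta_k<0$ set $a=z_k$, otherwise set $b=z_k$; stop if $b\le\theta$. **Constants.** Let $D_V^2=\frac{L_v}{2}[D_X^2+4R^2+1]$, $$M_z^2=\tfrac{3c^2}{z^2}\{L_G^2+(4L_f^2+1)\beta^2+16[4(L_f^2+\sigma_f^2)+1]R^2\}+12(L_f^2+\sigma_f^2)+8R^2+2\beta^2+3 .$$ For $\alpha\in(0,1)$, $\varepsilon>0$ and $w=\max\{z^*,z_0/2\}$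 let $$K=\max\Big\{1,\Big\lceil\log_2\tfrac{2z^*}{z_0}\Big\rceil\Big\}+\max\Big\{1,\Big\lceil\log_2\Big(\tfrac{32c^3w}{\varepsilon^3}[\beta^2+4R^2]+\tfrac{cw}{\varepsilon}\Big)\Big\rceil,\Big\lceil\log_2\tfrac{4cw}{\varepsilon}\Big\rceil\Big\}$$ (the first maximum being $1$ if $z^*=0$), $$\tilde C=\max\Big\{\tfrac{16K^2}{\alpha^2},\ \tfrac{128K\max\{1,16\beta^2/z_0^2\}\{[M_f^4+16R^4]+4\beta^4\}}{81\alpha D_V^2L_G^2}\Big\},$$ $$\theta=\frac{\varepsilon}{c},\qquad T_k=\Big\lceil\frac{81\tilde C M_{z_k}^2D_V^2}{\varepsilon^2}\Big\rceil,\qquad \gamma_k=\frac{D_V}{M_{z_k}\sqrt{T_k}},\qquad \tilde T=\frac{81\tilde C M_{\underline z}^2D_V^2}{\varepsilon^2},\quad \underline z=\min\{z_0,\max\{z^*/2,\varepsilon/(2c)\}\}.$$ **Theorem.** With probability at least $1-\alpha$ the method attains an $\varepsilon$-optimal solution within its first $K$ outer iterations and with at most $2K\lceil\tilde T\rceil$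 samples. That is, on an event of probability at least $1-\alpha$ there is an outer iteration $k<K$, before which the method has not stopped, such that at most $2K\lceil\tilde T\rceil$ samples have been drawn up to its end, $h(\bar x_k)-h(x^*)\le\varepsilon$, and also $\mathbb{E}[h(\bar x_k)]-h(x^*)\le\varepsilon$, where the expectation is over the samples of iteration $k$ with $z_k$ held at its realized value. Moreover there is a constant $C$, depending only on $c,L_f,\sigma_f,\beta,D_X,\delta,M_f,L_G,L_v,z_0,\alpha$, such that for all $0<\varepsilon\le1$ $$2K\lceil\tilde T\rceil\le\frac{C\,(1+\log(1/\varepsilon))^3}{\max\{z^*,\varepsilon\}^2\,\varepsilon^2},$$ i.e. the oracle complexity is $\tilde O\big(\max\{z^*,\varepsilon\}^{-2}\varepsilon^{-2}\big)$. -/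

import Mathlib

open MeasureTheory ProbabilityTheory

noncomputable section

namespace Semideviation

/-! ### The problem -/

/-- Data of a stochastic problem: feasible set `X`, law of the random variable `ξ`, random cost
`F(x, ξ)`, and the stochastic first-order information `dF(x, ξ)`, an element of the dual space. -/
structure Problem (E Ξ : Type*) [NormedAddCommGroup E] [NormedSpace ℝ E] [MeasurableSpace Ξ] where
  X : Set E
  law : Measure Ξ
  F : E → Ξ → ℝ
  dF : E → Ξ → (E →L[ℝ] ℝ)

section ProblemDefs

variable {E Ξ : Type*} [NormedAddCommGroup E] [NormedSpace ℝ E] [MeasurableSpace Ξ]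

/-- `f(x) = E[F(x, ξ)]`. -/
def Problem.f (Q : Problem E Ξ) (x : E) : ℝ := ∫ s, Q.F x s ∂Q.law

/-- `f'(x) = E[F'(x, ξ)]`. -/
def Problem.df (Q : Problem E Ξ) (x : E) : E →L[ℝ] ℝ := ∫ s, Q.dF x s ∂Q.law

/-- The upper semivariance `g(x) = E[(F(x, ξ) - E[F(x, ξ)])_+ ^ 2]`. -/
def Problem.g (Q : Problem E Ξ) (x : E) : ℝ := ∫ s, (max (Q.F x s - Q.f x) 0) ^ 2 ∂Q.law

/-- The mean-upper-semideviation objective (order two)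
`h(x) = E[F(x, ξ)] + c E[(F(x, ξ) - E[F(x, ξ)])_+ ^ 2] ^ (1/2)`. -/
def Problem.h (Q : Problem E Ξ) (c : ℝ) (x : E) : ℝ := Q.f x + c * √(Q.g x)

/-- Stochastic subgradient of `G(x, ξ) = (F(x, ξ) - E[F(x, ξ)])_+ ^ 2`, by the chain rule:
`G'(x, ξ) = 2 (F(x, ξ) - f(x))_+ (F'(x, ξ) - f'(x))`. -/
def Problem.dG (Q : Problem E Ξ) (x : E) (s : Ξ) : E →L[ℝ] ℝ :=
  (2 * max (Q.F x s - Q.f x) 0) • (Q.dF x s - Q.df x)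

end ProblemDefs

/-! ### Constants -/

/-- The numerical parameters: risk weight `c`, Lipschitz constant `Lf` of the mean, standard
deviation bounds `σf` (gradient) and `β` (value), diameter bound `DX`, accuracy `δ` of the initial
estimate, moment bound `Mf`, Lipschitz bound `LG` of the stochastic semivariance, smoothness `Lv`
of the distance generating functions, first trial value `z₀` and failure probability `α`. -/
structure Params where
  c : ℝ
  Lf : ℝ
  σf : ℝ
  β : ℝ
  DX : ℝ
  δ : ℝ
  Mf : ℝ
  LG : ℝ
  Lv : ℝ
  z₀ : ℝ
  α : ℝ

structure Params.Valid (p : Params) : Prop where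
  c_pos : 0 < p.c
  c_le_one : p.c ≤ 1
  Lf_nonneg : 0 ≤ p.Lf
  σf_nonneg : 0 ≤ p.σf
  β_nonneg : 0 ≤ p.β
  DX_nonneg : 0 ≤ p.DX
  δ_pos : 0 < p.δ
  Mf_nonneg : 0 ≤ p.Mf
  LG_pos : 0 < p.LG
  Lv_pos : 0 < p.Lv
  z₀_pos : 0 < p.z₀
  α_pos : 0 < p.α
  α_lt_one : p.α < 1

/-- `R = Lf DX + δ`, the half-width of the interval for the auxiliary variable `y`. -/
def Params.R (p : Params) : ℝ := p.Lf * p.DX + p.δ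

/-- `D_V = ((Lv / 2) (DX ^ 2 + 4 R ^ 2 + 1)) ^ (1/2)`. -/
def Params.DV (p : Params) : ℝ := √(p.Lv / 2 * (p.DX ^ 2 + 4 * p.R ^ 2 + 1))

/-- The bound `M_z` on the size of the inner stochastic subgradient. -/
def Params.M (p : Params) (z : ℝ) : ℝ :=
  √(3 * p.c ^ 2 / z ^ 2 *
        (p.LG ^ 2 + (4 * p.Lf ^ 2 + 1) * p.β ^ 2
          + 16 * (4 * (p.Lf ^ 2 + p.σf ^ 2) + 1) * p.R ^ 2)
      + 12 * (p.Lf ^ 2 + p.σf ^ 2) + 8 * p.R ^ 2 + 2 * p.β ^ 2 + 3)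

/-- Bound on the number of outer iterations of the doubling phase; `zs` stands for `z*`. -/
def Params.K₁ (p : Params) (zs : ℝ) : ℕ := max 1 ⌈Real.logb 2 (2 * zs / p.z₀)⌉₊

/-- Bound on the number of outer iterations of the bisection phase, whose initial interval has
length at most `2 w` with `w = max z* (z₀ / 2)`. -/
def Params.K₂ (p : Params) (ε zs : ℝ) : ℕ :=
  let w := max zs (p.z₀ / 2)
  max 1 (max
    ⌈Real.logb 2 (32 * p.c ^ 3 * w / ε ^ 3 * (p.β ^ 2 + 4 * p.R ^ 2) + p.c * w / ε)⌉₊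
    ⌈Real.logb 2 (4 * p.c * w / ε)⌉₊)

/-- The maximum number of outer iterations. -/
def Params.K (p : Params) (ε zs : ℝ) : ℕ := p.K₁ zs + p.K₂ ε zs

def Params.Ctilde (p : Params) (ε zs : ℝ) : ℝ :=
  max (16 * (p.K ε zs : ℝ) ^ 2 / p.α ^ 2)
    (128 * (p.K ε zs : ℝ) * max 1 (16 * p.β ^ 2 / p.z₀ ^ 2) *
        ((p.Mf ^ 4 + 16 * p.R ^ 4) + 4 * p.β ^ 4)
      / (81 * p.α * p.DV ^ 2 * p.LG ^ 2))

/-- The real number `81 C̃ M_z ^ 2 D_V ^ 2 / ε ^ 2`. -/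
def Params.budget (p : Params) (ε zs z : ℝ) : ℝ :=
  81 * p.Ctilde ε zs * p.M z ^ 2 * p.DV ^ 2 / ε ^ 2

/-- Number of inner steps at the trial value `z`. -/
def Params.T (p : Params) (ε zs z : ℝ) : ℕ := ⌈p.budget ε zs z⌉₊

/-- Inner step size at the trial value `z`. -/
def Params.γ (p : Params) (ε zs z : ℝ) : ℝ := p.DV / (p.M z * √(p.T ε zs z : ℝ))

/-- `T̃`, the inner budget at the smallest relevant trial value. -/
def Params.Ttilde (p : Params) (ε zs : ℝ) : ℝ :=
  p.budget ε zs (min p.z₀ (max (zs / 2) (ε / (2 * p.c))))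

/-! ### Standing assumptions -/

section Assumptions

variable {E Ξ : Type*} [NormedAddCommGroup E] [NormedSpace ℝ E]
  [MeasurableSpace E] [MeasurableSpace Ξ]

/-- Standing assumptions on the problem and its stochastic first-order oracle. The norm on the dual
space `E →L[ℝ] ℝ` is the dual norm. -/
structure Problem.Standing (Q : Problem E Ξ) (p : Params) : Prop where
  law_prob : IsProbabilityMeasure Q.law
  X_convex : Convex ℝ Q.X
  X_compact : IsCompact Q.X
  X_diam : ∀ x₁ ∈ Q.X, ∀ x₂ ∈ Q.X, ‖x₁ - x₂‖ ≤ p.DX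
  F_measurable : Measurable (fun q : E × Ξ => Q.F q.1 q.2)
  dF_measurable : Measurable (fun q : E × Ξ => Q.dF q.1 q.2)
  F_continuous : ∀ s, ContinuousOn (fun x => Q.F x s) Q.X
  F_convex : ∀ s, ConvexOn ℝ Q.X (fun x => Q.F x s)
  /-- `dF(x, ξ)` is a subgradient of `F(·, ξ)` at `x`. -/
  dF_subgradient : ∀ s, ∀ x ∈ Q.X, ∀ y ∈ Q.X, Q.F x s + Q.dF x s (y - x) ≤ Q.F y s
  F_integrable : ∀ x ∈ Q.X, Integrable (fun s => Q.F x s) Q.law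
  dF_integrable : ∀ x ∈ Q.X, Integrable (fun s => Q.dF x s) Q.law
  /-- `f` is `Lf`-Lipschitz on `X` ... -/
  f_lipschitz : ∀ x₁ ∈ Q.X, ∀ x₂ ∈ Q.X, |Q.f x₁ - Q.f x₂| ≤ p.Lf * ‖x₁ - x₂‖
  /-- ... and so its subgradients `f'(x) = E[F'(x, ξ)]` are bounded by `Lf`. -/
  df_bound : ∀ x ∈ Q.X, ‖Q.df x‖ ≤ p.Lf
  dF_sq_integrable : ∀ x ∈ Q.X, Integrable (fun s => ‖Q.dF x s - Q.df x‖ ^ 2) Q.law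
  dF_variance : ∀ x ∈ Q.X, ∫ s, ‖Q.dF x s - Q.df x‖ ^ 2 ∂Q.law ≤ p.σf ^ 2
  F_sq_integrable : ∀ x ∈ Q.X, Integrable (fun s => (Q.F x s - Q.f x) ^ 2) Q.law
  F_variance : ∀ x ∈ Q.X, ∫ s, (Q.F x s - Q.f x) ^ 2 ∂Q.law ≤ p.β ^ 2

/-- Bounded fourth moment of the upper deviation. -/
def Problem.FourthMomentBound (Q : Problem E Ξ) (Mf : ℝ) : Prop :=
  ∀ x ∈ Q.X, Integrable (fun s => (max (Q.F x s - Q.f x) 0) ^ 4) Q.law ∧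
    ∫ s, (max (Q.F x s - Q.f x) 0) ^ 4 ∂Q.law ≤ Mf ^ 4

/-- Lipschitz bound on the stochastic semivariance: `E ‖G'(x, ξ)‖_* ^ 2 ≤ LG ^ 2`. -/
def Problem.SemivarianceLipschitz (Q : Problem E Ξ) (LG : ℝ) : Prop :=
  ∀ x ∈ Q.X, Integrable (fun s => ‖Q.dG x s‖ ^ 2) Q.law ∧
    ∫ s, ‖Q.dG x s‖ ^ 2 ∂Q.law ≤ LG ^ 2

end Assumptions

/-! ### Distance generating functions -/

/-- A function together with its gradient, on a normed space. -/
structure DistGen (W : Type*) [NormedAddCommGroup W] [NormedSpace ℝ W] where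
  val : W → ℝ
  grad : W → (W →L[ℝ] ℝ)

section Mirror

variable {W : Type*} [NormedAddCommGroup W] [NormedSpace ℝ W]

/-- `v` is differentiable, `L`-Lipschitz smooth and `1`-strongly convex on `S`. -/
structure DistGen.IsValid (v : DistGen W) (S : Set W) (L : ℝ) : Prop where
  hasGrad : ∀ x ∈ S, HasFDerivWithinAt v.val (v.grad x) S x
  smooth : ∀ x₁ ∈ S, ∀ x₂ ∈ S, ‖v.grad x₁ - v.grad x₂‖ ≤ L * ‖x₁ - x₂‖
  strong : ∀ x₁ ∈ S, ∀ x₂ ∈ S,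
    v.val x₁ + v.grad x₁ (x₂ - x₁) + 1 / 2 * ‖x₁ - x₂‖ ^ 2 ≤ v.val x₂

/-- The prox-function (Bregman divergence) of `v`. -/
def DistGen.bregman (v : DistGen W) (x₁ x₂ : W) : ℝ :=
  v.val x₂ - v.val x₁ - v.grad x₁ (x₂ - x₁)

end Mirror

/-! ### The algorithm -/

section Algorithm

variable {E Ξ : Type*} [NormedAddCommGroup E] [NormedSpace ℝ E] [MeasurableSpace Ξ]

/-- Everything the two-layer method is run with: the problem, the parameters, the target accuracy
`ε`, the value `zs` of `z*` that enters the choice of the number of inner steps, the (separable)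
distance generating functions for `x`, `y`, `lam`, and the starting point `(x₀, y₀, 0)`, where
`y₀` is also the centre of the interval for `y`. -/
structure Method (E Ξ : Type*) [NormedAddCommGroup E] [NormedSpace ℝ E]
    [MeasurableSpace Ξ] where
  Q : Problem E Ξ
  p : Params
  ε : ℝ
  zs : ℝ
  vX : DistGen E
  vY : DistGen ℝ
  vL : DistGen ℝ
  x₀ : E
  y₀ : ℝ

/-- The interval `Y_δ = [y₀ - R, y₀ + R]`. -/
def Method.Y (A : Method E Ξ) : Set ℝ := Set.Icc (A.y₀ - A.p.R) (A.y₀ + A.p.R)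

/-- The feasible set `U = X × Y_δ × [0, 1]` of the inner saddle point problem. -/
def Method.U (A : Method E Ξ) : Set (E × ℝ × ℝ) := A.Q.X ×ˢ (A.Y ×ˢ Set.Icc 0 1)

/-- Value at `u` of the linear form `l'_z(u_t, s)`, where `u_t = (x, y, lam)`; its components are
the stochastic partial subgradients in `x` and `y`, and minus the one in `lam`, of
`(c / z) (F(x, s) - y)_+ ^ 2 + y + (c / 4) z + lam (F(x, s) - y)`. -/
def Method.lForm (A : Method E Ξ) (z : ℝ) (ut : E × ℝ × ℝ) (s : Ξ) (u : E × ℝ × ℝ) : ℝ :=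
  (2 * A.p.c / z * max (A.Q.F ut.1 s - ut.2.1) 0 + ut.2.2) * A.Q.dF ut.1 s u.1
    + (-(2 * A.p.c / z) * max (A.Q.F ut.1 s - ut.2.1) 0 + 1 - ut.2.2) * u.2.1
    + (-A.Q.F ut.1 s + ut.2.1) * u.2.2

/-- Stochastic subgradient in `z` at `(x, y, z, lam)` (it does not depend on `lam`). -/
def Method.dz (A : Method E Ξ) (z : ℝ) (u : E × ℝ × ℝ) (s : Ξ) : ℝ :=
  -(A.p.c / z ^ 2) * (max (A.Q.F u.1 s - u.2.1) 0) ^ 2 + A.p.c / 4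

/-- The separable prox-function on `E × ℝ × ℝ`. -/
def Method.V (A : Method E Ξ) (u₁ u₂ : E × ℝ × ℝ) : ℝ :=
  A.vX.bregman u₁.1 u₂.1 + A.vY.bregman u₁.2.1 u₂.2.1 + A.vL.bregman u₁.2.2 u₂.2.2

/-- One mirror descent step: the minimizer over `u ∈ U` of `γ ⟨l'_z(u_t, s), u⟩ + V(u_t, u)`. -/
def Method.proxStep (A : Method E Ξ) (z γ : ℝ) (ut : E × ℝ × ℝ) (s : Ξ) : E × ℝ × ℝ :=
  Classical.epsilon (fun w : E × ℝ × ℝ =>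
    w ∈ A.U ∧ IsMinOn (fun u => γ * A.lForm z ut s u + A.V ut u) A.U w)

/-- Inner iterates `u_t`, driven by the sample stream `ξ`. -/
def Method.smdIter (A : Method E Ξ) (z : ℝ) (γ : ℕ → ℝ) (ξ : ℕ → Ξ) : ℕ → E × ℝ × ℝ
  | 0 => (A.x₀, A.y₀, 0)
  | t + 1 => A.proxStep z (γ t) (A.smdIter z γ ξ t) (ξ t)

/-- First output of stochastic mirror descent after `T` steps: the weighted average iterate. -/
def Method.smdPoint (A : Method E Ξ) (z : ℝ) (T : ℕ) (γ : ℕ → ℝ) (ξ : ℕ → Ξ) : E × ℝ × ℝ :=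
  (∑ t ∈ Finset.range T, γ t)⁻¹ • ∑ t ∈ Finset.range T, γ t • A.smdIter z γ ξ t

/-- Second output of stochastic mirror descent after `T` steps: the weighted average of the
stochastic subgradients in `z`, evaluated with the second sample stream `η`. -/
def Method.smdSlope (A : Method E Ξ) (z : ℝ) (T : ℕ) (γ : ℕ → ℝ) (ξ η : ℕ → Ξ) : ℝ :=
  (∑ t ∈ Finset.range T, γ t)⁻¹ *
    ∑ t ∈ Finset.range T, γ t * A.dz z (A.smdIter z γ ξ t) (η t)

/-- Number of inner steps at trial value `z`. -/
def Method.T (A : Method E Ξ) (z : ℝ) : ℕ := A.p.T A.ε A.zs z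

/-- The averaged `x`-iterate of the inner method at trial value `z`, with the prescribed number of
steps and (constant) step sizes. -/
def Method.xbar (A : Method E Ξ) (z : ℝ) (ξ : ℕ → Ξ) : E :=
  (A.smdPoint z (A.T z) (fun _ => A.p.γ A.ε A.zs z) ξ).1

/-- The slope estimate of the inner method at trial value `z`, with the prescribed number of steps
and (constant) step sizes. -/
def Method.slope (A : Method E Ξ) (z : ℝ) (ξ η : ℕ → Ξ) : ℝ :=
  A.smdSlope z (A.T z) (fun _ => A.p.γ A.ε A.zs z) ξ η

/-- State of the outer method: whether it is still in the doubling phase, the current interval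
`[a, b]`, whether it has stopped, and the number of samples drawn so far. -/
structure OuterState where
  doubling : Bool
  a : ℝ
  b : ℝ
  stopped : Bool
  samples : ℕ

/-- The trial value `z_k` of the next outer iteration. -/
def OuterState.trial (S : OuterState) : ℝ := if S.doubling then S.b else (S.a + S.b) / 2

/-- One outer iteration with slope estimate `ζ` computed in `T` inner steps, each of which draws
two samples. -/
def OuterState.step (S : OuterState) (θ ζ : ℝ) (T : ℕ) : OuterState :=
  if S.stopped then S
  else if S.doubling then
    if ζ < 0 then { S with b := 2 * S.b, samples := S.samples + 2 * T }
    else { S with doubling := false, samples := S.samples + 2 * T }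
  else
    let a := if ζ < 0 then S.trial else S.a
    let b := if ζ < 0 then S.b else S.trial
    { doubling := false, a := a, b := b, stopped := decide (b ≤ θ),
      samples := S.samples + 2 * T }

/-- State before outer iteration `k`. Outer iteration `k` uses the fresh sample streams `ξ k` (for
the mirror descent steps) and `η k` (for the slope estimate); the tolerance is `θ = ε / c`. -/
def Method.state (A : Method E Ξ) (ξ η : ℕ → ℕ → Ξ) : ℕ → OuterState
  | 0 => { doubling := true, a := 0, b := A.p.z₀, stopped := false, samples := 0 }
  | k + 1 =>
    let S := A.state ξ η k
    S.step (A.ε / A.p.c) (A.slope S.trial (ξ k) (η k)) (A.T S.trial)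

end Algorithm

end Semideviation

end

open MeasureTheory ProbabilityTheory

noncomputable section

set_option linter.unusedSectionVars false

namespace Semideviation

/-! Write `φ_z(x, y, λ) = (c/z) E(F - y)_+² + y + cz/4 + λ (f - y)`. It is jointly convex in `(x, y,
z)`, because a square over a positive linear term is a perspective function, and it is affine in
`λ`. Since `c √g ≤ c g / z + c z / 4`, with equality at `z = 2 √g > 0`, minimising `h` amounts to
solving a saddle problem for each `z` and then minimising a convex function of the scalar `z`.

Three facts tie `φ` to `h`. For every `y`, `h(x) ≤ φ_z(x, y, λ)` for `λ = 0` or `λ = 1` (`h_le_phi`;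
this is where `c ≤ 1` enters). At `y = f(x)` the excess over `h(x)` is exactly `c (z - 2 √g(x))² /
(4 z)` (`phi_mean`). At `z = 2 √g(x)` it vanishes (`phi_opt`), also when `g(x) = 0`.

By joint convexity, the regret of mirror descent at `z` controls `h(x̄) - φ_{z'}(x, y, λ̄)` for any
other `z'`, up to `(z - z')` times the averaged slope (`phi_gap_le`). Only the reference multipliers
0 and 1 are needed, so the noise is a martingale at deterministic reference points, and second
moments with Markov's inequality suffice.

Suppose the regret is at most `ε/2` and the slope error times `|z - z*|` at most `ε/4`. Taking `z' =
z` gives `h(x̄) - h* ≤ ε/2 + c (z - z*)² / (4 z)`; taking `z' = z*` gives `h(x̄) - h* ≤ 3ε/4 + (z -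
z*) ζ`. So an iteration that fails has `(z - z*) ζ > 0`: the sign of `ζ` is wrong only where the
iteration has already succeeded (`outcome`). The bound in expectation follows from the same
dichotomy, because a realized average point with small `φ_z` may serve as a deterministic reference
for an independent run (`integral_h_le`).

Hence, until the first success, the outer loop is an exact doubling and bisection search for `z*`.
It neither loses `z*` nor stops early, and by iteration `K` its trial value is so close to `z*` that
success is forced (`exists_success`). The trial values are random, but they take finitely many
values and depend on past samples only, so a union bound over the `K` calls gives probability `1 -
α` (`badSet_spec`). -/

lemma clm_apply_le {W : Type*} [NormedAddCommGroup W] [NormedSpace ℝ W] (ℓ : W →L[ℝ] ℝ) (v : W) :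
    ℓ v ≤ ‖ℓ‖ * ‖v‖ :=
  (le_abs_self _).trans (by simpa using ℓ.le_opNorm v)

/-! ### Bregman divergences and prox steps on one block -/

section Block

variable {W : Type*} [NormedAddCommGroup W] [NormedSpace ℝ W] {v : DistGen W} {S : Set W} {L : ℝ}

lemma DistGen.IsValid.half_sq_le_bregman (hv : v.IsValid S L) {x u : W} (hx : x ∈ S)
    (hu : u ∈ S) : 1 / 2 * ‖x - u‖ ^ 2 ≤ v.bregman x u := by
  have := hv.strong x hx u hu
  unfold DistGen.bregman
  linarith

lemma DistGen.IsValid.bregman_nonneg (hv : v.IsValid S L) {x u : W} (hx : x ∈ S)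
    (hu : u ∈ S) : 0 ≤ v.bregman x u :=
  le_trans (by positivity) (hv.half_sq_le_bregman hx hu)

lemma DistGen.IsValid.sq_le_grad_sub (hv : v.IsValid S L) {x u : W} (hx : x ∈ S)
    (hu : u ∈ S) : ‖x - u‖ ^ 2 ≤ (v.grad u - v.grad x) (u - x) := by
  have h1 := hv.strong x hx u hu
  have h2 := hv.strong u hu x hx
  have h3 : v.grad u (x - u) = - v.grad u (u - x) := by rw [← map_neg, neg_sub]
  rw [norm_sub_rev u x] at h2
  rw [sub_apply]
  linarith

/-- Strong convexity at `u` bounds the divergence by `⟨∇v(u) - ∇v(x), u - x⟩`, so no integration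
along the segment is needed. The price is the factor `L` instead of `L / 2`. -/
lemma DistGen.IsValid.bregman_le (hv : v.IsValid S L) {x u : W} (hx : x ∈ S)
    (hu : u ∈ S) : v.bregman x u ≤ L * ‖x - u‖ ^ 2 := by
  have h1 := hv.strong u hu x hx
  have h2 : (v.grad u - v.grad x) (u - x) ≤ L * ‖x - u‖ ^ 2 := by
    calc (v.grad u - v.grad x) (u - x) ≤ ‖v.grad u - v.grad x‖ * ‖u - x‖ := clm_apply_le _ _
      _ ≤ (L * ‖u - x‖) * ‖u - x‖ := by gcongr; exact hv.smooth u hu x hx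
      _ = L * ‖x - u‖ ^ 2 := by rw [norm_sub_rev]; ring
  have h3 : v.grad u (x - u) = - v.grad u (u - x) := by rw [← map_neg, neg_sub]
  have h4 : 0 ≤ 1 / 2 * ‖u - x‖ ^ 2 := by positivity
  rw [sub_apply] at h2
  unfold DistGen.bregman
  linarith

/-- On a nondegenerate interval, strong monotonicity of the gradient and its Lipschitz bound are
compatible only if `1 ≤ L`. This lets `D_V²`, which carries the factor `Lv`, dominate plain squared
distances. -/
lemma DistGen.IsValid.one_le_of_Icc {v : DistGen ℝ} (hv : v.IsValid (Set.Icc 0 1) L) : 1 ≤ L := by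
  have h := hv.half_sq_le_bregman (x := 0) (u := 1) (by simp) (by simp)
  have h0 := hv.sq_le_grad_sub (x := 0) (u := 1) (by simp) (by simp)
  have h1 := hv.smooth 1 (by simp) 0 (by simp)
  have h2 := (v.grad 1 - v.grad 0).le_opNorm (1 - 0)
  have h3 := le_abs_self ((v.grad 1 - v.grad 0) (1 - 0))
  rw [Real.norm_eq_abs] at h2
  simp only [sub_zero, norm_one, mul_one, zero_sub, norm_neg, one_pow] at *
  linarith

lemma DistGen.IsValid.continuousOn_val (hv : v.IsValid S L) : ContinuousOn v.val S :=
  fun x hx => (hv.hasGrad x hx).continuousWithinAt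

lemma DistGen.IsValid.continuousOn_grad (hv : v.IsValid S L) : ContinuousOn v.grad S := by
  have : LipschitzOnWith L.toNNReal v.grad S := by
    refine LipschitzOnWith.of_dist_le_mul fun x hx y hy => ?_
    rw [dist_eq_norm, dist_eq_norm]
    exact (hv.smooth x hx y hy).trans (by gcongr; exact Real.le_coe_toNNReal L)
  exact this.continuousOn

lemma DistGen.IsValid.first_order (hv : v.IsValid S L) (hS : Convex ℝ S) {ℓ : W →L[ℝ] ℝ} {w u : W}
    (hw : w ∈ S) (hmin : IsMinOn (fun u => ℓ u + v.val u) S w) (hu : u ∈ S) :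
    0 ≤ ℓ (u - w) + v.grad w (u - w) := by
  have h := hmin.localize.hasFDerivWithinAt_nonneg
    (ℓ.hasFDerivWithinAt.add (hv.hasGrad w hw))
    (sub_mem_posTangentConeAt_of_segment_subset (hS.segment_subset hw hu))
  simpa using h

/-- Adding the two variational inequalities and using strong monotonicity of the gradient gives `‖w₁
- w₂‖² ≤ ‖ℓ₁ - ℓ₂‖ ‖w₁ - w₂‖`. Uniqueness of the minimizer and its continuity in `ℓ`, hence
measurability of the iterates, both come from here. -/
lemma DistGen.IsValid.norm_sub_le_of_isMinOn (hv : v.IsValid S L) (hS : Convex ℝ S)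
    {ℓ₁ ℓ₂ : W →L[ℝ] ℝ} {w₁ w₂ : W} (hw₁ : w₁ ∈ S) (hw₂ : w₂ ∈ S)
    (h₁ : IsMinOn (fun u => ℓ₁ u + v.val u) S w₁) (h₂ : IsMinOn (fun u => ℓ₂ u + v.val u) S w₂) :
    ‖w₁ - w₂‖ ≤ ‖ℓ₁ - ℓ₂‖ := by
  have e1 := hv.first_order hS hw₁ h₁ hw₂
  have e2 := hv.first_order hS hw₂ h₂ hw₁
  have e3 := hv.sq_le_grad_sub hw₁ hw₂
  have e4 : ℓ₂ (w₁ - w₂) = - ℓ₂ (w₂ - w₁) := by rw [← map_neg, neg_sub]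
  have e5 : v.grad w₂ (w₁ - w₂) = - v.grad w₂ (w₂ - w₁) := by rw [← map_neg, neg_sub]
  have e6 : (ℓ₁ - ℓ₂) (w₂ - w₁) ≤ ‖ℓ₁ - ℓ₂‖ * ‖w₁ - w₂‖ := by
    rw [norm_sub_rev w₁]
    exact clm_apply_le _ _
  rw [sub_apply] at e3 e6
  by_contra! hlt
  have : 0 < ‖w₁ - w₂‖ := (norm_nonneg _).trans_lt hlt
  nlinarith

lemma DistGen.IsValid.exists_argmin (hv : v.IsValid S L) (hS : IsCompact S) (hne : S.Nonempty)
    (ℓ : W →L[ℝ] ℝ) : ∃ w, w ∈ S ∧ IsMinOn (fun u => ℓ u + v.val u) S w := by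
  obtain ⟨w, hw, h⟩ := hS.exists_isMinOn hne (f := fun u => ℓ u + v.val u)
    (ℓ.continuous.continuousOn.add hv.continuousOn_val)
  exact ⟨w, hw, h⟩

/-- The minimizer of `ℓ + v` over `S`. -/
def DistGen.argmin (v : DistGen W) (S : Set W) (ℓ : W →L[ℝ] ℝ) : W :=
  Classical.epsilon fun w => w ∈ S ∧ IsMinOn (fun u => ℓ u + v.val u) S w

lemma DistGen.IsValid.argmin_spec (hv : v.IsValid S L) (hS : IsCompact S) (hne : S.Nonempty)
    (ℓ : W →L[ℝ] ℝ) :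
    v.argmin S ℓ ∈ S ∧ IsMinOn (fun u => ℓ u + v.val u) S (v.argmin S ℓ) :=
  Classical.epsilon_spec (hv.exists_argmin hS hne ℓ)

lemma DistGen.IsValid.eq_argmin (hv : v.IsValid S L) (hS : IsCompact S) (hSc : Convex ℝ S)
    {ℓ : W →L[ℝ] ℝ} {w : W} (hw : w ∈ S) (h : IsMinOn (fun u => ℓ u + v.val u) S w) :
    w = v.argmin S ℓ := by
  obtain ⟨h1, h2⟩ := hv.argmin_spec hS ⟨w, hw⟩ ℓ
  have := hv.norm_sub_le_of_isMinOn hSc hw h1 h h2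
  rw [sub_self, norm_zero] at this
  exact sub_eq_zero.1 (norm_le_zero_iff.1 this)

lemma DistGen.IsValid.continuous_argmin (hv : v.IsValid S L) (hS : IsCompact S)
    (hSc : Convex ℝ S) (hne : S.Nonempty) : Continuous (v.argmin S) := by
  refine LipschitzWith.continuous (K := 1) (LipschitzWith.of_dist_le_mul fun ℓ₁ ℓ₂ => ?_)
  obtain ⟨h1, h2⟩ := hv.argmin_spec hS hne ℓ₁
  obtain ⟨h3, h4⟩ := hv.argmin_spec hS hne ℓ₂
  simpa [dist_eq_norm] using hv.norm_sub_le_of_isMinOn hSc h1 h3 h2 h4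

/-- The two objectives differ by a constant in `u`; the base point only tilts the linear term. -/
lemma DistGen.isMinOn_bregman_iff (v : DistGen W) (S : Set W) (ℓ : W →L[ℝ] ℝ) (x w : W) :
    IsMinOn (fun u => ℓ u + v.bregman x u) S w ↔
      IsMinOn (fun u => (ℓ - v.grad x) u + v.val u) S w := by
  simp only [isMinOn_iff, DistGen.bregman, map_sub, sub_apply]
  refine forall₂_congr fun u _ => ?_
  constructor <;> intro h <;> linarith

/-- The three-point inequality of a prox step with linear term `ℓ`. -/
lemma DistGen.IsValid.prox_step (hv : v.IsValid S L) (hS : Convex ℝ S) {ℓ : W →L[ℝ] ℝ}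
    {x w u : W} (hx : x ∈ S) (hw : w ∈ S)
    (hmin : IsMinOn (fun u => ℓ u + v.bregman x u) S w) (hu : u ∈ S) :
    ℓ (x - u) ≤ v.bregman x u - v.bregman w u + ‖ℓ‖ ^ 2 / 2 := by
  have h1 := hv.first_order hS hw ((v.isMinOn_bregman_iff S ℓ x w).1 hmin) hu
  have h2 := hv.half_sq_le_bregman hx hw
  have h3 : ℓ (x - w) ≤ ‖ℓ‖ * ‖x - w‖ :=
    clm_apply_le _ _
  -- Young's inequality: the quadratic part is paid for by strong convexity, `1/2 ‖x - w‖² ≤ V(x,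
  -- w)`, in the three-point identity.
  have h4 : ‖ℓ‖ * ‖x - w‖ ≤ ‖ℓ‖ ^ 2 / 2 + 1 / 2 * ‖x - w‖ ^ 2 := by
    nlinarith [sq_nonneg (‖ℓ‖ - ‖x - w‖)]
  simp only [DistGen.bregman, map_sub, sub_apply] at *
  linarith

end Block

/-! ### The mirror descent step on the product set -/

section Prox

variable {E Ξ : Type*} [NormedAddCommGroup E] [NormedSpace ℝ E]
  [MeasurableSpace E] [MeasurableSpace Ξ]

/-- The standing assumptions on all the data the method is run with. -/
structure Method.Admissible (A : Method E Ξ) : Prop where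
  params : A.p.Valid
  standing : A.Q.Standing A.p
  fourth : A.Q.FourthMomentBound A.p.Mf
  semivariance : A.Q.SemivarianceLipschitz A.p.LG
  x₀_mem : A.x₀ ∈ A.Q.X
  f_near : ∀ x ∈ A.Q.X, |A.Q.f x - A.y₀| ≤ A.p.R
  vX_valid : A.vX.IsValid A.Q.X A.p.Lv
  vY_valid : A.vY.IsValid A.Y A.p.Lv
  vL_valid : A.vL.IsValid (Set.Icc 0 1) A.p.Lv
  ε_pos : 0 < A.ε

/-- Coefficient of `F'(x, s)` in the first component of `l'_z`. -/
def Method.lX (A : Method E Ξ) (z : ℝ) (u : E × ℝ × ℝ) (s : Ξ) : ℝ :=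
  2 * A.p.c / z * max (A.Q.F u.1 s - u.2.1) 0 + u.2.2

/-- Second component of `l'_z`. -/
def Method.lY (A : Method E Ξ) (z : ℝ) (u : E × ℝ × ℝ) (s : Ξ) : ℝ :=
  -(2 * A.p.c / z) * max (A.Q.F u.1 s - u.2.1) 0 + 1 - u.2.2

/-- Third component of `l'_z`. -/
def Method.lL (A : Method E Ξ) (u : E × ℝ × ℝ) (s : Ξ) : ℝ :=
  -A.Q.F u.1 s + u.2.1

/-- Squared dual norm of `l'_z`. -/
def Method.lSq (A : Method E Ξ) (z : ℝ) (u : E × ℝ × ℝ) (s : Ξ) : ℝ :=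
  (A.lX z u s) ^ 2 * ‖A.Q.dF u.1 s‖ ^ 2 + (A.lY z u s) ^ 2 + (A.lL u s) ^ 2

lemma Method.lForm_eq (A : Method E Ξ) (z : ℝ) (ut : E × ℝ × ℝ) (s : Ξ) (u : E × ℝ × ℝ) :
    A.lForm z ut s u =
      A.lX z ut s * A.Q.dF ut.1 s u.1 + A.lY z ut s * u.2.1 + A.lL ut s * u.2.2 := rfl

variable {A : Method E Ξ}

lemma Params.Valid.R_pos {p : Params} (hp : p.Valid) : 0 < p.R :=
  add_pos_of_nonneg_of_pos (mul_nonneg hp.Lf_nonneg hp.DX_nonneg) hp.δ_pos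

lemma Method.Admissible.Y_nonempty (hA : A.Admissible) : A.Y.Nonempty := by
  have := hA.params.R_pos
  exact ⟨A.y₀, by simp only [Method.Y, Set.mem_Icc]; constructor <;> linarith⟩

lemma Method.Admissible.start_mem (hA : A.Admissible) : (A.x₀, A.y₀, (0 : ℝ)) ∈ A.U := by
  have := hA.params.R_pos
  refine ⟨hA.x₀_mem, ?_, by simp⟩
  simp only [Method.Y, Set.mem_Icc]; constructor <;> linarith

lemma Method.U_convex (hA : A.Admissible) : Convex ℝ A.U :=
  hA.standing.X_convex.prod ((convex_Icc _ _).prod (convex_Icc _ _))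

/-- Linear term of the `x`-block of a prox step. -/
def Method.ellX (A : Method E Ξ) (z γ : ℝ) (ut : E × ℝ × ℝ) (s : Ξ) : E →L[ℝ] ℝ :=
  (γ * A.lX z ut s) • A.Q.dF ut.1 s

/-- Linear term of the `y`-block of a prox step. -/
def Method.ellY (A : Method E Ξ) (z γ : ℝ) (ut : E × ℝ × ℝ) (s : Ξ) : ℝ →L[ℝ] ℝ :=
  (γ * A.lY z ut s) • ContinuousLinearMap.id ℝ ℝ

/-- Linear term of the `λ`-block of a prox step. -/
def Method.ellL (A : Method E Ξ) (γ : ℝ) (ut : E × ℝ × ℝ) (s : Ξ) : ℝ →L[ℝ] ℝ :=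
  (γ * A.lL ut s) • ContinuousLinearMap.id ℝ ℝ

lemma Method.mul_lForm_add_V (A : Method E Ξ) (z γ : ℝ) (ut : E × ℝ × ℝ) (s : Ξ)
    (u : E × ℝ × ℝ) :
    γ * A.lForm z ut s u + A.V ut u =
      (A.ellX z γ ut s u.1 + A.vX.bregman ut.1 u.1)
      + (A.ellY z γ ut s u.2.1 + A.vY.bregman ut.2.1 u.2.1)
      + (A.ellL γ ut s u.2.2 + A.vL.bregman ut.2.2 u.2.2) := by
  simp only [Method.lForm_eq, Method.V, Method.ellX, Method.ellY, Method.ellL,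
    smul_apply, ContinuousLinearMap.id_apply, smul_eq_mul]
  ring

/-- `U` is a product and the objective is a sum over the blocks, so block minimizers assemble to a
joint one, and conversely each component of a joint minimizer is a block minimizer. -/
lemma Method.Admissible.proxStep_spec (hA : A.Admissible) (z γ : ℝ) (ut : E × ℝ × ℝ) (s : Ξ) :
    A.proxStep z γ ut s ∈ A.U ∧
    IsMinOn (fun x => A.ellX z γ ut s x + A.vX.bregman ut.1 x) A.Q.X (A.proxStep z γ ut s).1 ∧
    IsMinOn (fun y => A.ellY z γ ut s y + A.vY.bregman ut.2.1 y) A.Y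
      (A.proxStep z γ ut s).2.1 ∧
    IsMinOn (fun l => A.ellL γ ut s l + A.vL.bregman ut.2.2 l) (Set.Icc 0 1)
      (A.proxStep z γ ut s).2.2 := by
  have hex : ∃ w : E × ℝ × ℝ,
      w ∈ A.U ∧ IsMinOn (fun u => γ * A.lForm z ut s u + A.V ut u) A.U w := by
    obtain ⟨x, hx, hxm⟩ := hA.vX_valid.exists_argmin hA.standing.X_compact ⟨_, hA.x₀_mem⟩
      (A.ellX z γ ut s - A.vX.grad ut.1)
    obtain ⟨y, hy, hym⟩ := hA.vY_valid.exists_argmin isCompact_Icc hA.Y_nonempty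
      (A.ellY z γ ut s - A.vY.grad ut.2.1)
    obtain ⟨l, hl, hlm⟩ := hA.vL_valid.exists_argmin isCompact_Icc ⟨0, by simp⟩
      (A.ellL γ ut s - A.vL.grad ut.2.2)
    rw [← DistGen.isMinOn_bregman_iff] at hxm hym hlm
    refine ⟨(x, y, l), ⟨hx, hy, hl⟩, isMinOn_iff.2 fun u hu => ?_⟩
    rw [A.mul_lForm_add_V, A.mul_lForm_add_V]
    have h1 := isMinOn_iff.1 hxm _ hu.1
    have h2 := isMinOn_iff.1 hym _ hu.2.1
    have h3 := isMinOn_iff.1 hlm _ hu.2.2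
    simp only at h1 h2 h3 ⊢
    linarith
  obtain ⟨hw, hmin⟩ : A.proxStep z γ ut s ∈ A.U ∧
      IsMinOn (fun u => γ * A.lForm z ut s u + A.V ut u) A.U (A.proxStep z γ ut s) :=
    Classical.epsilon_spec hex
  set w := A.proxStep z γ ut s
  refine ⟨hw, isMinOn_iff.2 fun x hx => ?_, isMinOn_iff.2 fun y hy => ?_,
    isMinOn_iff.2 fun l hl => ?_⟩
  · have := isMinOn_iff.1 hmin (x, w.2.1, w.2.2) ⟨hx, hw.2.1, hw.2.2⟩
    rw [A.mul_lForm_add_V, A.mul_lForm_add_V] at this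
    linarith
  · have := isMinOn_iff.1 hmin (w.1, y, w.2.2) ⟨hw.1, hy, hw.2.2⟩
    rw [A.mul_lForm_add_V, A.mul_lForm_add_V] at this
    linarith
  · have := isMinOn_iff.1 hmin (w.1, w.2.1, l) ⟨hw.1, hw.2.1, hl⟩
    rw [A.mul_lForm_add_V, A.mul_lForm_add_V] at this
    linarith

lemma Method.Admissible.proxStep_mem (hA : A.Admissible) (z γ : ℝ) (ut : E × ℝ × ℝ) (s : Ξ) :
    A.proxStep z γ ut s ∈ A.U := (hA.proxStep_spec z γ ut s).1

lemma Method.Admissible.smdIter_mem (hA : A.Admissible) (z : ℝ) (γ : ℕ → ℝ) (ξ : ℕ → Ξ) (t : ℕ) :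
    A.smdIter z γ ξ t ∈ A.U := by
  cases t with
  | zero => exact hA.start_mem
  | succ t => exact hA.proxStep_mem _ _ _ _

lemma Method.Admissible.V_nonneg (hA : A.Admissible) {u w : E × ℝ × ℝ} (hu : u ∈ A.U)
    (hw : w ∈ A.U) : 0 ≤ A.V u w :=
  add_nonneg (add_nonneg (hA.vX_valid.bregman_nonneg hu.1 hw.1)
    (hA.vY_valid.bregman_nonneg hu.2.1 hw.2.1)) (hA.vL_valid.bregman_nonneg hu.2.2 hw.2.2)

/-- One mirror descent step. -/
lemma Method.Admissible.proxStep_le (hA : A.Admissible) (z γ : ℝ) {ut u : E × ℝ × ℝ} (s : Ξ)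
    (hut : ut ∈ A.U) (hu : u ∈ A.U) :
    γ * A.lForm z ut s (ut - u) ≤
      A.V ut u - A.V (A.proxStep z γ ut s) u + γ ^ 2 / 2 * A.lSq z ut s := by
  obtain ⟨hw, h1, h2, h3⟩ := hA.proxStep_spec z γ ut s
  have e1 := hA.vX_valid.prox_step hA.standing.X_convex hut.1 hw.1 h1 hu.1
  have e2 := hA.vY_valid.prox_step (convex_Icc _ _) hut.2.1 hw.2.1 h2 hu.2.1
  have e3 := hA.vL_valid.prox_step (convex_Icc _ _) hut.2.2 hw.2.2 h3 hu.2.2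
  simp only [Method.ellX, Method.ellY, Method.ellL, smul_apply,
    ContinuousLinearMap.id_apply, smul_eq_mul, norm_smul, ContinuousLinearMap.norm_id,
    mul_pow, Real.norm_eq_abs, sq_abs, mul_one] at e1 e2 e3
  simp only [Method.lForm_eq, Method.V, Method.lSq, Prod.fst_sub, Prod.snd_sub]
  linarith

/-- The divergences telescope, and the last one is dropped because it is nonnegative. -/
lemma Method.Admissible.sum_lForm_le (hA : A.Admissible) (z γ : ℝ) (ξ : ℕ → Ξ)
    {u : E × ℝ × ℝ} (hu : u ∈ A.U) (T : ℕ) :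
    γ * ∑ t ∈ Finset.range T, A.lForm z (A.smdIter z (fun _ => γ) ξ t) (ξ t)
        (A.smdIter z (fun _ => γ) ξ t - u) ≤
      A.V (A.x₀, A.y₀, 0) u +
        γ ^ 2 / 2 * ∑ t ∈ Finset.range T, A.lSq z (A.smdIter z (fun _ => γ) ξ t) (ξ t) := by
  have key : ∀ n, γ * ∑ t ∈ Finset.range n, A.lForm z (A.smdIter z (fun _ => γ) ξ t) (ξ t)
        (A.smdIter z (fun _ => γ) ξ t - u) ≤
      A.V (A.x₀, A.y₀, 0) u - A.V (A.smdIter z (fun _ => γ) ξ n) u +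
        γ ^ 2 / 2 * ∑ t ∈ Finset.range n, A.lSq z (A.smdIter z (fun _ => γ) ξ t) (ξ t) := by
    intro n
    induction n with
    | zero => simp [Method.smdIter]
    | succ n ih =>
      rw [Finset.sum_range_succ, Finset.sum_range_succ, mul_add, mul_add]
      have := hA.proxStep_le z γ (ξ n) (hA.smdIter_mem z (fun _ => γ) ξ n) hu
      rw [show A.smdIter z (fun _ => γ) ξ (n + 1) =
        A.proxStep z γ (A.smdIter z (fun _ => γ) ξ n) (ξ n) from rfl]
      linarith
  have h1 := key T
  have h2 := hA.V_nonneg (hA.smdIter_mem z (fun _ => γ) ξ T) hu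
  linarith

end Prox

/-! ### Measurability of the iterates and outputs -/

section Measurability

variable {E Ξ Ω : Type*} [NormedAddCommGroup E] [NormedSpace ℝ E] [FiniteDimensional ℝ E]
  [MeasurableSpace E] [BorelSpace E] [MeasurableSpace Ξ] [mΩ : MeasurableSpace Ω] {A : Method E Ξ}

/-- The gradient is continuous only on `S` and arbitrary elsewhere, so measurability passes through
the restriction to the subtype. -/
lemma DistGen.IsValid.measurable_grad_comp {W : Type*} [NormedAddCommGroup W] [NormedSpace ℝ W]
    [MeasurableSpace W] [BorelSpace W] {v : DistGen W} {S : Set W} {L : ℝ} (hv : v.IsValid S L)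
    {X : Ω → W} (hX : Measurable X) (hXS : ∀ ω, X ω ∈ S) :
    Measurable (fun ω => v.grad (X ω)) := by
  have h1 : Measurable (S.domRestrict v.grad) :=
    (continuousOn_iff_continuous_domRestrict.1 hv.continuousOn_grad).measurable
  exact h1.comp (hX.subtype_mk (h := hXS))

variable {u : Ω → E × ℝ × ℝ} {ξ : Ω → Ξ}

lemma Method.Admissible.measurable_F_comp (hA : A.Admissible) (hu : Measurable u)
    (hξ : Measurable ξ) : Measurable (fun ω => A.Q.F (u ω).1 (ξ ω)) :=
  hA.standing.F_measurable.comp (hu.fst.prodMk hξ)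

lemma Method.Admissible.measurable_dF_comp (hA : A.Admissible) (hu : Measurable u)
    (hξ : Measurable ξ) : Measurable (fun ω => A.Q.dF (u ω).1 (ξ ω)) :=
  hA.standing.dF_measurable.comp (hu.fst.prodMk hξ)

lemma Method.Admissible.measurable_lX (hA : A.Admissible) (z : ℝ) (hu : Measurable u)
    (hξ : Measurable ξ) : Measurable (fun ω => A.lX z (u ω) (ξ ω)) := by
  have := hA.measurable_F_comp hu hξ
  unfold Method.lX
  fun_prop

lemma Method.Admissible.measurable_lY (hA : A.Admissible) (z : ℝ) (hu : Measurable u)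
    (hξ : Measurable ξ) : Measurable (fun ω => A.lY z (u ω) (ξ ω)) := by
  have := hA.measurable_F_comp hu hξ
  unfold Method.lY
  fun_prop

lemma Method.Admissible.measurable_lL (hA : A.Admissible) (hu : Measurable u)
    (hξ : Measurable ξ) : Measurable (fun ω => A.lL (u ω) (ξ ω)) := by
  have := hA.measurable_F_comp hu hξ
  unfold Method.lL
  fun_prop

lemma Method.Admissible.measurable_lSq (hA : A.Admissible) (z : ℝ) (hu : Measurable u)
    (hξ : Measurable ξ) : Measurable (fun ω => A.lSq z (u ω) (ξ ω)) :=
  ((((hA.measurable_lX z hu hξ).pow_const 2).mul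
    ((hA.measurable_dF_comp hu hξ).norm.pow_const 2)).add
      ((hA.measurable_lY z hu hξ).pow_const 2)).add ((hA.measurable_lL hu hξ).pow_const 2)

lemma Method.Admissible.measurable_dz (hA : A.Admissible) (z : ℝ) (hu : Measurable u)
    (hξ : Measurable ξ) : Measurable (fun ω => A.dz z (u ω) (ξ ω)) := by
  have := hA.measurable_F_comp hu hξ
  unfold Method.dz
  fun_prop

lemma measurable_clm_apply {X : Ω → E →L[ℝ] ℝ} {w : Ω → E} (hX : Measurable X)
    (hw : Measurable w) : Measurable (fun ω => X ω (w ω)) := by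
  have : Continuous fun q : (E →L[ℝ] ℝ) × E => q.1 q.2 := by fun_prop
  exact this.measurable.comp (hX.prodMk hw)

lemma Method.Admissible.measurable_lForm (hA : A.Admissible) (z : ℝ) {w : Ω → E × ℝ × ℝ}
    (hu : Measurable u) (hξ : Measurable ξ) (hw : Measurable w) :
    Measurable (fun ω => A.lForm z (u ω) (ξ ω) (w ω)) := by
  have h1 := hA.measurable_lX z hu hξ
  have h2 := hA.measurable_lY z hu hξ
  have h3 := hA.measurable_lL hu hξ
  have h4 := measurable_clm_apply (hA.measurable_dF_comp hu hξ) hw.fst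
  simp only [Method.lForm_eq]
  exact ((h1.mul h4).add (h2.mul hw.snd.fst)).add (h3.mul hw.snd.snd)

lemma Method.Admissible.measurable_proxStep (hA : A.Admissible) (z γ : ℝ) (hu : Measurable u)
    (huU : ∀ ω, u ω ∈ A.U) (hξ : Measurable ξ) :
    Measurable (fun ω => A.proxStep z γ (u ω) (ξ ω)) := by
  have hlX := hA.measurable_lX z hu hξ
  have hlY := hA.measurable_lY z hu hξ
  have hlL := hA.measurable_lL hu hξ
  have hdF := hA.measurable_dF_comp hu hξ
  have gX := hA.vX_valid.measurable_grad_comp hu.fst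
    fun ω => (huU ω).1
  have gY := hA.vY_valid.measurable_grad_comp hu.snd.fst fun ω => (huU ω).2.1
  have gL := hA.vL_valid.measurable_grad_comp hu.snd.snd fun ω => (huU ω).2.2
  have cX := hA.vX_valid.continuous_argmin hA.standing.X_compact hA.standing.X_convex
    ⟨_, hA.x₀_mem⟩
  have cY := hA.vY_valid.continuous_argmin isCompact_Icc (convex_Icc _ _) hA.Y_nonempty
  have cL := hA.vL_valid.continuous_argmin isCompact_Icc (convex_Icc _ _) ⟨0, by simp⟩
  -- The prox step is a choice among minimizers. By uniqueness it is the continuous `argmin` map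
  -- applied to a measurable linear form.
  have heq : (fun ω => A.proxStep z γ (u ω) (ξ ω)) = fun ω =>
      (A.vX.argmin A.Q.X (A.ellX z γ (u ω) (ξ ω) - A.vX.grad (u ω).1),
       A.vY.argmin A.Y (A.ellY z γ (u ω) (ξ ω) - A.vY.grad (u ω).2.1),
       A.vL.argmin (Set.Icc 0 1) (A.ellL γ (u ω) (ξ ω) - A.vL.grad (u ω).2.2)) := by
    funext ω
    obtain ⟨hw, h1, h2, h3⟩ := hA.proxStep_spec z γ (u ω) (ξ ω)
    rw [DistGen.isMinOn_bregman_iff] at h1 h2 h3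
    refine Prod.ext ?_ (Prod.ext ?_ ?_)
    · exact hA.vX_valid.eq_argmin hA.standing.X_compact hA.standing.X_convex hw.1 h1
    · exact hA.vY_valid.eq_argmin isCompact_Icc (convex_Icc _ _) hw.2.1 h2
    · exact hA.vL_valid.eq_argmin isCompact_Icc (convex_Icc _ _) hw.2.2 h3
  rw [heq]
  unfold Method.ellX Method.ellY Method.ellL
  refine (cX.measurable.comp ?_).prodMk ((cY.measurable.comp ?_).prodMk (cL.measurable.comp ?_))
  · exact ((hlX.const_mul γ).smul hdF).sub gX
  · exact ((hlY.const_mul γ).smul measurable_const).sub gY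
  · exact ((hlL.const_mul γ).smul measurable_const).sub gL

/-- Only samples with index below `t` are assumed measurable: with a smaller σ-algebra on `Ω` this
says that the iterates are adapted. -/
lemma Method.Admissible.measurable_smdIter (hA : A.Admissible) (z : ℝ) (γ : ℕ → ℝ)
    {ξ : Ω → ℕ → Ξ} (t : ℕ) (hξ : ∀ i < t, Measurable fun ω => ξ ω i) :
    Measurable (fun ω => A.smdIter z γ (ξ ω) t) := by
  induction t with
  | zero => exact measurable_const
  | succ t ih =>
    exact hA.measurable_proxStep z (γ t) (ih fun i hi => hξ i (by omega))
      (fun ω => hA.smdIter_mem z γ (ξ ω) t) (hξ t (by omega))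

lemma Method.Admissible.measurable_smdPoint (hA : A.Admissible) (z : ℝ) (γ : ℕ → ℝ) (T : ℕ)
    {ξ : Ω → ℕ → Ξ} (hξ : ∀ i, Measurable fun ω => ξ ω i) :
    Measurable (fun ω => A.smdPoint z T γ (ξ ω)) := by
  unfold Method.smdPoint
  have h : Measurable fun ω => ∑ t ∈ Finset.range T, γ t • A.smdIter z γ (ξ ω) t :=
    Finset.measurable_fun_sum _ fun t _ =>
      (measurable_const_smul (γ t)).comp (hA.measurable_smdIter z γ t fun i _ => hξ i)
  exact (measurable_const_smul _).comp h

lemma Method.Admissible.measurable_smdSlope (hA : A.Admissible) (z : ℝ) (γ : ℕ → ℝ) (T : ℕ)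
    {ξ η : Ω → ℕ → Ξ} (hξ : ∀ i, Measurable fun ω => ξ ω i)
    (hη : ∀ i, Measurable fun ω => η ω i) :
    Measurable (fun ω => A.smdSlope z T γ (ξ ω) (η ω)) := by
  unfold Method.smdSlope
  refine (Finset.measurable_fun_sum _ fun t _ => ?_).const_mul _
  exact (hA.measurable_dz z (hA.measurable_smdIter z γ t fun i _ => hξ i) (hη t)).const_mul _

end Measurability

/-! ### Elementary moment inequalities -/

lemma integral_sub_integral_sq_le {Ξ : Type*} [MeasurableSpace Ξ] {P : Measure Ξ}
    [IsProbabilityMeasure P] {Y : Ξ → ℝ} (hY : MemLp Y 2 P) :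
    ∫ s, (Y s - ∫ r, Y r ∂P) ^ 2 ∂P ≤ ∫ s, Y s ^ 2 ∂P := by
  have h := variance_le_expectation_sq hY.1
  rw [variance_eq_integral hY.1.aemeasurable] at h
  simpa using h

lemma sq_integral_le {Ξ : Type*} [MeasurableSpace Ξ] {P : Measure Ξ}
    [IsProbabilityMeasure P] {Y : Ξ → ℝ} (hY : MemLp Y 2 P) :
    (∫ s, Y s ∂P) ^ 2 ≤ ∫ s, Y s ^ 2 ∂P := by
  have h := variance_eq_sub hY
  have h2 := variance_nonneg Y P
  rw [h] at h2
  simp only [Pi.pow_apply] at h2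
  linarith

lemma integral_mul_add_mul_add {Ξ : Type*} [MeasurableSpace Ξ] {P : Measure Ξ}
    [IsProbabilityMeasure P] {f g : Ξ → ℝ} (hf : Integrable f P) (hg : Integrable g P) (a b d : ℝ) :
    ∫ s, (a * f s + b * g s + d) ∂P = a * ∫ s, f s ∂P + b * ∫ s, g s ∂P + d := by
  have h1 : Integrable (fun s => a * f s + b * g s) P := (hf.const_mul a).add (hg.const_mul b)
  rw [integral_add h1 (integrable_const _), integral_add (hf.const_mul a) (hg.const_mul b),
    integral_const_mul, integral_const_mul]
  simp

/-! ### The saddle function and its relation to the objective -/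

section Saddle

variable {E Ξ : Type*} [NormedAddCommGroup E] [NormedSpace ℝ E] [FiniteDimensional ℝ E]
  [MeasurableSpace E] [BorelSpace E] [MeasurableSpace Ξ]

/-- The sampled saddle function `(c / z) (F(x, s) - y)_+ ^ 2 + y + (c / 4) z + lam (F(x, s) - y)`
at `u = (x, y, lam)`. -/
def Method.Phi (A : Method E Ξ) (z : ℝ) (u : E × ℝ × ℝ) (s : Ξ) : ℝ :=
  A.p.c / z * (max (A.Q.F u.1 s - u.2.1) 0) ^ 2 + u.2.1 + A.p.c * z / 4
    + u.2.2 * (A.Q.F u.1 s - u.2.1)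

/-- The expected saddle function. -/
def Method.phi (A : Method E Ξ) (z : ℝ) (u : E × ℝ × ℝ) : ℝ := ∫ s, A.Phi z u s ∂A.Q.law

/-- The expectation of `l'_z(u)` at `u - v`. -/
def Method.J (A : Method E Ξ) (z : ℝ) (u v : E × ℝ × ℝ) : ℝ := ∫ s, A.lForm z u s (u - v) ∂A.Q.law

/-- The expected subgradient in `z`. -/
def Method.slopeMean (A : Method E Ξ) (z : ℝ) (u : E × ℝ × ℝ) : ℝ := ∫ s, A.dz z u s ∂A.Q.law

variable {A : Method E Ξ}

/-- The tangent-plane inequality of the perspective function `q² / z`, whose gradient is `(2 p,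
-p²)` with `p` the ratio at the point of tangency. -/
lemma two_mul_le_div_add {p q z : ℝ} (hz : 0 < z) : 2 * p * q ≤ q ^ 2 / z + z * p ^ 2 := by
  rw [div_add' _ _ _ hz.ne', le_div_iff₀ hz]
  nlinarith [sq_nonneg (q - p * z)]

/-- The joint subgradient inequality for the sampled saddle function. -/
lemma Method.Admissible.Phi_sub_le (hA : A.Admissible) {z z' : ℝ} (hz : 0 < z)
    {u v : E × ℝ × ℝ} (hu : u.1 ∈ A.Q.X) (hul : 0 ≤ u.2.2) (hv : v.1 ∈ A.Q.X) (s : Ξ)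
    (hz' : 0 < z' ∨ z' = 0 ∧ max (A.Q.F v.1 s - v.2.1) 0 = 0) :
    A.Phi z (u.1, u.2.1, v.2.2) s - A.Phi z' (v.1, v.2.1, u.2.2) s ≤
      A.lForm z u s (u - v) + (z - z') * A.dz z u s := by
  have hc := hA.params.c_pos
  have hsub := hA.standing.dF_subgradient s _ hu _ hv
  have hneg : A.Q.dF u.1 s (v.1 - u.1) = - A.Q.dF u.1 s (u.1 - v.1) := by rw [← map_neg, neg_sub]
  simp only [Method.Phi, Method.lForm_eq, Method.lX, Method.lY, Method.lL, Method.dz,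
    Prod.fst_sub, Prod.snd_sub]
  set D := A.Q.dF u.1 s (u.1 - v.1)
  set Fu := A.Q.F u.1 s
  set Fv := A.Q.F v.1 s
  -- With `p = (F - y)_+ / z` the partial slopes of the perspective term become polynomials in `p`,
  -- free of denominators.
  obtain ⟨p, hp⟩ : ∃ p, max (Fu - u.2.1) 0 = p * z := ⟨_, (div_mul_cancel₀ _ hz.ne').symm⟩
  have hp0 : 0 ≤ p := by
    have : 0 ≤ p * z := hp ▸ le_max_right _ _
    exact nonneg_of_mul_nonneg_left this hz
  have hpF : p * (Fu - u.2.1) = p * (p * z) := by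
    rcases le_total (Fu - u.2.1) 0 with h | h
    · rw [max_eq_right h] at hp
      rcases mul_eq_zero.1 hp.symm with h | h
      · simp [h]
      · exact absurd h hz.ne'
    · rw [max_eq_left h] at hp; rw [hp]
  have hq : p * (Fv - v.2.1) ≤ p * max (Fv - v.2.1) 0 := by gcongr; exact le_max_left _ _
  have hpd : p * (Fu - D - Fv) ≤ 0 := mul_nonpos_of_nonneg_of_nonpos hp0 (by linarith)
  have hld : u.2.2 * (Fu - D - Fv) ≤ 0 := mul_nonpos_of_nonneg_of_nonpos hul (by linarith)
  -- At `z' = 0` the quotient is 0 by the convention for division by zero, and the inequality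
  -- survives because the upper deviation vanishes there.
  have hkey : 2 * p * max (Fv - v.2.1) 0 ≤ (max (Fv - v.2.1) 0) ^ 2 / z' + z' * p ^ 2 := by
    rcases hz' with h | ⟨rfl, h⟩
    · exact two_mul_le_div_add h
    · simp [h]
  rw [hp]
  have e1 : A.p.c / z * (p * z) ^ 2 = A.p.c * (p ^ 2 * z) := by field_simp
  have e2 : 2 * A.p.c / z * (p * z) = A.p.c * (2 * p) := by field_simp
  have e3 : -(2 * A.p.c / z) * (p * z) = -(A.p.c * (2 * p)) := by field_simp
  have e4 : -(A.p.c / z ^ 2) * (p * z) ^ 2 = -(A.p.c * p ^ 2) := by field_simp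
  have e5 : A.p.c / z' * max (Fv - v.2.1) 0 ^ 2 = A.p.c * (max (Fv - v.2.1) 0 ^ 2 / z') := by ring
  rw [e1, e2, e3, e4, e5]
  -- A nonnegative combination of the slacks: the tangent plane, `F - y ≤ (F - y)_+` at `v`, the
  -- subgradient of `F`, and `p (F - y) = p² z` at `u`.
  have hfin : 0 ≤ A.p.c * ((max (Fv - v.2.1) 0) ^ 2 / z' + z' * p ^ 2
      - 2 * p * max (Fv - v.2.1) 0 + 2 * (p * max (Fv - v.2.1) 0 - p * (Fv - v.2.1))
      - 2 * (p * (Fu - D - Fv)) + 2 * (p * (Fu - u.2.1) - p * (p * z))) :=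
    mul_nonneg hc.le (by linarith)
  linarith

section Moments

variable (hA : A.Admissible) {x : E} (hx : x ∈ A.Q.X)
include hA hx

lemma Method.Admissible.measurable_F (x : E) : Measurable (A.Q.F x) :=
  hA.standing.F_measurable.comp measurable_prodMk_left

lemma Method.Admissible.memLp_F_sub (b : ℝ) : MemLp (fun s => A.Q.F x s - b) 2 A.Q.law := by
  have := hA.standing.law_prob
  have hm := hA.measurable_F hx x
  have h1 : MemLp (fun s => A.Q.F x s - A.Q.f x) 2 A.Q.law :=
    (memLp_two_iff_integrable_sq (hm.sub_const _).aestronglyMeasurable).2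
      (hA.standing.F_sq_integrable x hx)
  have h2 := h1.add (memLp_const (A.Q.f x - b))
  refine h2.ae_eq (ae_of_all _ fun s => ?_)
  simp

lemma Method.Admissible.memLp_max (b : ℝ) :
    MemLp (fun s => max (A.Q.F x s - b) 0) 2 A.Q.law := by
  have hm := hA.measurable_F hx x
  refine (hA.memLp_F_sub hx b).mono ((hm.sub_const _).max measurable_const).aestronglyMeasurable
    (ae_of_all _ fun s => ?_)
  rw [Real.norm_eq_abs, Real.norm_eq_abs, abs_of_nonneg (le_max_right _ _)]
  exact max_le (le_abs_self _) (abs_nonneg _)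

lemma Method.Admissible.integral_F_sub (b : ℝ) :
    ∫ s, (A.Q.F x s - b) ∂A.Q.law = A.Q.f x - b := by
  have := hA.standing.law_prob
  rw [integral_sub (hA.standing.F_integrable x hx) (integrable_const _)]
  simp [Problem.f]

lemma Method.Admissible.integral_F_sub_sq (b : ℝ) :
    ∫ s, (A.Q.F x s - b) ^ 2 ∂A.Q.law =
      ∫ s, (A.Q.F x s - A.Q.f x) ^ 2 ∂A.Q.law + (A.Q.f x - b) ^ 2 := by
  have := hA.standing.law_prob
  have h1 := hA.integral_F_sub hx (A.Q.f x)
  have h2 : Integrable (fun s => (A.Q.F x s - A.Q.f x)) A.Q.law :=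
    (hA.standing.F_integrable x hx).sub (integrable_const _)
  have h3 := hA.standing.F_sq_integrable x hx
  have h4 := integral_mul_add_mul_add h3 h2 1 (2 * (A.Q.f x - b)) ((A.Q.f x - b) ^ 2)
  rw [h1, sub_self, mul_zero, add_zero, one_mul] at h4
  rw [← h4]
  congr 1; ext s; ring

lemma Method.Admissible.integral_F_sub_sq_le {b : ℝ} (hb : |A.Q.f x - b| ≤ 2 * A.p.R) :
    ∫ s, (A.Q.F x s - b) ^ 2 ∂A.Q.law ≤ A.p.β ^ 2 + 4 * A.p.R ^ 2 := by
  rw [hA.integral_F_sub_sq hx]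
  have h1 := hA.standing.F_variance x hx
  have h2 : (A.Q.f x - b) ^ 2 ≤ (2 * A.p.R) ^ 2 := sq_le_sq' (abs_le.1 hb).1 (abs_le.1 hb).2
  nlinarith

lemma Method.Admissible.memLp_dF_apply (v : E) : MemLp (fun s => A.Q.dF x s v) 2 A.Q.law := by
  have := hA.standing.law_prob
  have hm : Measurable (A.Q.dF x) := hA.standing.dF_measurable.comp measurable_prodMk_left
  have h1 : MemLp (fun s => ‖A.Q.dF x s - A.Q.df x‖) 2 A.Q.law :=
    (memLp_two_iff_integrable_sq (hm.sub_const _).norm.aestronglyMeasurable).2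
      (hA.standing.dF_sq_integrable x hx)
  have h2 := (h1.add (memLp_const ‖A.Q.df x‖)).mul_const ‖v‖
  refine h2.mono (hm.apply_continuousLinearMap v).aestronglyMeasurable (ae_of_all _ fun s => ?_)
  refine ((A.Q.dF x s).le_opNorm v).trans ?_
  rw [Real.norm_eq_abs]
  refine le_trans ?_ (le_abs_self _)
  simp only [Pi.add_apply]
  gcongr
  simpa using norm_add_le (A.Q.dF x s - A.Q.df x) (A.Q.df x)

lemma Method.Admissible.integrable_Phi (z y l : ℝ) :
    Integrable (A.Phi z (x, y, l)) A.Q.law := by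
  have := hA.standing.law_prob
  unfold Method.Phi
  exact ((((hA.memLp_max hx y).integrable_sq.const_mul _).add (integrable_const _)).add
    (integrable_const _)).add (((hA.memLp_F_sub hx y).integrable one_le_two).const_mul _)

lemma Method.Admissible.phi_eq (z y l : ℝ) :
    A.phi z (x, y, l) = A.p.c / z * ∫ s, (max (A.Q.F x s - y) 0) ^ 2 ∂A.Q.law + y
      + A.p.c * z / 4 + l * (A.Q.f x - y) := by
  have := hA.standing.law_prob
  have h1 := (hA.memLp_max hx y).integrable_sq
  have h2 : Integrable (fun s => A.Q.F x s - y) A.Q.law :=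
    (hA.memLp_F_sub hx y).integrable one_le_two
  have h3 := integral_mul_add_mul_add h1 h2 (A.p.c / z) l (y + A.p.c * z / 4)
  rw [hA.integral_F_sub hx] at h3
  rw [show A.p.c / z * ∫ s, (max (A.Q.F x s - y) 0) ^ 2 ∂A.Q.law + y + A.p.c * z / 4
    + l * (A.Q.f x - y) = A.p.c / z * ∫ s, (max (A.Q.F x s - y) 0) ^ 2 ∂A.Q.law
    + l * (A.Q.f x - y) + (y + A.p.c * z / 4) by ring, ← h3]
  unfold Method.phi Method.Phi
  congr 1; ext s; ring

lemma Method.Admissible.memLp_lY (z y l : ℝ) : MemLp (A.lY z (x, y, l)) 2 A.Q.law := by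
  have := hA.standing.law_prob
  refine (((hA.memLp_max hx y).const_mul (-(2 * A.p.c / z))).add (memLp_const (1 - l))).ae_eq
    (ae_of_all _ fun s => ?_)
  simp [Method.lY]; ring

lemma Method.Admissible.memLp_lX (z y l : ℝ) : MemLp (A.lX z (x, y, l)) 2 A.Q.law := by
  have := hA.standing.law_prob
  exact ((hA.memLp_max hx y).const_mul (2 * A.p.c / z)).add (memLp_const l)

lemma Method.Admissible.memLp_lL (y l : ℝ) : MemLp (A.lL (x, y, l)) 2 A.Q.law := by
  refine (hA.memLp_F_sub hx y).neg.ae_eq (ae_of_all _ fun s => ?_)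
  simp [Method.lL]; ring

lemma Method.Admissible.integrable_lForm (z y l : ℝ) (w : E × ℝ × ℝ) :
    Integrable (fun s => A.lForm z (x, y, l) s w) A.Q.law := by
  have := hA.standing.law_prob
  simp only [Method.lForm_eq]
  exact (((hA.memLp_lX hx z y l).integrable_mul (hA.memLp_dF_apply hx w.1)).add
    (((hA.memLp_lY hx z y l).integrable one_le_two).mul_const _)).add
    (((hA.memLp_lL hx y l).integrable one_le_two).mul_const _)

lemma Method.Admissible.integrable_dz (z y l : ℝ) :
    Integrable (A.dz z (x, y, l)) A.Q.law := by
  have := hA.standing.law_prob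
  exact ((hA.memLp_max hx y).integrable_sq.const_mul _).add (integrable_const _)

end Moments

/-- The joint subgradient inequality for the expected saddle function. -/
lemma Method.Admissible.phi_sub_le (hA : A.Admissible) {z z' : ℝ} (hz : 0 < z)
    {u v : E × ℝ × ℝ} (hu : u.1 ∈ A.Q.X) (hul : 0 ≤ u.2.2) (hv : v.1 ∈ A.Q.X)
    (hz' : 0 < z' ∨ z' = 0 ∧ ∀ᵐ s ∂A.Q.law, max (A.Q.F v.1 s - v.2.1) 0 = 0) :
    A.phi z (u.1, u.2.1, v.2.2) - A.phi z' (v.1, v.2.1, u.2.2) ≤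
      A.J z u v + (z - z') * A.slopeMean z u := by
  have hi1 := hA.integrable_Phi hu z u.2.1 v.2.2
  have hi2 := hA.integrable_Phi hv z' v.2.1 u.2.2
  have hi3 := hA.integrable_lForm hu z u.2.1 u.2.2 (u - v)
  have hi4 := (hA.integrable_dz hu z u.2.1 u.2.2).const_mul (z - z')
  have hae : ∀ᵐ s ∂A.Q.law, A.Phi z (u.1, u.2.1, v.2.2) s - A.Phi z' (v.1, v.2.1, u.2.2) s ≤
      A.lForm z u s (u - v) + (z - z') * A.dz z u s := by
    rcases hz' with h | ⟨h0, h⟩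
    · exact ae_of_all _ fun s => hA.Phi_sub_le hz hu hul hv s (Or.inl h)
    · filter_upwards [h] with s hs
      exact hA.Phi_sub_le hz hu hul hv s (Or.inr ⟨h0, hs⟩)
  have := integral_mono_ae (hi1.sub hi2) (hi3.add hi4) hae
  simp only [Pi.sub_apply, Pi.add_apply] at this
  rw [integral_sub hi1 hi2, integral_add hi3 hi4, integral_const_mul] at this
  exact this

/-- Linearity of `J` in the direction, in the form needed for Jensen: directions that cancel
contribute nothing. -/
lemma Method.Admissible.J_add_smul (hA : A.Admissible) {z : ℝ} {u : E × ℝ × ℝ} (hu : u.1 ∈ A.Q.X)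
    {ι : Type*} (I : Finset ι) (w : ι → ℝ) (v : ι → E × ℝ × ℝ)
    (h : ∑ i ∈ I, w i • (u - v i) = 0) : ∑ i ∈ I, w i * A.J z u (v i) = 0 := by
  simp only [Method.J, ← integral_const_mul]
  rw [← integral_finsetSum _ fun i _ => (hA.integrable_lForm hu z u.2.1 u.2.2 _).const_mul _]
  have : ∀ s, ∑ i ∈ I, w i * A.lForm z u s (u - v i) = 0 := by
    intro s
    have hlin : ∑ i ∈ I, w i * A.lForm z u s (u - v i)
        = A.lForm z u s (∑ i ∈ I, w i • (u - v i)) := by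
      simp only [Method.lForm_eq, Prod.fst_sum, Prod.snd_sum, map_sum, Prod.smul_fst,
        Prod.smul_snd, Finset.mul_sum, map_smul, smul_eq_mul, ← Finset.sum_add_distrib]
      exact Finset.sum_congr rfl fun i _ => by ring
    rw [hlin, h]
    simp [Method.lForm_eq]
  simp [this]

lemma Problem.g_nonneg (Q : Problem E Ξ) (x : E) : 0 ≤ Q.g x :=
  integral_nonneg fun _ => by positivity

lemma mul_sqrt_le {c g z : ℝ} (hc : 0 < c) (hz : 0 < z) (hg : 0 ≤ g) :
    c * √g ≤ c / z * g + c * z / 4 := by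
  have h := two_mul_le_div_add (p := 1 / 2) (q := √g) hz
  rw [Real.sq_sqrt hg] at h
  have := mul_le_mul_of_nonneg_left h hc.le
  calc c * √g = c * (2 * (1 / 2) * √g) := by ring
    _ ≤ _ := this
    _ = _ := by ring

/-- The objective is dominated by the saddle function at one of the extreme multipliers. -/
lemma Method.Admissible.h_le_phi (hA : A.Admissible) {z : ℝ} (hz : 0 < z) {x : E}
    (hx : x ∈ A.Q.X) (y : ℝ) :
    ∃ l : ℝ, (l = 0 ∨ l = 1) ∧ A.Q.h A.p.c x ≤ A.phi z (x, y, l) := by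
  have := hA.standing.law_prob
  have hc := hA.params.c_pos
  have hG : 0 ≤ ∫ s, (max (A.Q.F x s - y) 0) ^ 2 ∂A.Q.law := integral_nonneg fun _ => by positivity
  have hi := (hA.memLp_max hx y).integrable_sq
  have hi0 := (hA.memLp_max hx (A.Q.f x)).integrable_sq
  unfold Problem.h
  -- If `y ≤ f(x)`, the multiplier 1 replaces `y` by `f(x)` in the linear part, and lowering the
  -- threshold only increases the deviation. If `y ≥ f(x)`, the multiplier 0 keeps `y`, whose excess
  -- over `f(x)` pays for the deviation lost by raising the threshold.
  rcases le_total y (A.Q.f x) with h | h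
  · refine ⟨1, Or.inr rfl, ?_⟩
    rw [hA.phi_eq hx]
    have hle : A.Q.g x ≤ ∫ s, (max (A.Q.F x s - y) 0) ^ 2 ∂A.Q.law := by
      refine integral_mono hi0 hi fun s => ?_
      simp only
      gcongr
    have h1 := mul_sqrt_le hc hz (A.Q.g_nonneg x)
    have h2 : A.p.c / z * A.Q.g x ≤ A.p.c / z * ∫ s, (max (A.Q.F x s - y) 0) ^ 2 ∂A.Q.law := by
      gcongr
    linarith
  · refine ⟨0, Or.inl rfl, ?_⟩
    rw [hA.phi_eq hx]
    have h1 := mul_sqrt_le hc hz hG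
    set G := ∫ s, (max (A.Q.F x s - y) 0) ^ 2 ∂A.Q.law
    -- Minkowski's inequality for `(F - f)_+ ≤ (F - y)_+ + (y - f)`, written out in squares.
    have hsq : A.Q.g x ≤ (√G + (y - A.Q.f x)) ^ 2 := by
      have hi1 : Integrable (fun s => max (A.Q.F x s - y) 0) A.Q.law :=
        (hA.memLp_max hx y).integrable one_le_two
      have hE : ∫ s, max (A.Q.F x s - y) 0 ∂A.Q.law ≤ √G :=
        Real.le_sqrt_of_sq_le (sq_integral_le (hA.memLp_max hx y))
      have hle : A.Q.g x ≤ ∫ s, (1 * (max (A.Q.F x s - y) 0) ^ 2 +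
          2 * (y - A.Q.f x) * max (A.Q.F x s - y) 0 + (y - A.Q.f x) ^ 2) ∂A.Q.law := by
        refine integral_mono hi0
          (((hi.const_mul 1).add (hi1.const_mul _)).add (integrable_const _)) fun s => ?_
        simp only
        have : max (A.Q.F x s - A.Q.f x) 0 ≤ max (A.Q.F x s - y) 0 + (y - A.Q.f x) :=
          max_le (by linarith [le_max_left (A.Q.F x s - y) 0])
            (by linarith [le_max_right (A.Q.F x s - y) 0])
        have h0 := le_max_right (A.Q.F x s - A.Q.f x) 0
        nlinarith
      rw [integral_mul_add_mul_add hi hi1, one_mul] at hle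
      have := Real.sq_sqrt hG
      nlinarith
    have h2 : √(A.Q.g x) ≤ √G + (y - A.Q.f x) :=
      (Real.sqrt_le_sqrt hsq).trans_eq
        (Real.sqrt_sq (add_nonneg (Real.sqrt_nonneg _) (by linarith)))
    have h3 : A.p.c * √(A.Q.g x) ≤ A.p.c * √G + A.p.c * (y - A.Q.f x) := by
      rw [← mul_add]; gcongr
    -- `c ≤ 1` is what makes the gap `y - f(x)` large enough.
    have h4 : A.p.c * (y - A.Q.f x) ≤ 1 * (y - A.Q.f x) :=
      mul_le_mul_of_nonneg_right hA.params.c_le_one (by linarith)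
    linarith

/-- The saddle function at `(x, f(x))` exceeds the objective by `c (z - 2 √g(x)) ^ 2 / (4 z)`. -/
lemma Method.Admissible.phi_mean (hA : A.Admissible) {z : ℝ} (hz : 0 < z) {x : E}
    (hx : x ∈ A.Q.X) (l : ℝ) :
    A.phi z (x, A.Q.f x, l) = A.Q.h A.p.c x + A.p.c * (z - 2 * √(A.Q.g x)) ^ 2 / (4 * z) := by
  rw [hA.phi_eq hx]
  unfold Problem.h
  change A.p.c / z * A.Q.g x + _ + _ + _ = _
  have := Real.sq_sqrt (A.Q.g_nonneg x)
  rw [← this]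
  simp only [Real.sqrt_sq (Real.sqrt_nonneg _)]
  field_simp
  ring

lemma Method.Admissible.phi_opt (hA : A.Admissible) {x : E} (hx : x ∈ A.Q.X) (l : ℝ) :
    A.phi (2 * √(A.Q.g x)) (x, A.Q.f x, l) = A.Q.h A.p.c x := by
  rcases (Real.sqrt_nonneg (A.Q.g x)).eq_or_lt with h | h
  · rw [hA.phi_eq hx, ← h]
    simp [Problem.h, ← h]
  · rw [hA.phi_mean (by positivity) hx]
    simp

lemma Method.Admissible.ae_max_eq_zero (hA : A.Admissible) {x : E} (hx : x ∈ A.Q.X)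
    (h : 2 * √(A.Q.g x) = 0) : ∀ᵐ s ∂A.Q.law, max (A.Q.F x s - A.Q.f x) 0 = 0 := by
  have h1 : A.Q.g x = 0 := by
    have : √(A.Q.g x) = 0 := by linarith
    exact (Real.sqrt_eq_zero (A.Q.g_nonneg x)).1 this
  have h2 := (integral_eq_zero_iff_of_nonneg (fun s => by positivity)
    (hA.memLp_max hx (A.Q.f x)).integrable_sq).1 h1
  filter_upwards [h2] with s hs
  exact pow_eq_zero_iff two_ne_zero |>.1 hs

lemma Method.Admissible.g_le (hA : A.Admissible) {x : E} (hx : x ∈ A.Q.X) :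
    A.Q.g x ≤ A.p.β ^ 2 := by
  refine (integral_mono (hA.memLp_max hx _).integrable_sq (hA.standing.F_sq_integrable x hx)
    fun s => ?_).trans (hA.standing.F_variance x hx)
  simp only
  rw [← sq_abs (A.Q.F x s - A.Q.f x)]
  gcongr
  exact max_le (le_abs_self _) (abs_nonneg _)

lemma Method.Admissible.abs_f_sub_le (hA : A.Admissible) {u : E × ℝ × ℝ} (hu : u ∈ A.U) :
    |A.Q.f u.1 - u.2.1| ≤ 2 * A.p.R := by
  have h1 := abs_le.1 (hA.f_near u.1 hu.1)
  obtain ⟨h2, h3⟩ := hu.2.1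
  rw [abs_le]; constructor <;> linarith

lemma Method.Admissible.max_le_add (hA : A.Admissible) {u : E × ℝ × ℝ} (hu : u ∈ A.U) (s : Ξ) :
    max (A.Q.F u.1 s - u.2.1) 0 ≤ max (A.Q.F u.1 s - A.Q.f u.1) 0 + 2 * A.p.R := by
  have h1 := abs_le.1 (hA.abs_f_sub_le hu)
  have h2 := hA.params.R_pos
  exact max_le (by linarith [le_max_left (A.Q.F u.1 s - A.Q.f u.1) 0])
    (by linarith [le_max_right (A.Q.F u.1 s - A.Q.f u.1) 0])

end Saddle

/-! ### Second moments of the stochastic subgradients -/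

section MomentBounds

variable {E Ξ : Type*} [NormedAddCommGroup E] [NormedSpace ℝ E] [FiniteDimensional ℝ E]
  [MeasurableSpace E] [BorelSpace E] [MeasurableSpace Ξ] {A : Method E Ξ}

lemma Params.M_sq (p : Params) (z : ℝ) : p.M z ^ 2 =
    3 * p.c ^ 2 / z ^ 2 *
        (p.LG ^ 2 + (4 * p.Lf ^ 2 + 1) * p.β ^ 2
          + 16 * (4 * (p.Lf ^ 2 + p.σf ^ 2) + 1) * p.R ^ 2)
      + 12 * (p.Lf ^ 2 + p.σf ^ 2) + 8 * p.R ^ 2 + 2 * p.β ^ 2 + 3 :=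
  Real.sq_sqrt (by positivity)

lemma Params.M_pos (p : Params) (z : ℝ) : 0 < p.M z := Real.sqrt_pos.2 (by positivity)

lemma Params.Valid.DV_sq {p : Params} (hp : p.Valid) :
    p.DV ^ 2 = p.Lv / 2 * (p.DX ^ 2 + 4 * p.R ^ 2 + 1) :=
  Real.sq_sqrt (by have := hp.Lv_pos; positivity)

lemma Params.Valid.DV_pos {p : Params} (hp : p.Valid) : 0 < p.DV :=
  Real.sqrt_pos.2 (by have := hp.Lv_pos; positivity)

/-- The squared Euclidean combination of the norms of the three blocks. -/
def normSq (w : E × ℝ × ℝ) : ℝ := ‖w.1‖ ^ 2 + w.2.1 ^ 2 + w.2.2 ^ 2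

lemma Method.Admissible.normSq_sub_le (hA : A.Admissible) {u v : E × ℝ × ℝ} (hu : u ∈ A.U)
    (hv : v ∈ A.U) : normSq (u - v) ≤ 2 * A.p.DV ^ 2 := by
  have hL := hA.vL_valid.one_le_of_Icc
  rw [hA.params.DV_sq]
  have h1 : ‖u.1 - v.1‖ ^ 2 ≤ A.p.DX ^ 2 := by
    gcongr; exact hA.standing.X_diam _ hu.1 _ hv.1
  obtain ⟨hu1, hu2⟩ := hu.2.1
  obtain ⟨hv1, hv2⟩ := hv.2.1
  obtain ⟨hu3, hu4⟩ := hu.2.2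
  obtain ⟨hv3, hv4⟩ := hv.2.2
  have h2 : (u.2.1 - v.2.1) ^ 2 ≤ (2 * A.p.R) ^ 2 := sq_le_sq' (by linarith) (by linarith)
  have h3 : (u.2.2 - v.2.2) ^ 2 ≤ 1 ^ 2 := sq_le_sq' (by linarith) (by linarith)
  simp only [normSq, Prod.fst_sub, Prod.snd_sub]
  have h4 : 0 ≤ A.p.DX ^ 2 + 4 * A.p.R ^ 2 + 1 := by positivity
  nlinarith

lemma Method.Admissible.V_start_le (hA : A.Admissible) {u : E × ℝ × ℝ} (hu : u ∈ A.U) :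
    A.V (A.x₀, A.y₀, 0) u ≤ 2 * A.p.DV ^ 2 := by
  have hL := hA.params.Lv_pos
  have hs := hA.start_mem
  rw [hA.params.DV_sq]
  have h1 := hA.vX_valid.bregman_le hs.1 hu.1
  have h2 := hA.vY_valid.bregman_le hs.2.1 hu.2.1
  have h3 := hA.vL_valid.bregman_le hs.2.2 hu.2.2
  obtain ⟨hu1, hu2⟩ := hu.2.1
  obtain ⟨hu3, hu4⟩ := hu.2.2
  have e1 : ‖A.x₀ - u.1‖ ^ 2 ≤ A.p.DX ^ 2 := by
    gcongr; exact hA.standing.X_diam _ hA.x₀_mem _ hu.1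
  have e2 : (A.y₀ - u.2.1) ^ 2 ≤ (2 * A.p.R) ^ 2 := by
    have := hA.params.R_pos
    exact sq_le_sq' (by linarith) (by linarith)
  have e3 : (0 - u.2.2) ^ 2 ≤ 1 ^ 2 := sq_le_sq' (by linarith) (by linarith)
  simp only [Real.norm_eq_abs, sq_abs] at h1 h2 h3
  simp only [Method.V]
  have f1 := mul_le_mul_of_nonneg_left e1 hL.le
  have f2 := mul_le_mul_of_nonneg_left e2 hL.le
  have f3 := mul_le_mul_of_nonneg_left e3 hL.le
  linarith

/-- Cauchy-Schwarz across the three blocks, each paired with its dual norm. -/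
lemma Method.lForm_sq_le (A : Method E Ξ) (z : ℝ) (u : E × ℝ × ℝ) (s : Ξ) (w : E × ℝ × ℝ) :
    (A.lForm z u s w) ^ 2 ≤ A.lSq z u s * normSq w := by
  rw [Method.lForm_eq]
  unfold Method.lSq normSq
  have h1 : (A.Q.dF u.1 s w.1) ^ 2 ≤ ‖A.Q.dF u.1 s‖ ^ 2 * ‖w.1‖ ^ 2 := by
    rw [← mul_pow, ← sq_abs]
    gcongr
    simpa using (A.Q.dF u.1 s).le_opNorm w.1
  set a := A.lX z u s
  set b := A.lY z u s
  set d := A.lL u s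
  set n := ‖A.Q.dF u.1 s‖
  set t := A.Q.dF u.1 s w.1
  set m := ‖w.1‖
  have ht : |t| ≤ n * m := abs_le_of_sq_le_sq (by rwa [mul_pow]) (by positivity)
  have h2 : |a * t + b * w.2.1 + d * w.2.2| ≤ |a| * n * m + |b| * |w.2.1| + |d| * |w.2.2| := by
    refine (abs_add_three _ _ _).trans ?_
    rw [abs_mul, abs_mul, abs_mul, mul_assoc]
    gcongr
  calc (a * t + b * w.2.1 + d * w.2.2) ^ 2
      ≤ (|a| * n * m + |b| * |w.2.1| + |d| * |w.2.2|) ^ 2 := by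
        rw [← sq_abs]; gcongr
    _ ≤ ((|a| * n) ^ 2 + |b| ^ 2 + |d| ^ 2) * (m ^ 2 + |w.2.1| ^ 2 + |w.2.2| ^ 2) := by
        nlinarith [sq_nonneg (|a| * n * |w.2.1| - |b| * m), sq_nonneg (|a| * n * |w.2.2| - |d| * m),
          sq_nonneg (|b| * |w.2.2| - |d| * |w.2.1|)]
    _ = _ := by simp only [mul_pow, sq_abs]

/-- The delicate term is `(F - y)_+ ‖F'‖`, a product that separate variances do not control.
Replacing `y` by `f(x)` costs `2 R ‖F'‖`, and then `2 (F - f)_+ ‖F'‖ ≤ ‖G'‖ + 2 Lf (F - f)_+`. The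
summands are grouped in the shape of `integral_mul_add_mul_add`. -/
lemma Method.Admissible.lSq_le (hA : A.Admissible) {z : ℝ} (hz : 0 < z) {u : E × ℝ × ℝ}
    (hu : u ∈ A.U) (s : Ξ) :
    A.lSq z u s ≤ (3 * (A.p.c / z) ^ 2 * ‖A.Q.dG u.1 s‖ ^ 2
        + 12 * (A.p.c / z) ^ 2 * A.p.Lf ^ 2 * (A.Q.F u.1 s - A.Q.f u.1) ^ 2 + 0)
      + (12 * (16 * (A.p.c / z) ^ 2 * A.p.R ^ 2 + 1) * ‖A.Q.dF u.1 s - A.Q.df u.1‖ ^ 2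
        + (4 * (A.p.c / z) ^ 2 + 1) * (A.Q.F u.1 s - u.2.1) ^ 2
        + (12 * (16 * (A.p.c / z) ^ 2 * A.p.R ^ 2 + 1) * A.p.Lf ^ 2 + 1)) := by
  have hR := hA.params.R_pos
  have hk : 0 < A.p.c / z := div_pos hA.params.c_pos hz
  have hLf := hA.params.Lf_nonneg
  have hq := hA.max_le_add hu s
  have hdf := hA.standing.df_bound u.1 hu.1
  obtain ⟨hl0, hl1⟩ := hu.2.2
  have hdG : ‖A.Q.dG u.1 s‖ =
      2 * max (A.Q.F u.1 s - A.Q.f u.1) 0 * ‖A.Q.dF u.1 s - A.Q.df u.1‖ := by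
    unfold Problem.dG
    rw [norm_smul, Real.norm_eq_abs, abs_of_nonneg (by positivity)]
  have ha : ‖A.Q.dF u.1 s‖ ≤ ‖A.Q.dF u.1 s - A.Q.df u.1‖ + A.p.Lf := by
    calc ‖A.Q.dF u.1 s‖ = ‖A.Q.dF u.1 s - A.Q.df u.1 + A.Q.df u.1‖ := by rw [sub_add_cancel]
      _ ≤ _ := (norm_add_le _ _).trans (by gcongr)
  have hV : (max (A.Q.F u.1 s - A.Q.f u.1) 0) ^ 2 ≤ (A.Q.F u.1 s - A.Q.f u.1) ^ 2 := by
    rw [← sq_abs (A.Q.F u.1 s - A.Q.f u.1)]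
    gcongr
    exact max_le (le_abs_self _) (abs_nonneg _)
  have hW : (max (A.Q.F u.1 s - u.2.1) 0) ^ 2 ≤ (A.Q.F u.1 s - u.2.1) ^ 2 := by
    rw [← sq_abs (A.Q.F u.1 s - u.2.1)]
    gcongr
    exact max_le (le_abs_self _) (abs_nonneg _)
  have eX : A.lX z u s =
    2 * (A.p.c / z) * max (A.Q.F u.1 s - u.2.1) 0 + u.2.2 := by unfold Method.lX; ring
  have eY : A.lY z u s =
    -(2 * (A.p.c / z)) * max (A.Q.F u.1 s - u.2.1) 0 + (1 - u.2.2) := by unfold Method.lY; ring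
  have eL : A.lL u s ^ 2 = (A.Q.F u.1 s - u.2.1) ^ 2 := by unfold Method.lL; ring
  unfold Method.lSq
  rw [eX, eY, eL, hdG, ← mul_pow]
  have hq0 : 0 ≤ max (A.Q.F u.1 s - u.2.1) 0 := le_max_right _ _
  have hq00 : 0 ≤ max (A.Q.F u.1 s - A.Q.f u.1) 0 := le_max_right _ _
  have hn := norm_nonneg (A.Q.dF u.1 s)
  have hd := norm_nonneg (A.Q.dF u.1 s - A.Q.df u.1)
  generalize max (A.Q.F u.1 s - u.2.1) 0 = q at *
  generalize max (A.Q.F u.1 s - A.Q.f u.1) 0 = q₀ at *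
  generalize ‖A.Q.dF u.1 s‖ = a at *
  generalize ‖A.Q.dF u.1 s - A.Q.df u.1‖ = d at *
  generalize A.p.c / z = k at *
  generalize (A.Q.F u.1 s - u.2.1) ^ 2 = W at *
  generalize (A.Q.F u.1 s - A.Q.f u.1) ^ 2 = V at *
  have hX1 : (2 * k * q + u.2.2) * a ≤
      k * (2 * q₀ * d) + 2 * k * A.p.Lf * q₀ + (4 * k * A.p.R + 1) * a := by
    have h1 : k * q * a ≤ k * (q₀ + 2 * A.p.R) * a := by gcongr
    have h2 : k * q₀ * a ≤ k * q₀ * (d + A.p.Lf) := by gcongr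
    have h3 : u.2.2 * a ≤ 1 * a := by gcongr
    linarith
  have hX2 : ((2 * k * q + u.2.2) * a) ^ 2 ≤
      3 * ((k * (2 * q₀ * d)) ^ 2 + (2 * k * A.p.Lf * q₀) ^ 2 + ((4 * k * A.p.R + 1) * a) ^ 2) := by
    refine (pow_le_pow_left₀ (by positivity) hX1 2).trans ?_
    generalize k * (2 * q₀ * d) = a1
    generalize 2 * k * A.p.Lf * q₀ = a2
    generalize (4 * k * A.p.R + 1) * a = a3
    nlinarith [sq_nonneg (a1 - a2), sq_nonneg (a1 - a3), sq_nonneg (a2 - a3)]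
  have hX3 : ((4 * k * A.p.R + 1) * a) ^ 2 ≤ 2 * (16 * k ^ 2 * A.p.R ^ 2 + 1) * a ^ 2 := by
    rw [mul_pow]
    gcongr
    nlinarith [sq_nonneg (4 * k * A.p.R - 1)]
  have ha2 : a ^ 2 ≤ 2 * d ^ 2 + 2 * A.p.Lf ^ 2 := by
    refine (pow_le_pow_left₀ hn ha 2).trans ?_
    nlinarith [sq_nonneg (d - A.p.Lf)]
  have hX4 : 2 * (16 * k ^ 2 * A.p.R ^ 2 + 1) * a ^ 2 ≤
      2 * (16 * k ^ 2 * A.p.R ^ 2 + 1) * (2 * d ^ 2 + 2 * A.p.Lf ^ 2) := by gcongr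
  have hX5 : (2 * k * A.p.Lf * q₀) ^ 2 ≤ 4 * k ^ 2 * A.p.Lf ^ 2 * V := by
    calc (2 * k * A.p.Lf * q₀) ^ 2 = 4 * k ^ 2 * A.p.Lf ^ 2 * q₀ ^ 2 := by ring
      _ ≤ _ := by gcongr
  have hY : (-(2 * k) * q + (1 - u.2.2)) ^ 2 ≤ 4 * k ^ 2 * W + 1 := by
    have h1 : 4 * k ^ 2 * q ^ 2 ≤ 4 * k ^ 2 * W := by gcongr
    have h2 : 0 ≤ k * q * (1 - u.2.2) :=
      mul_nonneg (mul_nonneg hk.le hq0) (by linarith)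
    nlinarith
  linarith

/-- The integrated bound is covered term by term by `M_z²`, except that it contains `4 (c/z)² β²`
where `M_z²` has `3 (c/z)² β²`; this is the origin of the factor `4/3`. -/
lemma Method.Admissible.integrable_lSq_and_integral_le (hA : A.Admissible) {z : ℝ} (hz : 0 < z)
    {u : E × ℝ × ℝ} (hu : u ∈ A.U) :
    Integrable (A.lSq z u) A.Q.law ∧ ∫ s, A.lSq z u s ∂A.Q.law ≤ 4 / 3 * A.p.M z ^ 2 := by
  have := hA.standing.law_prob
  obtain ⟨hG, hGle⟩ := hA.semivariance u.1 hu.1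
  have hV := hA.standing.F_sq_integrable u.1 hu.1
  have hVle := hA.standing.F_variance u.1 hu.1
  have hD := hA.standing.dF_sq_integrable u.1 hu.1
  have hDle := hA.standing.dF_variance u.1 hu.1
  have hW := (hA.memLp_F_sub hu.1 u.2.1).integrable_sq
  have hWle := hA.integral_F_sub_sq_le hu.1 (hA.abs_f_sub_le hu)
  have hi1 := ((hG.const_mul (3 * (A.p.c / z) ^ 2)).add
    (hV.const_mul (12 * (A.p.c / z) ^ 2 * A.p.Lf ^ 2))).add (integrable_const (0 : ℝ))
  have hi2 := ((hD.const_mul (12 * (16 * (A.p.c / z) ^ 2 * A.p.R ^ 2 + 1))).add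
    (hW.const_mul (4 * (A.p.c / z) ^ 2 + 1))).add
    (integrable_const (12 * (16 * (A.p.c / z) ^ 2 * A.p.R ^ 2 + 1) * A.p.Lf ^ 2 + 1))
  have hm : Measurable (A.lSq z u) :=
    hA.measurable_lSq z (u := fun _ : Ξ => u) measurable_const measurable_id
  have hnn : ∀ s, 0 ≤ A.lSq z u s := fun s => by unfold Method.lSq; positivity
  have hi : Integrable (A.lSq z u) A.Q.law := by
    refine (hi1.add hi2).mono' hm.aestronglyMeasurable (ae_of_all _ fun s => ?_)
    rw [Real.norm_eq_abs, abs_of_nonneg (hnn s)]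
    exact hA.lSq_le hz hu s
  refine ⟨hi, ?_⟩
  have hle := integral_mono hi (hi1.add hi2) (hA.lSq_le hz hu)
  have hadd := integral_add hi1 hi2
  simp only [Pi.add_apply] at hle hadd
  rw [hadd, integral_mul_add_mul_add hG hV, integral_mul_add_mul_add hD hW] at hle
  refine hle.trans ?_
  have hM : A.p.M z ^ 2 = 3 * (A.p.c / z) ^ 2 *
        (A.p.LG ^ 2 + (4 * A.p.Lf ^ 2 + 1) * A.p.β ^ 2
          + 16 * (4 * (A.p.Lf ^ 2 + A.p.σf ^ 2) + 1) * A.p.R ^ 2)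
      + 12 * (A.p.Lf ^ 2 + A.p.σf ^ 2) + 8 * A.p.R ^ 2 + 2 * A.p.β ^ 2 + 3 := by
    rw [A.p.M_sq, div_pow]; ring
  rw [hM]
  generalize A.p.c / z = k
  have b1 := mul_le_mul_of_nonneg_left hGle (show 0 ≤ 3 * k ^ 2 by positivity)
  have b2 := mul_le_mul_of_nonneg_left hVle (show 0 ≤ 12 * k ^ 2 * A.p.Lf ^ 2 by positivity)
  have b3 := mul_le_mul_of_nonneg_left hDle
    (show 0 ≤ 12 * (16 * k ^ 2 * A.p.R ^ 2 + 1) by positivity)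
  have b4 := mul_le_mul_of_nonneg_left hWle (show 0 ≤ 4 * k ^ 2 + 1 by positivity)
  have c1 : 0 ≤ k ^ 2 * A.p.LG ^ 2 := by positivity
  have c2 : 0 ≤ k ^ 2 * (A.p.Lf ^ 2 * A.p.β ^ 2) := by positivity
  have c3 : 0 ≤ k ^ 2 * A.p.R ^ 2 * (A.p.Lf ^ 2 + A.p.σf ^ 2) := by positivity
  have c4 : 0 ≤ A.p.Lf ^ 2 + A.p.σf ^ 2 := by positivity
  have c5 : 0 ≤ k ^ 2 * A.p.R ^ 2 := by positivity
  have c6 := sq_nonneg A.p.R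
  have c7 := sq_nonneg A.p.β
  have c8 : 0 ≤ k ^ 2 * A.p.β ^ 2 := by positivity
  nlinarith

lemma Method.Admissible.memLp_lForm (hA : A.Admissible) {z : ℝ} (hz : 0 < z) {u : E × ℝ × ℝ}
    (hu : u ∈ A.U) (w : E × ℝ × ℝ) : MemLp (fun s => A.lForm z u s w) 2 A.Q.law := by
  have hm : Measurable (fun s => A.lForm z u s w) :=
    hA.measurable_lForm z (u := fun _ : Ξ => u) (w := fun _ => w) measurable_const measurable_id
      measurable_const
  rw [memLp_two_iff_integrable_sq hm.aestronglyMeasurable]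
  refine ((hA.integrable_lSq_and_integral_le hz hu).1.mul_const (normSq w)).mono'
    (hm.pow_const 2).aestronglyMeasurable (ae_of_all _ fun s => ?_)
  rw [Real.norm_eq_abs, abs_of_nonneg (by positivity)]
  exact A.lForm_sq_le z u s w

/-- The noise of the linear form has mean zero and bounded variance. -/
lemma Method.Admissible.noise_lForm (hA : A.Admissible) {z : ℝ} (hz : 0 < z) {u v : E × ℝ × ℝ}
    (hu : u ∈ A.U) (hv : v ∈ A.U) :
    MemLp (fun s => A.lForm z u s (u - v) - A.J z u v) 2 A.Q.law ∧
    ∫ s, (A.lForm z u s (u - v) - A.J z u v) ∂A.Q.law = 0 ∧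
    ∫ s, (A.lForm z u s (u - v) - A.J z u v) ^ 2 ∂A.Q.law ≤ 8 / 3 * A.p.M z ^ 2 * A.p.DV ^ 2 := by
  have := hA.standing.law_prob
  have hL := hA.memLp_lForm hz hu (u - v)
  obtain ⟨hi, hle⟩ := hA.integrable_lSq_and_integral_le hz hu
  refine ⟨hL.sub (memLp_const _), ?_, ?_⟩
  · rw [integral_sub (hL.integrable one_le_two) (integrable_const _)]
    simp [Method.J]
  · refine (integral_sub_integral_sq_le hL).trans ?_
    calc ∫ s, A.lForm z u s (u - v) ^ 2 ∂A.Q.law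
        ≤ ∫ s, A.lSq z u s * normSq (u - v) ∂A.Q.law :=
          integral_mono hL.integrable_sq (hi.mul_const _) fun s => A.lForm_sq_le z u s _
      _ = (∫ s, A.lSq z u s ∂A.Q.law) * normSq (u - v) := integral_mul_const _ _
      _ ≤ (4 / 3 * A.p.M z ^ 2) * (2 * A.p.DV ^ 2) := by
          gcongr
          · unfold normSq; positivity
          · exact hA.normSq_sub_le hu hv
      _ = _ := by ring

/-- The noise of the slope has mean zero and bounded variance. -/
lemma Method.Admissible.noise_dz (hA : A.Admissible) {z : ℝ} (hz : 0 < z) {u : E × ℝ × ℝ}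
    (hu : u ∈ A.U) :
    MemLp (fun s => A.dz z u s - A.slopeMean z u) 2 A.Q.law ∧
    ∫ s, (A.dz z u s - A.slopeMean z u) ∂A.Q.law = 0 ∧
    ∫ s, (A.dz z u s - A.slopeMean z u) ^ 2 ∂A.Q.law ≤
      8 * A.p.c ^ 2 / z ^ 4 * (A.p.Mf ^ 4 + 16 * A.p.R ^ 4) := by
  have := hA.standing.law_prob
  obtain ⟨h4, h4le⟩ := hA.fourth u.1 hu.1
  have hm : Measurable fun s => max (A.Q.F u.1 s - u.2.1) 0 :=
    ((hA.measurable_F hu.1 u.1).sub_const _).max measurable_const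
  -- Convexity of the fourth power, `(a + b)⁴ ≤ 8 (a⁴ + b⁴)`, with `b = 2 R`.
  have hdom : ∀ s, (max (A.Q.F u.1 s - u.2.1) 0) ^ 4 ≤
      8 * (max (A.Q.F u.1 s - A.Q.f u.1) 0) ^ 4 + 8 * (16 * A.p.R ^ 4) := by
    intro s
    have h1 := pow_le_pow_left₀ (le_max_right _ _) (hA.max_le_add hu s) 4
    refine h1.trans ?_
    have h2 := add_pow_le (le_max_right (A.Q.F u.1 s - A.Q.f u.1) 0)
      (by have := hA.params.R_pos; positivity : 0 ≤ 2 * A.p.R) 4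
    norm_num at h2
    refine h2.trans (le_of_eq ?_)
    ring
  have hi4 := (h4.const_mul 8).add (integrable_const (8 * (16 * A.p.R ^ 4)))
  have hq4 : Integrable (fun s => (max (A.Q.F u.1 s - u.2.1) 0) ^ 4) A.Q.law := by
    refine hi4.mono' (hm.pow_const 4).aestronglyMeasurable (ae_of_all _ fun s => ?_)
    rw [Real.norm_eq_abs, abs_of_nonneg (by positivity)]
    exact hdom s
  have hq4le : ∫ s, (max (A.Q.F u.1 s - u.2.1) 0) ^ 4 ∂A.Q.law ≤
      8 * (A.p.Mf ^ 4 + 16 * A.p.R ^ 4) := by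
    refine (integral_mono hq4 hi4 hdom).trans ?_
    rw [integral_add' (h4.const_mul 8) (integrable_const _), integral_const_mul]
    simp only [integral_const, probReal_univ, smul_eq_mul, one_mul]
    linarith
  set Y : Ξ → ℝ := fun s => -(A.p.c / z ^ 2) * (max (A.Q.F u.1 s - u.2.1) 0) ^ 2 with hYdef
  have hY2 : ∀ s, Y s ^ 2 = A.p.c ^ 2 / z ^ 4 * (max (A.Q.F u.1 s - u.2.1) 0) ^ 4 := by
    intro s; simp only [hYdef]; field_simp
  have hY : MemLp Y 2 A.Q.law := by
    rw [memLp_two_iff_integrable_sq ((hm.pow_const 2).const_mul _).aestronglyMeasurable]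
    exact (hq4.const_mul (A.p.c ^ 2 / z ^ 4)).congr (ae_of_all _ fun s => (hY2 s).symm)
  have hmean : A.slopeMean z u = ∫ s, Y s ∂A.Q.law + A.p.c / 4 := by
    unfold Method.slopeMean Method.dz
    rw [integral_add (hY.integrable one_le_two) (integrable_const _)]
    simp [hYdef]
  have heq : ∀ s, A.dz z u s - A.slopeMean z u = Y s - ∫ r, Y r ∂A.Q.law := by
    intro s
    rw [hmean]
    simp only [hYdef, Method.dz]
    ring
  simp only [heq]
  refine ⟨hY.sub (memLp_const _), ?_, ?_⟩
  · rw [integral_sub (hY.integrable one_le_two) (integrable_const _)]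
    simp
  · refine (integral_sub_integral_sq_le hY).trans ((integral_congr_ae (ae_of_all _ hY2)).trans_le ?_)
    rw [integral_const_mul]
    calc A.p.c ^ 2 / z ^ 4 * ∫ s, (max (A.Q.F u.1 s - u.2.1) 0) ^ 4 ∂A.Q.law
        ≤ A.p.c ^ 2 / z ^ 4 * (8 * (A.p.Mf ^ 4 + 16 * A.p.R ^ 4)) := by gcongr
      _ = _ := by ring

end MomentBounds

/-! ### Freezing an independent variable; martingale sums -/

section Freezing

variable {Ω Ξ α : Type*} [MeasurableSpace Ω] [MeasurableSpace Ξ] [MeasurableSpace α]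
  {μ : Measure Ω} [IsProbabilityMeasure μ] {P : Measure Ξ} [IsProbabilityMeasure P]

/-- Expectation bound for a nonnegative function of two independent variables, obtained by freezing
the first one. -/
lemma integrable_and_integral_le_of_indepFun {U : Ω → α} {X : Ω → Ξ} (hU : Measurable U)
    (hX : Measurable X) (hind : IndepFun U X μ) (hP : μ.map X = P) {ψ : α × Ξ → ℝ}
    (hψ : Measurable ψ) (h0 : ∀ q, 0 ≤ ψ q) {B : ℝ}
    (hB : ∀ ω, Integrable (fun s => ψ (U ω, s)) P ∧ ∫ s, ψ (U ω, s) ∂P ≤ B) :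
    Integrable (fun ω => ψ (U ω, X ω)) μ ∧ ∫ ω, ψ (U ω, X ω) ∂μ ≤ B := by
  obtain ⟨ω₀⟩ : Nonempty Ω := μ.nonempty_of_neZero
  have hB0 : 0 ≤ B := (integral_nonneg fun s => h0 _).trans (hB ω₀).2
  have hm : Measurable fun ω => ψ (U ω, X ω) := hψ.comp (hU.prodMk hX)
  have hprod := hind.map_prod_eq_prod_map_map hU.aemeasurable hX.aemeasurable
  rw [hP] at hprod
  have hle : ∫⁻ ω, ENNReal.ofReal (ψ (U ω, X ω)) ∂μ ≤ ENNReal.ofReal B := by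
    calc ∫⁻ ω, ENNReal.ofReal (ψ (U ω, X ω)) ∂μ
        = ∫⁻ q, ENNReal.ofReal (ψ q) ∂(μ.map fun ω => (U ω, X ω)) :=
          (lintegral_map hψ.ennreal_ofReal (hU.prodMk hX)).symm
      _ = ∫⁻ a, ∫⁻ s, ENNReal.ofReal (ψ (a, s)) ∂P ∂(μ.map U) := by
          rw [hprod, lintegral_prod _ hψ.ennreal_ofReal.aemeasurable]
      _ = ∫⁻ ω, ∫⁻ s, ENNReal.ofReal (ψ (U ω, s)) ∂P ∂μ :=
          lintegral_map hψ.ennreal_ofReal.lintegral_prod_right' hU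
      _ ≤ ∫⁻ _, ENNReal.ofReal B ∂μ := by
          refine lintegral_mono fun ω => ?_
          rw [← ofReal_integral_eq_lintegral_ofReal (hB ω).1 (ae_of_all _ fun s => h0 _)]
          exact ENNReal.ofReal_le_ofReal (hB ω).2
      _ = ENNReal.ofReal B := by simp
  refine ⟨⟨hm.aestronglyMeasurable, ?_⟩, ?_⟩
  · rw [hasFiniteIntegral_iff_ofReal (ae_of_all _ fun ω => h0 _)]
    exact hle.trans_lt ENNReal.ofReal_lt_top
  · rw [integral_eq_lintegral_of_nonneg_ae (ae_of_all _ fun ω => h0 _) hm.aestronglyMeasurable]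
    exact ENNReal.toReal_le_of_le_ofReal hB0 hle

/-- A function of two independent variables has mean zero if it has so for each frozen value of
the first one. -/
lemma integral_eq_zero_of_indepFun {U : Ω → α} {X : Ω → Ξ} (hU : Measurable U)
    (hX : Measurable X) (hind : IndepFun U X μ) (hP : μ.map X = P) {ψ : α × Ξ → ℝ}
    (hψ : Measurable ψ) (hi : Integrable (fun ω => ψ (U ω, X ω)) μ)
    (h0 : ∀ ω, ∫ s, ψ (U ω, s) ∂P = 0) : ∫ ω, ψ (U ω, X ω) ∂μ = 0 := by
  have hprod := hind.map_prod_eq_prod_map_map hU.aemeasurable hX.aemeasurable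
  rw [hP] at hprod
  have hUX := (hU.prodMk hX).aemeasurable (μ := μ)
  have hi' : Integrable ψ ((μ.map U).prod P) := by
    rw [← hprod, integrable_map_measure hψ.aestronglyMeasurable hUX]
    exact hi
  have : IsProbabilityMeasure (μ.map U) := Measure.isProbabilityMeasure_map hU.aemeasurable
  have e1 : ∫ ω, ψ (U ω, X ω) ∂μ = ∫ q, ψ q ∂(μ.map fun ω => (U ω, X ω)) :=
    (integral_map hUX hψ.aestronglyMeasurable).symm
  rw [e1, hprod, integral_prod _ hi',
    integral_map hU.aemeasurable hψ.stronglyMeasurable.integral_prod_right'.aestronglyMeasurable]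
  simp [h0]

/-- The second moment of a sum of martingale differences `ψ (U t, X t)`. -/
lemma memLp_sum_and_integral_sq_le {U : ℕ → Ω → α} {X : ℕ → Ω → Ξ} (hU : ∀ t, Measurable (U t))
    (hX : ∀ t, Measurable (X t)) (hP : ∀ t, μ.map (X t) = P) {ψ : α × Ξ → ℝ} (hψ : Measurable ψ)
    {B : ℝ} (h2 : ∀ t ω, MemLp (fun s => ψ (U t ω, s)) 2 P)
    (h0 : ∀ t ω, ∫ s, ψ (U t ω, s) ∂P = 0) (hB : ∀ t ω, ∫ s, ψ (U t ω, s) ^ 2 ∂P ≤ B)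
    (hind : ∀ t, IndepFun (fun ω => (∑ j ∈ Finset.range t, ψ (U j ω, X j ω), U t ω)) (X t) μ)
    (T : ℕ) :
    MemLp (fun ω => ∑ t ∈ Finset.range T, ψ (U t ω, X t ω)) 2 μ ∧
      ∫ ω, (∑ t ∈ Finset.range T, ψ (U t ω, X t ω)) ^ 2 ∂μ ≤ T * B := by
  have hm : ∀ t, Measurable fun ω => ψ (U t ω, X t ω) := fun t =>
    hψ.comp ((hU t).prodMk (hX t))
  have hS : ∀ T, Measurable fun ω => ∑ t ∈ Finset.range T, ψ (U t ω, X t ω) := fun T =>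
    Finset.measurable_fun_sum _ fun t _ => hm t
  induction T with
  | zero => simp
  | succ T ih =>
    obtain ⟨ih1, ih2⟩ := ih
    have hUind : IndepFun (U T) (X T) μ := (hind T).comp measurable_snd measurable_id
    obtain ⟨hsq, hsqle⟩ := integrable_and_integral_le_of_indepFun (hU T) (hX T) hUind (hP T)
      (ψ := fun q => ψ q ^ 2) (hψ.pow_const 2) (fun q => sq_nonneg _)
      (fun ω => ⟨(h2 T ω).integrable_sq, hB T ω⟩)
    have hL : MemLp (fun ω => ψ (U T ω, X T ω)) 2 μ :=
      (memLp_two_iff_integrable_sq (hm T).aestronglyMeasurable).2 hsq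
    -- Orthogonality of martingale differences: the pair (partial sum, current iterate) is frozen
    -- and the fresh sample is integrated first.
    have hcross : ∫ ω, (∑ t ∈ Finset.range T, ψ (U t ω, X t ω)) * ψ (U T ω, X T ω) ∂μ = 0 := by
      refine integral_eq_zero_of_indepFun (α := ℝ × α)
        (U := fun ω => (∑ j ∈ Finset.range T, ψ (U j ω, X j ω), U T ω))
        (ψ := fun q => q.1.1 * ψ (q.1.2, q.2)) ((hS T).prodMk (hU T)) (hX T) (hind T) (hP T)
        (measurable_fst.fst.mul (hψ.comp (measurable_fst.snd.prodMk measurable_snd)))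
        (ih1.integrable_mul hL) fun ω => ?_
      simp only
      rw [integral_const_mul, h0 T ω, mul_zero]
    refine ⟨?_, ?_⟩
    · simp only [Finset.sum_range_succ]
      exact ih1.add hL
    · have hexp : ∀ ω, (∑ t ∈ Finset.range (T + 1), ψ (U t ω, X t ω)) ^ 2 =
          (∑ t ∈ Finset.range T, ψ (U t ω, X t ω)) ^ 2 +
          (2 * ((∑ t ∈ Finset.range T, ψ (U t ω, X t ω)) * ψ (U T ω, X T ω)) +
            ψ (U T ω, X T ω) ^ 2) := by
        intro ω; rw [Finset.sum_range_succ]; ring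
      have hc : Integrable (fun ω => 2 * ((∑ t ∈ Finset.range T, ψ (U t ω, X t ω)) *
          ψ (U T ω, X T ω))) μ := (ih1.integrable_mul hL).const_mul 2
      have hcs : Integrable (fun ω => 2 * ((∑ t ∈ Finset.range T, ψ (U t ω, X t ω)) *
          ψ (U T ω, X T ω)) + ψ (U T ω, X T ω) ^ 2) μ := hc.add hsq
      simp only [hexp]
      rw [integral_add ih1.integrable_sq hcs, integral_add hc hsq, integral_const_mul,
        hcross]
      push_cast
      linarith

end Freezing

/-! ### Independence of disjoint groups of samples -/

section Independence

variable {Ω Ξ ι : Type*} [mΩ : MeasurableSpace Ω] [mΞ : MeasurableSpace Ξ] {μ : Measure Ω}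
  {S : ι → Ω → Ξ}

/-- The σ-algebra generated by the variables with index in `I`. -/
abbrev sigmaOf (S : ι → Ω → Ξ) (I : Set ι) : MeasurableSpace Ω := ⨆ i ∈ I, mΞ.comap (S i)

lemma measurable_sigmaOf {I : Set ι} {i : ι} (hi : i ∈ I) : Measurable[sigmaOf S I] (S i) :=
  (comap_measurable (S i)).mono (le_iSup₂ (f := fun i (_ : i ∈ I) => mΞ.comap (S i)) i hi) le_rfl

lemma indep_sigmaOf (hS : ∀ i, Measurable (S i)) (hind : iIndepFun S μ) {I J : Set ι}
    (hIJ : Disjoint I J) : Indep (sigmaOf S I) (sigmaOf S J) μ :=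
  indep_iSup_of_disjoint (fun i => (hS i).comap_le) hind hIJ

lemma indepFun_of_measurable_sigmaOf {α : Type*} [MeasurableSpace α] (hS : ∀ i, Measurable (S i))
    (hind : iIndepFun S μ) {I : Set ι} {j : ι} (hj : j ∉ I) {W : Ω → α}
    (hW : Measurable[sigmaOf S I] W) : IndepFun W (S j) μ := by
  have h := indep_sigmaOf hS hind (Set.disjoint_singleton_right.2 hj)
  rw [IndepFun_iff_Indep]
  refine indep_of_indep_of_le_left (indep_of_indep_of_le_right h ?_) hW.comap_le
  exact (measurable_sigmaOf (Set.mem_singleton j)).comap_le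

end Independence

/-! ### Pathwise regret of the inner method -/

section Pathwise

variable {E Ξ : Type*} [NormedAddCommGroup E] [NormedSpace ℝ E] [FiniteDimensional ℝ E]
  [MeasurableSpace E] [BorelSpace E] [MeasurableSpace Ξ]

/-- Cumulated noise of the linear forms along the iterates, at the reference point `v`. -/
def Method.noise (A : Method E Ξ) (z γ : ℝ) (T : ℕ) (ξ : ℕ → Ξ) (v : E × ℝ × ℝ) : ℝ :=
  ∑ t ∈ Finset.range T, (A.lForm z (A.smdIter z (fun _ => γ) ξ t) (ξ t)
    (A.smdIter z (fun _ => γ) ξ t - v) - A.J z (A.smdIter z (fun _ => γ) ξ t) v)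

/-- Bound on the averaged regret against `(x, y, 0)` and `(x, y, 1)`. -/
def Method.regret (A : Method E Ξ) (z γ : ℝ) (T : ℕ) (ξ : ℕ → Ξ) (x : E) (y : ℝ) : ℝ :=
  (T : ℝ)⁻¹ * (2 * A.p.DV ^ 2 / γ
    + γ / 2 * ∑ t ∈ Finset.range T, A.lSq z (A.smdIter z (fun _ => γ) ξ t) (ξ t)
    + |A.noise z γ T ξ (x, y, 0)| + |A.noise z γ T ξ (x, y, 1)|)

/-- Averaged expected slope along the iterates. -/
def Method.slopeAvg (A : Method E Ξ) (z γ : ℝ) (T : ℕ) (ξ : ℕ → Ξ) : ℝ :=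
  (T : ℝ)⁻¹ * ∑ t ∈ Finset.range T, A.slopeMean z (A.smdIter z (fun _ => γ) ξ t)

variable {A : Method E Ξ}

lemma Method.smdPoint_const (A : Method E Ξ) (z : ℝ) {γ : ℝ} (hγ : γ ≠ 0) (T : ℕ) (ξ : ℕ → Ξ) :
    A.smdPoint z T (fun _ => γ) ξ =
      (T : ℝ)⁻¹ • ∑ t ∈ Finset.range T, A.smdIter z (fun _ => γ) ξ t := by
  unfold Method.smdPoint
  rw [← Finset.smul_sum, smul_smul, Finset.sum_const, Finset.card_range, nsmul_eq_mul, mul_inv,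
    mul_assoc, inv_mul_cancel₀ hγ, mul_one]

lemma Method.smdSlope_const (A : Method E Ξ) (z : ℝ) {γ : ℝ} (hγ : γ ≠ 0) (T : ℕ)
    (ξ η : ℕ → Ξ) :
    A.smdSlope z T (fun _ => γ) ξ η =
      (T : ℝ)⁻¹ * ∑ t ∈ Finset.range T, A.dz z (A.smdIter z (fun _ => γ) ξ t) (η t) := by
  unfold Method.smdSlope
  rw [← Finset.mul_sum, ← mul_assoc, Finset.sum_const, Finset.card_range, nsmul_eq_mul, mul_inv,
    mul_assoc (T : ℝ)⁻¹, inv_mul_cancel₀ hγ, mul_one]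

lemma Method.Admissible.smdPoint_mem (hA : A.Admissible) (z : ℝ) {γ : ℝ} (hγ : γ ≠ 0) {T : ℕ}
    (hT : 0 < T) (ξ : ℕ → Ξ) : A.smdPoint z T (fun _ => γ) ξ ∈ A.U := by
  rw [A.smdPoint_const z hγ, Finset.smul_sum]
  refine (Method.U_convex hA).sum_mem (fun _ _ => by positivity) ?_
    fun t _ => hA.smdIter_mem z _ ξ t
  have : (T : ℝ) ≠ 0 := by positivity
  simp [this]

lemma Method.regret_nonneg (A : Method E Ξ) (z : ℝ) {γ : ℝ} (hγ : 0 < γ) (T : ℕ)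
    (ξ : ℕ → Ξ) (x : E) (y : ℝ) : 0 ≤ A.regret z γ T ξ x y := by
  unfold Method.regret
  have : 0 ≤ ∑ t ∈ Finset.range T, A.lSq z (A.smdIter z (fun _ => γ) ξ t) (ξ t) :=
    Finset.sum_nonneg fun t _ => by unfold Method.lSq; positivity
  positivity

/-- Jensen's inequality for the saddle function along the iterates. -/
lemma Method.Admissible.phi_smdPoint_le (hA : A.Admissible) {z : ℝ} (hz : 0 < z) {γ : ℝ}
    (hγ : γ ≠ 0) {T : ℕ} (hT : 0 < T) (ξ : ℕ → Ξ) {l : ℝ} (hl : 0 ≤ l) :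
    A.phi z ((A.smdPoint z T (fun _ => γ) ξ).1, (A.smdPoint z T (fun _ => γ) ξ).2.1, l) ≤
      (T : ℝ)⁻¹ * ∑ t ∈ Finset.range T, A.phi z ((A.smdIter z (fun _ => γ) ξ t).1,
        (A.smdIter z (fun _ => γ) ξ t).2.1, l) := by
  have hT' : (T : ℝ) ≠ 0 := by positivity
  have hmem := hA.smdPoint_mem z hγ hT ξ
  have hpt := A.smdPoint_const z hγ T ξ
  set w := A.smdPoint z T (fun _ => γ) ξ
  set u := A.smdIter z (fun _ => γ) ξ
  have h1 : ∀ t, A.phi z (w.1, w.2.1, l) - A.phi z ((u t).1, (u t).2.1, l) ≤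
      A.J z (w.1, w.2.1, l) ((u t).1, (u t).2.1, l) := by
    intro t
    have := hA.phi_sub_le hz (u := (w.1, w.2.1, l)) (v := ((u t).1, (u t).2.1, l)) hmem.1 hl
      (hA.smdIter_mem z _ ξ t).1 (Or.inl hz)
    simpa using this
  -- Jensen by subgradients: in the inequalities based at the average point, the linear terms cancel
  -- on averaging.
  have h2 := hA.J_add_smul (z := z) (u := (w.1, w.2.1, l)) hmem.1 (Finset.range T)
    (fun _ => (T : ℝ)⁻¹) (fun t => ((u t).1, (u t).2.1, l)) (by
      rw [← Finset.smul_sum, Finset.sum_sub_distrib, smul_sub, Finset.sum_const, Finset.card_range,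
        ← Nat.cast_smul_eq_nsmul ℝ, smul_smul, inv_mul_cancel₀ hT', one_smul, sub_eq_zero]
      refine Prod.ext ?_ (Prod.ext ?_ ?_)
      · rw [hpt]; simp [Prod.fst_sum]
      · rw [hpt]; simp [Prod.fst_sum, Prod.snd_sum]
      · simp [Prod.snd_sum, hT'])
  rw [← Finset.mul_sum] at h2
  have h3 := Finset.sum_le_sum fun t (_ : t ∈ Finset.range T) => h1 t
  have h4 := mul_le_mul_of_nonneg_left h3 (show (0 : ℝ) ≤ (T : ℝ)⁻¹ by positivity)
  rw [h2, Finset.sum_sub_distrib, Finset.sum_const, Finset.card_range, nsmul_eq_mul, mul_sub,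
    ← mul_assoc, inv_mul_cancel₀ hT', one_mul] at h4
  linarith

/-- The pathwise gap bound of the inner method, including the trial value `z`. -/
lemma Method.Admissible.phi_gap_le (hA : A.Admissible) {z z' : ℝ} (hz : 0 < z) {γ : ℝ}
    (hγ : 0 < γ) {T : ℕ} (hT : 0 < T) (ξ : ℕ → Ξ) {x : E} (hx : x ∈ A.Q.X) {y : ℝ} (hy : y ∈ A.Y)
    (hz' : 0 < z' ∨ z' = 0 ∧ ∀ᵐ s ∂A.Q.law, max (A.Q.F x s - y) 0 = 0) {l : ℝ}
    (hl : l = 0 ∨ l = 1) :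
    A.phi z ((A.smdPoint z T (fun _ => γ) ξ).1, (A.smdPoint z T (fun _ => γ) ξ).2.1, l)
      - A.phi z' (x, y, (A.smdPoint z T (fun _ => γ) ξ).2.2) ≤
      A.regret z γ T ξ x y + (z - z') * A.slopeAvg z γ T ξ := by
  have hT' : (T : ℝ) ≠ 0 := by positivity
  have hl0 : 0 ≤ l := by rcases hl with rfl | rfl <;> norm_num
  have hvU : ((x, y, l) : E × ℝ × ℝ) ∈ A.U := by
    refine ⟨hx, hy, ?_⟩
    rcases hl with rfl | rfl <;> simp
  have h1 := hA.phi_smdPoint_le hz hγ.ne' hT ξ hl0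
  have hpt := A.smdPoint_const z hγ.ne' T ξ
  have hreg := hA.sum_lForm_le z γ ξ hvU T
  have hV := hA.V_start_le hvU
  unfold Method.regret Method.slopeAvg
  -- The multiplier `l` will be selected along the path, so the noise is bounded at both fixed
  -- reference points instead of at a random one.
  have hnoise : |A.noise z γ T ξ (x, y, l)| ≤
      |A.noise z γ T ξ (x, y, 0)| + |A.noise z γ T ξ (x, y, 1)| := by
    rcases hl with rfl | rfl <;>
      linarith [abs_nonneg (A.noise z γ T ξ (x, y, 0)), abs_nonneg (A.noise z γ T ξ (x, y, 1))]
  have hnoise' : A.noise z γ T ξ (x, y, l) =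
    ∑ t ∈ Finset.range T, A.lForm z (A.smdIter z (fun _ => γ) ξ t) (ξ t)
      (A.smdIter z (fun _ => γ) ξ t - (x, y, l)) -
    ∑ t ∈ Finset.range T, A.J z (A.smdIter z (fun _ => γ) ξ t) (x, y, l) := by
    unfold Method.noise
    rw [Finset.sum_sub_distrib]
  have hmem : ∀ t, A.smdIter z (fun _ => γ) ξ t ∈ A.U := fun t => hA.smdIter_mem z _ ξ t
  set w := A.smdPoint z T (fun _ => γ) ξ
  set u := A.smdIter z (fun _ => γ) ξ
  have h2 : A.phi z' (x, y, w.2.2) = (T : ℝ)⁻¹ * ∑ t ∈ Finset.range T,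
      A.phi z' (x, y, (u t).2.2) := by
    have hw : w.2.2 = (T : ℝ)⁻¹ * ∑ t ∈ Finset.range T, (u t).2.2 := by
      rw [hpt]; simp [Prod.snd_sum]
    simp only [hA.phi_eq hx]
    rw [hw, Finset.sum_add_distrib, Finset.sum_const, Finset.card_range, nsmul_eq_mul, mul_add,
      ← mul_assoc (T : ℝ)⁻¹, inv_mul_cancel₀ hT', one_mul, ← Finset.sum_mul]
    ring
  have h3 : ∀ t, A.phi z ((u t).1, (u t).2.1, l) - A.phi z' (x, y, (u t).2.2) ≤
      A.J z (u t) (x, y, l) + (z - z') * A.slopeMean z (u t) := fun t =>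
    hA.phi_sub_le hz (v := (x, y, l)) (hmem t).1 (hmem t).2.2.1 hx hz'
  have h4 := Finset.sum_le_sum fun t (_ : t ∈ Finset.range T) => h3 t
  rw [Finset.sum_sub_distrib, Finset.sum_add_distrib, ← Finset.mul_sum] at h4
  have h5 : ∑ t ∈ Finset.range T, A.lForm z (u t) (ξ t) (u t - (x, y, l)) ≤
      2 * A.p.DV ^ 2 / γ + γ / 2 * ∑ t ∈ Finset.range T, A.lSq z (u t) (ξ t) := by
    have : 2 * A.p.DV ^ 2 / γ + γ / 2 * ∑ t ∈ Finset.range T, A.lSq z (u t) (ξ t) =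
      (2 * A.p.DV ^ 2 + γ ^ 2 / 2 * ∑ t ∈ Finset.range T, A.lSq z (u t) (ξ t)) / γ := by
      field_simp
    rw [this, le_div_iff₀ hγ, mul_comm]
    linarith
  have h6 := neg_abs_le (A.noise z γ T ξ (x, y, l))
  have h7 : ∑ t ∈ Finset.range T, A.phi z ((u t).1, (u t).2.1, l) -
      ∑ t ∈ Finset.range T, A.phi z' (x, y, (u t).2.2) ≤
      (2 * A.p.DV ^ 2 / γ + γ / 2 * ∑ t ∈ Finset.range T, A.lSq z (u t) (ξ t)
      + |A.noise z γ T ξ (x, y, 0)| + |A.noise z γ T ξ (x, y, 1)|)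
      + (z - z') * ∑ t ∈ Finset.range T, A.slopeMean z (u t) := by
    linarith
  have h8 := mul_le_mul_of_nonneg_left h7 (show (0 : ℝ) ≤ (T : ℝ)⁻¹ by positivity)
  rw [h2]
  linarith

end Pathwise

/-! ### Lower bounds on the number of inner steps -/

section Constants

variable {p : Params} {ε zs : ℝ}

lemma Params.two_le_K (p : Params) (ε zs : ℝ) : 2 ≤ p.K ε zs := by
  have h1 : 1 ≤ p.K₁ zs := le_max_left _ _
  have h2 : 1 ≤ p.K₂ ε zs := le_max_left _ _
  unfold Params.K
  omega

lemma Params.K_pos (p : Params) (ε zs : ℝ) : (0 : ℝ) < p.K ε zs := by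
  have := p.two_le_K ε zs
  positivity

lemma Params.Valid.Ctilde_pos (hp : p.Valid) : 0 < p.Ctilde ε zs := by
  have := p.K_pos ε zs
  have := hp.α_pos
  exact lt_of_lt_of_le (by positivity) (le_max_left _ _)

lemma Params.Valid.budget_pos (hp : p.Valid) (hε : 0 < ε) (z : ℝ) : 0 < p.budget ε zs z := by
  have h1 := hp.Ctilde_pos (ε := ε) (zs := zs)
  have h2 := p.M_pos z
  have h3 := hp.DV_pos
  unfold Params.budget
  positivity

lemma Params.Valid.T_pos (hp : p.Valid) (hε : 0 < ε) (z : ℝ) : 0 < p.T ε zs z :=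
  Nat.ceil_pos.2 (hp.budget_pos hε z)

lemma Params.Valid.γ_pos (hp : p.Valid) (hε : 0 < ε) (z : ℝ) : 0 < p.γ ε zs z := by
  have h1 := hp.T_pos hε z (zs := zs)
  have h2 := p.M_pos z
  have h3 := hp.DV_pos
  unfold Params.γ
  positivity

lemma Params.budget_le_T (p : Params) (ε zs z : ℝ) : p.budget ε zs z ≤ p.T ε zs z :=
  Nat.le_ceil _

/-- The constant comes from `36² = 81 * 16`, using the first argument of the maximum in `Ctilde`. -/
lemma Params.Valid.le_sqrt_T (hp : p.Valid) (hε : 0 < ε) (z : ℝ) :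
    36 * p.K ε zs * p.M z * p.DV / (p.α * ε) ≤ √(p.T ε zs z : ℝ) := by
  have h1 := p.K_pos ε zs
  have h2 := hp.α_pos
  have h3 := p.M_pos z
  have h4 := hp.DV_pos
  refine Real.le_sqrt_of_sq_le (le_trans ?_ (p.budget_le_T ε zs z))
  have h5 : 16 * (p.K ε zs : ℝ) ^ 2 / p.α ^ 2 ≤ p.Ctilde ε zs := le_max_left _ _
  calc (36 * p.K ε zs * p.M z * p.DV / (p.α * ε)) ^ 2
      = 81 * (16 * (p.K ε zs : ℝ) ^ 2 / p.α ^ 2) * p.M z ^ 2 * p.DV ^ 2 / ε ^ 2 := by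
        field_simp; norm_num
    _ ≤ p.budget ε zs z := by unfold Params.budget; gcongr

/-- Number of inner steps needed for the slope estimate. -/
lemma Params.Valid.slope_le_T (hp : p.Valid) (hε : 0 < ε) {z : ℝ} (hz : 0 < z) :
    384 * p.K ε zs * max 1 (16 * p.β ^ 2 / p.z₀ ^ 2) * (p.Mf ^ 4 + 16 * p.R ^ 4) * p.c ^ 2 /
      (z ^ 2 * p.α * ε ^ 2) ≤ (p.T ε zs z : ℝ) := by
  have h1 := p.K_pos ε zs
  have h2 := hp.α_pos
  have h4 := hp.DV_pos
  have hLG := hp.LG_pos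
  refine le_trans ?_ (p.budget_le_T ε zs z)
  have h5 : 128 * (p.K ε zs : ℝ) * max 1 (16 * p.β ^ 2 / p.z₀ ^ 2) *
        ((p.Mf ^ 4 + 16 * p.R ^ 4) + 4 * p.β ^ 4)
      / (81 * p.α * p.DV ^ 2 * p.LG ^ 2) ≤ p.Ctilde ε zs := le_max_right _ _
  have hmx : 0 < max 1 (16 * p.β ^ 2 / p.z₀ ^ 2) := lt_max_of_lt_left one_pos
  -- Only this part of `M_z²` is kept: it cancels `L_G²` in the second argument of `Ctilde` and
  -- supplies the factor `c²/z²`; the constant is `384 = 128 * 3`.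
  have hM : 3 * p.c ^ 2 / z ^ 2 * p.LG ^ 2 ≤ p.M z ^ 2 := by
    rw [p.M_sq]
    have : 3 * p.c ^ 2 / z ^ 2 * p.LG ^ 2 ≤ 3 * p.c ^ 2 / z ^ 2 * (p.LG ^ 2
      + (4 * p.Lf ^ 2 + 1) * p.β ^ 2 + 16 * (4 * (p.Lf ^ 2 + p.σf ^ 2) + 1) * p.R ^ 2) := by
      gcongr
      have : 0 ≤ (4 * p.Lf ^ 2 + 1) * p.β ^ 2 +
        16 * (4 * (p.Lf ^ 2 + p.σf ^ 2) + 1) * p.R ^ 2 := by positivity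
      linarith
    have h6 : 0 ≤ 12 * (p.Lf ^ 2 + p.σf ^ 2) + 8 * p.R ^ 2 + 2 * p.β ^ 2 + 3 := by positivity
    linarith
  calc 384 * p.K ε zs * max 1 (16 * p.β ^ 2 / p.z₀ ^ 2) * (p.Mf ^ 4 + 16 * p.R ^ 4) * p.c ^ 2 /
      (z ^ 2 * p.α * ε ^ 2)
      = 81 * (128 * (p.K ε zs : ℝ) * max 1 (16 * p.β ^ 2 / p.z₀ ^ 2) *
        ((p.Mf ^ 4 + 16 * p.R ^ 4) + 0) / (81 * p.α * p.DV ^ 2 * p.LG ^ 2)) *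
        (3 * p.c ^ 2 / z ^ 2 * p.LG ^ 2) * p.DV ^ 2 / ε ^ 2 := by
        field_simp; ring
    _ ≤ 81 * (128 * (p.K ε zs : ℝ) * max 1 (16 * p.β ^ 2 / p.z₀ ^ 2) *
        ((p.Mf ^ 4 + 16 * p.R ^ 4) + 4 * p.β ^ 4) / (81 * p.α * p.DV ^ 2 * p.LG ^ 2)) *
        (3 * p.c ^ 2 / z ^ 2 * p.LG ^ 2) * p.DV ^ 2 / ε ^ 2 := by
        gcongr; positivity
    _ ≤ p.budget ε zs z := by
        have := hp.Ctilde_pos (ε := ε) (zs := zs)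
        unfold Params.budget
        gcongr

end Constants

/-! ### Expected regret and expected objective -/

section Expectation

variable {E Ξ Ω : Type*} [NormedAddCommGroup E] [NormedSpace ℝ E] [FiniteDimensional ℝ E]
  [MeasurableSpace E] [BorelSpace E] [MeasurableSpace Ξ] [mΩ : MeasurableSpace Ω]
  {A : Method E Ξ}

/-- Independent samples of the law `P`. -/
structure IsSample {ι : Type*} (S : ι → Ω → Ξ) (P : Measure Ξ) (μ : Measure Ω) : Prop where
  meas : ∀ i, Measurable (S i)
  law : ∀ i, μ.map (S i) = P
  indep : iIndepFun S μ

lemma Method.Admissible.measurable_J (hA : A.Admissible) (z : ℝ) (v : E × ℝ × ℝ) :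
    Measurable fun u => A.J z u v := by
  have := hA.standing.law_prob
  exact (hA.measurable_lForm z (u := fun q : (E × ℝ × ℝ) × Ξ => q.1) (w := fun q => q.1 - v)
    measurable_fst measurable_snd
    (measurable_fst.sub_const v)).stronglyMeasurable.integral_prod_right'.measurable

lemma Method.Admissible.measurable_slopeMean (hA : A.Admissible) (z : ℝ) :
    Measurable (A.slopeMean z) := by
  have := hA.standing.law_prob
  exact (hA.measurable_dz z (u := fun q : (E × ℝ × ℝ) × Ξ => q.1)
    measurable_fst measurable_snd).stronglyMeasurable.integral_prod_right'.measurable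

lemma Method.Admissible.measurable_f (hA : A.Admissible) : Measurable A.Q.f := by
  have := hA.standing.law_prob
  exact hA.standing.F_measurable.stronglyMeasurable.integral_prod_right'.measurable

lemma Method.Admissible.measurable_h (hA : A.Admissible) : Measurable (A.Q.h A.p.c) := by
  have := hA.standing.law_prob
  have hg : Measurable A.Q.g :=
    (((hA.standing.F_measurable.sub (hA.measurable_f.comp measurable_fst)).max
      measurable_const).pow_const 2).stronglyMeasurable.integral_prod_right'.measurable
  exact hA.measurable_f.add (hg.sqrt.const_mul _)

/-- Noise of the linear form. -/
def Method.psiForm (A : Method E Ξ) (z : ℝ) (v : E × ℝ × ℝ) (q : (E × ℝ × ℝ) × Ξ) : ℝ :=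
  A.lForm z q.1 q.2 (q.1 - v) - A.J z q.1 v

/-- Noise of the slope. -/
def Method.psiSlope (A : Method E Ξ) (z : ℝ) (q : (E × ℝ × ℝ) × Ξ) : ℝ :=
  A.dz z q.1 q.2 - A.slopeMean z q.1

lemma Method.Admissible.measurable_psiForm (hA : A.Admissible) (z : ℝ) (v : E × ℝ × ℝ) :
    Measurable (A.psiForm z v) :=
  (hA.measurable_lForm z measurable_fst measurable_snd (measurable_fst.sub_const v)).sub
    ((hA.measurable_J z v).comp measurable_fst)

lemma Method.Admissible.measurable_psiSlope (hA : A.Admissible) (z : ℝ) :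
    Measurable (A.psiSlope z) :=
  (hA.measurable_dz z measurable_fst measurable_snd).sub
    ((hA.measurable_slopeMean z).comp measurable_fst)

lemma Method.Admissible.measurable_sum_prod (hA : A.Admissible) (z γ : ℝ) {ξ η : Ω → ℕ → Ξ} (t : ℕ)
    (hξ : ∀ i < t, Measurable fun ω => ξ ω i) (hη : ∀ i < t, Measurable fun ω => η ω i)
    {ψ : (E × ℝ × ℝ) × Ξ → ℝ} (hψ : Measurable ψ) :
    Measurable fun ω => (∑ j ∈ Finset.range t, ψ (A.smdIter z (fun _ => γ) (ξ ω) j, η ω j),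
      A.smdIter z (fun _ => γ) (ξ ω) t) := by
  refine (Finset.measurable_fun_sum _ fun j hj => ?_).prodMk (hA.measurable_smdIter z _ t hξ)
  have hj := Finset.mem_range.1 hj
  exact hψ.comp ((hA.measurable_smdIter z _ j fun i hi => hξ i (hi.trans hj)).prodMk (hη j hj))

variable {μ : Measure Ω} [IsProbabilityMeasure μ] {S : Bool × ℕ × ℕ → Ω → Ξ}

/-- Treats both noises at once: `d = false` pairs the iterate with the sample that drives it on, `d
= true` with the sample of the slope estimate. -/
lemma Method.Admissible.sum_psi (hA : A.Admissible) (hS : IsSample S A.Q.law μ) (z γ : ℝ)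
    (k T : ℕ) (d : Bool) {ψ : (E × ℝ × ℝ) × Ξ → ℝ} (hψ : Measurable ψ) {B : ℝ}
    (h : ∀ u ∈ A.U, MemLp (fun s => ψ (u, s)) 2 A.Q.law ∧ ∫ s, ψ (u, s) ∂A.Q.law = 0 ∧
      ∫ s, ψ (u, s) ^ 2 ∂A.Q.law ≤ B) :
    MemLp (fun ω => ∑ t ∈ Finset.range T,
        ψ (A.smdIter z (fun _ => γ) (fun t => S (false, k, t) ω) t, S (d, k, t) ω)) 2 μ ∧
      ∫ ω, (∑ t ∈ Finset.range T,
        ψ (A.smdIter z (fun _ => γ) (fun t => S (false, k, t) ω) t, S (d, k, t) ω)) ^ 2 ∂μ ≤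
          T * B := by
  have := hA.standing.law_prob
  have hm : ∀ t ω, A.smdIter z (fun _ => γ) (fun t => S (false, k, t) ω) t ∈ A.U :=
    fun t ω => hA.smdIter_mem z _ _ t
  refine memLp_sum_and_integral_sq_le (P := A.Q.law)
    (U := fun t ω => A.smdIter z (fun _ => γ) (fun t => S (false, k, t) ω) t)
    (X := fun t => S (d, k, t))
    (fun t => hA.measurable_smdIter z _ t fun i _ => hS.meas _) (fun t => hS.meas _)
    (fun t => hS.law _) hψ (fun t ω => (h _ (hm t ω)).1) (fun t ω => (h _ (hm t ω)).2.1)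
    (fun t ω => (h _ (hm t ω)).2.2) (fun t => ?_) T
  -- The iterate and the partial sum at time `t` use samples of inner index below `t` only, while
  -- the fresh sample has inner index `t`.
  refine indepFun_of_measurable_sigmaOf (I := {i | i.2.2 < t}) hS.meas hS.indep (by simp) ?_
  exact hA.measurable_sum_prod (mΩ := sigmaOf S {i | i.2.2 < t}) z γ
    (ξ := fun ω t => S (false, k, t) ω) (η := fun ω t => S (d, k, t) ω) t
    (fun i hi => measurable_sigmaOf (S := S) (i := (false, k, i)) hi)
    (fun i hi => measurable_sigmaOf (S := S) (i := (d, k, i)) hi) hψ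

lemma Method.Admissible.noise_sq (hA : A.Admissible) (hS : IsSample S A.Q.law μ) {z : ℝ}
    (hz : 0 < z) (γ : ℝ) (k T : ℕ) {v : E × ℝ × ℝ} (hv : v ∈ A.U) :
    MemLp (fun ω => A.noise z γ T (fun t => S (false, k, t) ω) v) 2 μ ∧
      ∫ ω, (A.noise z γ T (fun t => S (false, k, t) ω) v) ^ 2 ∂μ ≤
        T * (8 / 3 * A.p.M z ^ 2 * A.p.DV ^ 2) :=
  hA.sum_psi hS z γ k T false (hA.measurable_psiForm z v) fun _ hu => hA.noise_lForm hz hu hv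

lemma integral_abs_le_sqrt {Y : Ω → ℝ} (hY : MemLp Y 2 μ) {B : ℝ} (hB : ∫ ω, Y ω ^ 2 ∂μ ≤ B) :
    ∫ ω, |Y ω| ∂μ ≤ √B := by
  refine Real.le_sqrt_of_sq_le ((sq_integral_le hY.abs).trans ?_)
  simpa only [Pi.abs_apply, sq_abs] using hB

lemma Method.Admissible.integral_lSq (hA : A.Admissible) (hS : IsSample S A.Q.law μ) {z : ℝ}
    (hz : 0 < z) (γ : ℝ) (k t : ℕ) :
    Integrable (fun ω => A.lSq z (A.smdIter z (fun _ => γ) (fun t => S (false, k, t) ω) t)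
      (S (false, k, t) ω)) μ ∧
    ∫ ω, A.lSq z (A.smdIter z (fun _ => γ) (fun t => S (false, k, t) ω) t)
      (S (false, k, t) ω) ∂μ ≤ 4 / 3 * A.p.M z ^ 2 := by
  have := hA.standing.law_prob
  refine integrable_and_integral_le_of_indepFun (P := A.Q.law)
    (U := fun ω => A.smdIter z (fun _ => γ) (fun t => S (false, k, t) ω) t)
    (ψ := fun q => A.lSq z q.1 q.2)
    (hA.measurable_smdIter z _ t fun i _ => hS.meas _) (hS.meas _) ?_ (hS.law _)
    (hA.measurable_lSq z measurable_fst measurable_snd)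
    (fun q => by unfold Method.lSq; positivity)
    fun ω => hA.integrable_lSq_and_integral_le hz (hA.smdIter_mem z _ _ t)
  refine indepFun_of_measurable_sigmaOf (I := {i | i.2.2 < t}) hS.meas hS.indep (by simp) ?_
  exact hA.measurable_smdIter (mΩ := sigmaOf S {i | i.2.2 < t})
    (ξ := fun ω t => S (false, k, t) ω) z _ t
    fun i hi => measurable_sigmaOf (S := S) (i := (false, k, i)) hi

lemma Method.Admissible.Y_mem_U (_ : A.Admissible) {x : E} (hx : x ∈ A.Q.X) {y : ℝ} (hy : y ∈ A.Y)
    {l : ℝ} (hl : l = 0 ∨ l = 1) : ((x, y, l) : E × ℝ × ℝ) ∈ A.U := by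
  refine ⟨hx, hy, ?_⟩
  rcases hl with rfl | rfl <;> simp

/-- The regret bound of the inner method in expectation. -/
lemma Method.Admissible.integral_regret_le (hA : A.Admissible) (hS : IsSample S A.Q.law μ) {z : ℝ}
    (hz : 0 < z) (k : ℕ) {x : E} (hx : x ∈ A.Q.X) {y : ℝ} (hy : y ∈ A.Y) :
    Integrable (fun ω => A.regret z (A.p.γ A.ε A.zs z) (A.T z) (fun t => S (false, k, t) ω) x y) μ ∧
    ∫ ω, A.regret z (A.p.γ A.ε A.zs z) (A.T z) (fun t => S (false, k, t) ω) x y ∂μ ≤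
      A.ε * A.p.α / (6 * A.p.K A.ε A.zs) := by
  have hM := A.p.M_pos z
  have hD := hA.params.DV_pos
  have hα := hA.params.α_pos
  have hε := hA.ε_pos
  have hK := A.p.K_pos A.ε A.zs
  have hT : 0 < A.T z := hA.params.T_pos hε z
  have hsT : 0 < √(A.T z : ℝ) := Real.sqrt_pos.2 (by positivity)
  have hsqT : √(A.T z : ℝ) ^ 2 = A.T z := Real.sq_sqrt (by positivity)
  have hle : 36 * A.p.K A.ε A.zs * A.p.M z * A.p.DV / (A.p.α * A.ε) ≤ √(A.T z : ℝ) :=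
    hA.params.le_sqrt_T hε z
  set γ := A.p.γ A.ε A.zs z with hγ
  have hγ' : γ = A.p.DV / (A.p.M z * √(A.T z : ℝ)) := rfl
  obtain ⟨n0, n0le⟩ := hA.noise_sq hS hz γ k (A.T z) (hA.Y_mem_U hx hy (Or.inl rfl))
  obtain ⟨n1, n1le⟩ := hA.noise_sq hS hz γ k (A.T z) (hA.Y_mem_U hx hy (Or.inr rfl))
  have i0 := (n0.integrable one_le_two).abs
  have i1 := (n1.integrable one_le_two).abs
  have e0 := integral_abs_le_sqrt n0 n0le
  have e1 := integral_abs_le_sqrt n1 n1le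
  have iL : Integrable (fun ω => ∑ t ∈ Finset.range (A.T z),
      A.lSq z (A.smdIter z (fun _ => γ) (fun t => S (false, k, t) ω) t) (S (false, k, t) ω)) μ :=
    integrable_finsetSum _ fun t _ => (hA.integral_lSq hS hz γ k t).1
  have eL : ∫ ω, ∑ t ∈ Finset.range (A.T z),
      A.lSq z (A.smdIter z (fun _ => γ) (fun t => S (false, k, t) ω) t) (S (false, k, t) ω) ∂μ ≤
      A.T z * (4 / 3 * A.p.M z ^ 2) := by
    rw [integral_finsetSum _ fun t _ => (hA.integral_lSq hS hz γ k t).1]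
    refine (Finset.sum_le_sum fun t _ => (hA.integral_lSq hS hz γ k t).2).trans_eq ?_
    rw [Finset.sum_const, Finset.card_range, nsmul_eq_mul]
  have ia : Integrable (fun ω => 2 * A.p.DV ^ 2 / γ + γ / 2 * ∑ t ∈ Finset.range (A.T z),
      A.lSq z (A.smdIter z (fun _ => γ) (fun t => S (false, k, t) ω) t) (S (false, k, t) ω)) μ :=
    (integrable_const _).add (iL.const_mul _)
  have ib : Integrable (fun ω => 2 * A.p.DV ^ 2 / γ + γ / 2 * ∑ t ∈ Finset.range (A.T z),
      A.lSq z (A.smdIter z (fun _ => γ) (fun t => S (false, k, t) ω) t) (S (false, k, t) ω)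
      + |A.noise z γ (A.T z) (fun t => S (false, k, t) ω) (x, y, 0)|) μ := ia.add i0
  refine ⟨(ib.add i1).const_mul _, ?_⟩
  unfold Method.regret
  rw [integral_const_mul, integral_add ib i1, integral_add ia i0,
    integral_add (integrable_const _) (iL.const_mul _), integral_const_mul]
  simp only [integral_const, probReal_univ, smul_eq_mul, one_mul]
  -- From `8/3 ≤ (5/3)²`. In units of `√T M_z D_V` the regret collects 2 from the divergence, `2/3`
  -- from the squared norms and `5/3` twice from the noise, 6 in total.
  have hs : √(A.T z * (8 / 3 * A.p.M z ^ 2 * A.p.DV ^ 2)) ≤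
      √(A.T z : ℝ) * (5 / 3 * A.p.M z * A.p.DV) := by
    refine Real.sqrt_le_iff.2 ⟨by positivity, ?_⟩
    rw [mul_pow, hsqT]
    gcongr
    have : 0 ≤ A.p.M z ^ 2 * A.p.DV ^ 2 := by positivity
    nlinarith
  have hγT : γ / 2 * (A.T z * (4 / 3 * A.p.M z ^ 2)) =
      2 / 3 * √(A.T z : ℝ) * (A.p.M z * A.p.DV) := by
    rw [hγ', ← hsqT]; simp only [Real.sqrt_sq hsT.le]; field_simp; norm_num
  have hDγ : 2 * A.p.DV ^ 2 / γ = 2 * √(A.T z : ℝ) * (A.p.M z * A.p.DV) := by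
    rw [hγ']; field_simp
  have hγ0 : 0 < γ := hA.params.γ_pos hε z
  have eL' := mul_le_mul_of_nonneg_left eL (show 0 ≤ γ / 2 by positivity)
  have htot : (A.T z : ℝ)⁻¹ * (6 * √(A.T z : ℝ) * (A.p.M z * A.p.DV)) ≤
      A.ε * A.p.α / (6 * A.p.K A.ε A.zs) := by
    rw [← hsqT]; simp only [Real.sqrt_sq hsT.le]
    rw [div_le_iff₀ (by positivity)] at hle
    rw [le_div_iff₀ (by positivity)]
    have : (√(A.T z : ℝ) ^ 2)⁻¹ * (6 * √(A.T z : ℝ) * (A.p.M z * A.p.DV)) * (6 * A.p.K A.ε A.zs)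
      = 36 * A.p.K A.ε A.zs * A.p.M z * A.p.DV / √(A.T z : ℝ) := by field_simp; norm_num
    rw [this, div_le_iff₀ hsT]
    linarith
  refine le_trans ?_ htot
  gcongr
  linarith

lemma le_max_of_affine {a b l : ℝ} {φ : ℝ → ℝ} (hφ : ∀ l, φ l = a + l * b) (h0 : 0 ≤ l)
    (h1 : l ≤ 1) : φ l ≤ max (φ 0) (φ 1) := by
  simp only [hφ]
  rcases le_total 0 b with h | h
  · exact le_max_of_le_right (by nlinarith)
  · exact le_max_of_le_left (by nlinarith)

lemma Method.Admissible.phi_le_max (hA : A.Admissible) (z : ℝ) {x : E} (hx : x ∈ A.Q.X) (y : ℝ)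
    {l : ℝ} (h0 : 0 ≤ l) (h1 : l ≤ 1) :
    A.phi z (x, y, l) ≤ max (A.phi z (x, y, 0)) (A.phi z (x, y, 1)) :=
  le_max_of_affine (φ := fun l => A.phi z (x, y, l)) (fun l => hA.phi_eq hx z y l) h0 h1

/-- The expected optimality gap against every reference point. -/
lemma Method.Admissible.integral_h_le (hA : A.Admissible) (hS : IsSample S A.Q.law μ) {z : ℝ}
    (hz : 0 < z) (k : ℕ) {xs : E} (hmin : IsMinOn (A.Q.h A.p.c) A.Q.X xs) {x : E}
    (hx : x ∈ A.Q.X) {y : ℝ} (hy : y ∈ A.Y) :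
    ∫ ω, A.Q.h A.p.c (A.xbar z (fun t => S (false, k, t) ω)) ∂μ ≤
      max (A.phi z (x, y, 0)) (A.phi z (x, y, 1)) + A.ε * A.p.α / (6 * A.p.K A.ε A.zs) := by
  have hT : 0 < A.T z := hA.params.T_pos hA.ε_pos z
  have hγ0 : 0 < A.p.γ A.ε A.zs z := hA.params.γ_pos hA.ε_pos z
  obtain ⟨hi, hle⟩ := hA.integral_regret_le hS hz k hx hy
  set Φ := max (A.phi z (x, y, 0)) (A.phi z (x, y, 1)) with hΦ
  have hpath : ∀ ω, A.Q.h A.p.c (A.xbar z (fun t => S (false, k, t) ω)) ≤ Φ +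
      A.regret z (A.p.γ A.ε A.zs z) (A.T z) (fun t => S (false, k, t) ω) x y := by
    intro ω
    have hmem := hA.smdPoint_mem z hγ0.ne' hT (fun t => S (false, k, t) ω)
    obtain ⟨l, hl, h1⟩ := hA.h_le_phi hz hmem.1
      (A.smdPoint z (A.T z) (fun _ => A.p.γ A.ε A.zs z) (fun t => S (false, k, t) ω)).2.1
    have h2 := hA.phi_gap_le hz hγ0 hT (fun t => S (false, k, t) ω) hx hy (Or.inl hz) hl
    have h3 := hA.phi_le_max z hx y hmem.2.2.1 hmem.2.2.2
    rw [sub_self, zero_mul] at h2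
    unfold Method.xbar
    linarith
  -- Optimality of `xs` supplies the lower bound that makes `h(x̄)` integrable.
  have hlow : ∀ ω, A.Q.h A.p.c xs ≤ A.Q.h A.p.c (A.xbar z (fun t => S (false, k, t) ω)) :=
    fun ω => isMinOn_iff.1 hmin _ (hA.smdPoint_mem z hγ0.ne' hT (fun t => S (false, k, t) ω)).1
  have hmeas : Measurable fun ω => A.Q.h A.p.c (A.xbar z (fun t => S (false, k, t) ω)) :=
    hA.measurable_h.comp (hA.measurable_smdPoint z _ _ (ξ := fun ω t => S (false, k, t) ω)
      fun i => hS.meas _).fst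
  have hup := (integrable_const (μ := μ) Φ).add hi
  have hint : Integrable (fun ω => A.Q.h A.p.c (A.xbar z (fun t => S (false, k, t) ω))) μ :=
    integrable_of_le_of_le hmeas.aestronglyMeasurable (ae_of_all _ hlow) (ae_of_all _ hpath)
      (integrable_const _) hup
  have := integral_mono hint hup hpath
  rw [integral_add' (integrable_const _) hi] at this
  simp only [integral_const, probReal_univ, smul_eq_mul, one_mul] at this
  linarith

end Expectation

/-! ### The good event of one inner call -/

section InnerEvent

variable {E Ξ Ω : Type*} [NormedAddCommGroup E] [NormedSpace ℝ E] [FiniteDimensional ℝ E]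
  [MeasurableSpace E] [BorelSpace E] [MeasurableSpace Ξ] [mΩ : MeasurableSpace Ω]
  {A : Method E Ξ}

/-- The event that a call of the inner method at `z` has small regret and small slope noise. -/
def Method.InnerGood (A : Method E Ξ) (xs : E) (z : ℝ) (ξ η : ℕ → Ξ) : Prop :=
  A.regret z (A.p.γ A.ε A.zs z) (A.T z) ξ xs (A.Q.f xs) ≤ A.ε / 2 ∧
    |(z - A.zs) * (A.slope z ξ η - A.slopeAvg z (A.p.γ A.ε A.zs z) (A.T z) ξ)| ≤ A.ε / 4

variable {μ : Measure Ω} [IsProbabilityMeasure μ] {S : Bool × ℕ × ℕ → Ω → Ξ}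

lemma measureReal_lt_le {Y : Ω → ℝ} (hY : Integrable Y μ) (h0 : ∀ ω, 0 ≤ Y ω) {B a : ℝ}
    (hB : ∫ ω, Y ω ∂μ ≤ B) (ha : 0 < a) : μ.real {ω | a < Y ω} ≤ B / a := by
  rw [le_div_iff₀ ha, mul_comm]
  have h1 : μ.real {ω | a < Y ω} ≤ μ.real {ω | a ≤ Y ω} :=
    measureReal_mono fun ω (h : a < Y ω) => h.le
  exact (mul_le_mul_of_nonneg_left h1 ha.le).trans
    ((mul_meas_ge_le_integral_of_nonneg (ae_of_all _ h0) hY a).trans hB)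

lemma Method.Admissible.mean_mem_Y (hA : A.Admissible) {x : E} (hx : x ∈ A.Q.X) :
    A.Q.f x ∈ A.Y := by
  obtain ⟨h1, h2⟩ := abs_le.1 (hA.f_near x hx)
  simp only [Method.Y, Set.mem_Icc]; constructor <;> linarith

lemma Method.Admissible.slope_sub_slopeAvg (hA : A.Admissible) (z : ℝ) (ξ η : ℕ → Ξ) :
    A.slope z ξ η - A.slopeAvg z (A.p.γ A.ε A.zs z) (A.T z) ξ =
      (A.T z : ℝ)⁻¹ * ∑ t ∈ Finset.range (A.T z),
        A.psiSlope z (A.smdIter z (fun _ => A.p.γ A.ε A.zs z) ξ t, η t) := by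
  have hγ0 : 0 < A.p.γ A.ε A.zs z := hA.params.γ_pos hA.ε_pos z
  unfold Method.slope Method.slopeAvg
  rw [A.smdSlope_const z hγ0.ne', ← mul_sub, ← Finset.sum_sub_distrib]
  rfl

lemma Method.Admissible.prob_regret (hA : A.Admissible) (hS : IsSample S A.Q.law μ) {z : ℝ}
    (hz : 0 < z) (k : ℕ) {xs : E} (hxs : xs ∈ A.Q.X) :
    μ.real {ω | A.ε / 2 < A.regret z (A.p.γ A.ε A.zs z) (A.T z) (fun t => S (false, k, t) ω) xs
      (A.Q.f xs)} ≤ A.p.α / (3 * A.p.K A.ε A.zs) := by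
  have hε := hA.ε_pos
  have hK := A.p.K_pos A.ε A.zs
  obtain ⟨hi, hle⟩ := hA.integral_regret_le hS hz k hxs (hA.mean_mem_Y hxs)
  refine (measureReal_lt_le hi (fun ω => A.regret_nonneg z (hA.params.γ_pos hε z) _ _ _ _) hle
    (half_pos hε)).trans_eq ?_
  field_simp
  ring

/-- Chebyshev for the martingale of slope errors. Its variance grows like `z⁻⁴`; one factor `z⁻²` is
offset by `(z - z*)²`, which `hrel` bounds by a multiple of `z²`, and the other by the `z⁻²` in the
number of steps. -/
lemma Method.Admissible.prob_slope (hA : A.Admissible) (hS : IsSample S A.Q.law μ) {z : ℝ}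
    (hz : 0 < z) (k : ℕ) (hzs0 : 0 ≤ A.zs) (hzs : A.zs ≤ 2 * A.p.β)
    (hrel : A.p.z₀ ≤ z ∨ A.zs ≤ 2 * z) :
    μ.real {ω | A.ε / 4 < |(z - A.zs) * (A.slope z (fun t => S (false, k, t) ω)
      (fun t => S (true, k, t) ω) - A.slopeAvg z (A.p.γ A.ε A.zs z) (A.T z)
        (fun t => S (false, k, t) ω))|} ≤ A.p.α / (3 * A.p.K A.ε A.zs) := by
  have hε := hA.ε_pos
  have hα := hA.params.α_pos
  have hz0 := hA.params.z₀_pos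
  have hK := A.p.K_pos A.ε A.zs
  have hT : 0 < A.T z := hA.params.T_pos hε z
  have hT' : (0 : ℝ) < A.T z := by positivity
  have hR := hA.params.R_pos
  have hTle : 384 * A.p.K A.ε A.zs * max 1 (16 * A.p.β ^ 2 / A.p.z₀ ^ 2) *
    (A.p.Mf ^ 4 + 16 * A.p.R ^ 4) * A.p.c ^ 2 / (z ^ 2 * A.p.α * A.ε ^ 2) ≤ (A.T z : ℝ) :=
    hA.params.slope_le_T hε hz
  obtain ⟨h2, hle⟩ := hA.sum_psi hS z (A.p.γ A.ε A.zs z) k (A.T z) true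
    (hA.measurable_psiSlope z) fun _ hu => hA.noise_dz hz hu
  set Q := A.p.Mf ^ 4 + 16 * A.p.R ^ 4 with hQ
  have hQ0 : 0 < Q := by positivity
  set mx := max 1 (16 * A.p.β ^ 2 / A.p.z₀ ^ 2) with hmx
  have hmx1 : 1 ≤ mx := le_max_left _ _
  -- If `z* ≤ 2 z` then `|z - z*| ≤ z`. Otherwise `z ≥ z₀` and `|z - z*| ≤ z* ≤ 2 β`.
  have hratio : (z - A.zs) ^ 2 ≤ z ^ 2 * mx := by
    rcases le_or_gt A.zs (2 * z) with h | h
    · have : (z - A.zs) ^ 2 ≤ z ^ 2 := sq_le_sq' (by linarith) (by linarith)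
      nlinarith [sq_nonneg z]
    · have hzz : A.p.z₀ ≤ z := hrel.resolve_right (not_le.2 h)
      have h1 : (z - A.zs) ^ 2 ≤ (2 * A.p.β) ^ 2 := sq_le_sq' (by linarith) (by linarith)
      have h3 : 16 * A.p.β ^ 2 ≤ z ^ 2 * mx := by
        calc 16 * A.p.β ^ 2 = A.p.z₀ ^ 2 * (16 * A.p.β ^ 2 / A.p.z₀ ^ 2) := by field_simp
          _ ≤ z ^ 2 * mx := by gcongr; exact le_max_right _ _
      nlinarith [sq_nonneg A.p.β]
  set N : Ω → ℝ := fun ω => ∑ t ∈ Finset.range (A.T z), A.psiSlope z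
    (A.smdIter z (fun _ => A.p.γ A.ε A.zs z) (fun t => S (false, k, t) ω) t, S (true, k, t) ω)
  have hint : Integrable (fun ω => ((z - A.zs) * (A.T z : ℝ)⁻¹) ^ 2 * N ω ^ 2) μ :=
    h2.integrable_sq.const_mul _
  have hB : ∫ ω, ((z - A.zs) * (A.T z : ℝ)⁻¹) ^ 2 * N ω ^ 2 ∂μ ≤
      A.p.α * A.ε ^ 2 / (48 * A.p.K A.ε A.zs) := by
    rw [integral_const_mul, mul_pow]
    calc (z - A.zs) ^ 2 * (A.T z : ℝ)⁻¹ ^ 2 * ∫ ω, N ω ^ 2 ∂μ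
        ≤ (z ^ 2 * mx) * (A.T z : ℝ)⁻¹ ^ 2 * (A.T z * (8 * A.p.c ^ 2 / z ^ 4 * Q)) := by gcongr
      _ = 8 * A.p.c ^ 2 * Q * mx / (z ^ 2 * A.T z) := by field_simp
      _ ≤ A.p.α * A.ε ^ 2 / (48 * A.p.K A.ε A.zs) := by
        rw [div_le_iff₀ (by positivity)] at hTle
        rw [div_le_div_iff₀ (by positivity) (by positivity)]
        linarith
  have hsub : {ω | A.ε / 4 < |(z - A.zs) * (A.slope z (fun t => S (false, k, t) ω)
      (fun t => S (true, k, t) ω) - A.slopeAvg z (A.p.γ A.ε A.zs z) (A.T z)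
        (fun t => S (false, k, t) ω))|} ⊆
      {ω | (A.ε / 4) ^ 2 < ((z - A.zs) * (A.T z : ℝ)⁻¹) ^ 2 * N ω ^ 2} := by
    intro ω hω
    rw [Set.mem_ofPred_eq, hA.slope_sub_slopeAvg, ← mul_assoc] at hω
    rw [Set.mem_ofPred_eq, ← mul_pow, ← sq_abs (_ * N ω)]
    gcongr
  refine (measureReal_mono hsub).trans ((measureReal_lt_le hint (fun ω => by positivity) hB
    (by positivity)).trans_eq ?_)
  field_simp
  norm_num

/-- The inner method behaves well with probability at least `1 - α / K`. -/
lemma Method.Admissible.prob_not_innerGood (hA : A.Admissible) (hS : IsSample S A.Q.law μ) {z : ℝ}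
    (hz : 0 < z) (k : ℕ) {xs : E} (hxs : xs ∈ A.Q.X) (hzs : A.zs = 2 * √(A.Q.g xs))
    (hrel : A.p.z₀ ≤ z ∨ A.zs ≤ 2 * z) :
    μ {ω | ¬ A.InnerGood xs z (fun t => S (false, k, t) ω) (fun t => S (true, k, t) ω)} ≤
      ENNReal.ofReal (A.p.α / A.p.K A.ε A.zs) := by
  have hα := hA.params.α_pos
  have hK := A.p.K_pos A.ε A.zs
  have hzs0 : 0 ≤ A.zs := by rw [hzs]; positivity
  have hzsβ : A.zs ≤ 2 * A.p.β := by
    rw [hzs]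
    have := Real.sqrt_le_sqrt (hA.g_le hxs)
    rw [Real.sqrt_sq hA.params.β_nonneg] at this
    linarith
  have h1 := hA.prob_regret hS hz k hxs
  have h2 := hA.prob_slope hS hz k hzs0 hzsβ hrel
  rw [← ENNReal.ofReal_toReal (measure_ne_top μ _)]
  refine ENNReal.ofReal_le_ofReal ?_
  change μ.real _ ≤ _
  have hsub : {ω | ¬ A.InnerGood xs z (fun t => S (false, k, t) ω) (fun t => S (true, k, t) ω)} ⊆
      {ω | A.ε / 2 < A.regret z (A.p.γ A.ε A.zs z) (A.T z) (fun t => S (false, k, t) ω) xs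
        (A.Q.f xs)} ∪
      {ω | A.ε / 4 < |(z - A.zs) * (A.slope z (fun t => S (false, k, t) ω)
        (fun t => S (true, k, t) ω) - A.slopeAvg z (A.p.γ A.ε A.zs z) (A.T z)
          (fun t => S (false, k, t) ω))|} := by
    intro ω hω
    simp only [Method.InnerGood, Set.mem_ofPred_eq, not_and_or, not_le] at hω
    exact hω
  refine (measureReal_mono hsub).trans ((measureReal_union_le _ _).trans
    ((add_le_add h1 h2).trans ?_))
  rw [← add_div, div_le_div_iff₀ (by positivity) hK]
  nlinarith [mul_pos hα hK]

/-- Deterministic consequences of the good event of the inner method. -/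
lemma Method.Admissible.outcome (hA : A.Admissible) (hS : IsSample S A.Q.law μ) {z : ℝ}
    (hz : 0 < z) (k : ℕ) {xs : E} (hxs : xs ∈ A.Q.X) (hmin : IsMinOn (A.Q.h A.p.c) A.Q.X xs)
    (hzs : A.zs = 2 * √(A.Q.g xs)) {ξ η : ℕ → Ξ} (hgood : A.InnerGood xs z ξ η) :
    (A.p.c * (z - A.zs) ^ 2 / (4 * z) ≤ A.ε / 4 →
      A.Q.h A.p.c (A.xbar z ξ) - A.Q.h A.p.c xs ≤ A.ε ∧
      (∫ ω, A.Q.h A.p.c (A.xbar z (fun t => S (false, k, t) ω)) ∂μ) - A.Q.h A.p.c xs ≤ A.ε) ∧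
    (¬ (A.Q.h A.p.c (A.xbar z ξ) - A.Q.h A.p.c xs ≤ A.ε ∧
      (∫ ω, A.Q.h A.p.c (A.xbar z (fun t => S (false, k, t) ω)) ∂μ) - A.Q.h A.p.c xs ≤ A.ε) →
      (A.slope z ξ η < 0 → z < A.zs) ∧ (¬ A.slope z ξ η < 0 → A.zs < z)) := by
  have hε := hA.ε_pos
  have hα := hA.params.α_pos
  have hα1 := hA.params.α_lt_one
  have hK2 : (2 : ℝ) ≤ A.p.K A.ε A.zs := by exact_mod_cast A.p.two_le_K A.ε A.zs
  have hT : 0 < A.T z := hA.params.T_pos hε z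
  have hγ0 : 0 < A.p.γ A.ε A.zs z := hA.params.γ_pos hε z
  -- From `K ≥ 2` and `α < 1`. The margin `ε/12` fits beside the `3ε/4` used by regret and slope
  -- error.
  have hr : A.ε * A.p.α / (6 * A.p.K A.ε A.zs) ≤ A.ε / 12 := by
    rw [div_le_div_iff₀ (by positivity) (by norm_num)]
    nlinarith [mul_pos hε hα]
  have hfY := hA.mean_mem_Y hxs
  obtain ⟨hreg, hns⟩ := hgood
  have hmem := hA.smdPoint_mem z hγ0.ne' hT ξ
  constructor
  · intro hnear
    have hphi : ∀ l, A.phi z (xs, A.Q.f xs, l) ≤ A.Q.h A.p.c xs + A.ε / 4 := by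
      intro l
      rw [hA.phi_mean hz hxs, ← hzs]
      linarith
    constructor
    · obtain ⟨l, hl, h1⟩ := hA.h_le_phi hz hmem.1
        (A.smdPoint z (A.T z) (fun _ => A.p.γ A.ε A.zs z) ξ).2.1
      have h2 := hA.phi_gap_le hz hγ0 hT ξ hxs hfY (Or.inl hz) hl
      have h3 := hphi (A.smdPoint z (A.T z) (fun _ => A.p.γ A.ε A.zs z) ξ).2.2
      rw [sub_self, zero_mul] at h2
      unfold Method.xbar
      linarith
    · have h1 := hA.integral_h_le hS hz k hmin hxs hfY
      have h2 := max_le (hphi 0) (hphi 1)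
      linarith
  · intro hnot
    -- When `z* = 0` the upper deviation at `xs` vanishes almost surely, which is the degenerate
    -- case admitted in `phi_gap_le`.
    have hzs' : 0 < A.zs ∨ A.zs = 0 ∧ ∀ᵐ s ∂A.Q.law, max (A.Q.F xs s - A.Q.f xs) 0 = 0 := by
      rcases (show 0 ≤ A.zs by rw [hzs]; positivity).eq_or_lt with h | h
      · exact Or.inr ⟨h.symm, hA.ae_max_eq_zero hxs (by rw [← hzs, ← h])⟩
      · exact Or.inl h
    have hgap : ∀ l : ℝ, l = 0 ∨ l = 1 →
        A.phi z ((A.smdPoint z (A.T z) (fun _ => A.p.γ A.ε A.zs z) ξ).1,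
          (A.smdPoint z (A.T z) (fun _ => A.p.γ A.ε A.zs z) ξ).2.1, l) - A.Q.h A.p.c xs ≤
        A.ε / 2 + A.ε / 4 + (z - A.zs) * A.slope z ξ η := by
      intro l hl
      have h2 := hA.phi_gap_le hz hγ0 hT ξ hxs hfY hzs' hl
      have h3 := hA.phi_opt hxs (A.smdPoint z (A.T z) (fun _ => A.p.γ A.ε A.zs z) ξ).2.2
      rw [← hzs] at h3
      have h4 := (abs_le.1 hns).1
      rw [mul_sub] at h4
      linarith
    -- If the product were nonpositive, the gap would be at most `3ε/4`, contradicting failure.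
    have hpos : 0 < (z - A.zs) * A.slope z ξ η := by
      by_contra! hle
      refine hnot ⟨?_, ?_⟩
      · obtain ⟨l, hl, h1⟩ := hA.h_le_phi hz hmem.1
          (A.smdPoint z (A.T z) (fun _ => A.p.γ A.ε A.zs z) ξ).2.1
        have h2 := hgap l hl
        unfold Method.xbar
        linarith
      -- The reference point is the average point just realized along `ξ`. It is a constant for the
      -- run integrated here, and `φ_z` there exceeds the optimum by at most `3ε/4` for both
      -- multipliers.
      · have h1 := hA.integral_h_le hS hz k hmin hmem.1 hmem.2.1
        have h2 := hgap 0 (Or.inl rfl)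
        have h3 := hgap 1 (Or.inr rfl)
        rcases max_choice (A.phi z ((A.smdPoint z (A.T z) (fun _ => A.p.γ A.ε A.zs z) ξ).1,
          (A.smdPoint z (A.T z) (fun _ => A.p.γ A.ε A.zs z) ξ).2.1, 0))
          (A.phi z ((A.smdPoint z (A.T z) (fun _ => A.p.γ A.ε A.zs z) ξ).1,
          (A.smdPoint z (A.T z) (fun _ => A.p.γ A.ε A.zs z) ξ).2.1, 1)) with h | h <;>
        · rw [h] at h1
          linarith
    constructor
    · intro hneg
      nlinarith
    · intro hneg
      push Not at hneg
      nlinarith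

end InnerEvent

/-! ### The outer search, deterministically -/

section Outer

variable {p : Params} {ε zs : ℝ}

lemma Params.M_anti (p : Params) {z z' : ℝ} (hz : 0 < z) (h : z ≤ z') : p.M z' ≤ p.M z := by
  unfold Params.M
  gcongr

lemma Params.Valid.T_le (hp : p.Valid) (hε : 0 < ε) {z z' : ℝ} (hz : 0 < z) (h : z ≤ z') :
    p.T ε zs z' ≤ ⌈p.budget ε zs z⌉₊ := by
  refine Nat.ceil_le_ceil ?_
  have h1 := hp.Ctilde_pos (ε := ε) (zs := zs)
  have h2 := p.M_pos z'
  unfold Params.budget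
  gcongr
  exact p.M_anti hz h

/-- A doubling step at trial value `2 ^ j * z₀` with correct sign implies this hypothesis; so `K₁`
bounds the doubling phase, including the iteration that ends it. -/
lemma Params.Valid.lt_K₁ (hp : p.Valid) {j : ℕ} (h : 2 ^ j * p.z₀ < zs) : j + 1 < p.K₁ zs := by
  refine lt_max_of_lt_right (Nat.lt_ceil.2 ?_)
  have hz0 := hp.z₀_pos
  have hzs : 0 < zs := lt_trans (by positivity) h
  rw [Real.lt_logb_iff_rpow_lt (by norm_num) (by positivity), Real.rpow_natCast,
    lt_div_iff₀ hz0, pow_succ]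
  linarith

lemma Params.Valid.le_two_pow_K₂ (hp : p.Valid) (hε : 0 < ε) :
    4 * p.c * max zs (p.z₀ / 2) / ε ≤ 2 ^ p.K₂ ε zs := by
  have hz0 := hp.z₀_pos
  have hc := hp.c_pos
  have hw : 0 < max zs (p.z₀ / 2) := lt_max_of_lt_right (by positivity)
  have h : Real.logb 2 (4 * p.c * max zs (p.z₀ / 2) / ε) ≤ (p.K₂ ε zs : ℝ) := by
    refine (Nat.le_ceil _).trans ?_
    exact_mod_cast (le_max_right _ _).trans (le_max_right _ _)
  rwa [Real.logb_le_iff_le_rpow (by norm_num) (by positivity), Real.rpow_natCast] at h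

/-- What holds before outer iteration `k` as long as no success has occurred. -/
def OuterState.Inv (p : Params) (ε zs : ℝ) (s : OuterState) (k : ℕ) : Prop :=
  s.stopped = false ∧ s.samples ≤ 2 * k * ⌈p.Ttilde ε zs⌉₊ ∧
  ((s.doubling = true ∧ s.a = 0 ∧ s.b = 2 ^ k * p.z₀ ∧ ∀ j, k = j + 1 → 2 ^ j * p.z₀ < zs) ∨
   (s.doubling = false ∧ 0 ≤ s.a ∧ s.a ≤ zs ∧ zs ≤ s.b ∧ ε / p.c < s.b ∧
    ∃ j ≤ k, 1 ≤ j ∧ j ≤ p.K₁ zs ∧ (s.b - s.a) * 2 ^ (k - j) ≤ 2 * max zs (p.z₀ / 2)))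

variable {s : OuterState} {k : ℕ}

/-- In bisection, `2 z = a + b ≥ b`, and `b` exceeds both `ε/c` and (weakly) `z*`. The three
conclusions serve the inner method, the slope estimate and the sample count. -/
lemma OuterState.Inv.trial (hp : p.Valid) (hε : 0 < ε) (hs : s.Inv p ε zs k) :
    0 < s.trial ∧ (p.z₀ ≤ s.trial ∨ zs ≤ 2 * s.trial) ∧
      min p.z₀ (max (zs / 2) (ε / (2 * p.c))) ≤ s.trial := by
  have hz0 := hp.z₀_pos
  have hc := hp.c_pos
  have hθ : 0 < ε / p.c := by positivity
  obtain ⟨-, -, ⟨hd, ha, hb, -⟩ | ⟨hd, ha, h1, h2, h3, -⟩⟩ := hs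
  · have htr : s.trial = 2 ^ k * p.z₀ := by simp [OuterState.trial, hd, hb]
    have : p.z₀ ≤ 2 ^ k * p.z₀ := le_mul_of_one_le_left hz0.le (one_le_pow₀ one_le_two)
    rw [htr]
    exact ⟨by positivity, Or.inl this, (min_le_left _ _).trans this⟩
  · have htr : s.trial = (s.a + s.b) / 2 := by simp [OuterState.trial, hd]
    rw [htr]
    refine ⟨by linarith, Or.inr (by linarith), (min_le_right _ _).trans (max_le (by linarith) ?_)⟩
    have : ε / (2 * p.c) = ε / p.c / 2 := by field_simp
    linarith

lemma OuterState.Inv.samples_step (hp : p.Valid) (hε : 0 < ε)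
    (hs : s.Inv p ε zs k) (θ ζ : ℝ) :
    (s.step θ ζ (p.T ε zs s.trial)).samples ≤ 2 * (k + 1) * ⌈p.Ttilde ε zs⌉₊ := by
  have hz0 := hp.z₀_pos
  have hc := hp.c_pos
  obtain ⟨-, -, h3⟩ := hs.trial hp hε
  have hpos : 0 < min p.z₀ (max (zs / 2) (ε / (2 * p.c))) :=
    lt_min hz0 (lt_max_of_lt_right (by positivity))
  have hT : p.T ε zs s.trial ≤ ⌈p.Ttilde ε zs⌉₊ := hp.T_le hε hpos h3
  have h1 : s.samples + 2 * p.T ε zs s.trial ≤ 2 * (k + 1) * ⌈p.Ttilde ε zs⌉₊ := by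
    have := hs.2.1
    nlinarith
  unfold OuterState.step
  simp only [hs.1, Bool.false_eq_true, if_false]
  split_ifs <;> exact h1

/-- Here `|z - z*| ≤ z`, so the excess is at most `c z / 4`. Hence a trial value above `z*` that
triggers the stopping rule is already successful. -/
lemma near_of_le {c z : ℝ} (hc : 0 < c) (hz : 0 < z) (hzs : 0 ≤ zs) (h : zs ≤ z)
    (hz' : z ≤ ε / c) : c * (z - zs) ^ 2 / (4 * z) ≤ ε / 4 := by
  rw [le_div_iff₀ hc] at hz'
  rw [div_le_div_iff₀ (by positivity) (by norm_num)]
  have h1 : (z - zs) ^ 2 ≤ z ^ 2 := sq_le_sq' (by linarith) (by linarith)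
  have h2 : c * (z - zs) ^ 2 ≤ c * z ^ 2 := by gcongr
  nlinarith

lemma OuterState.Inv.step (hp : p.Valid) (hε : 0 < ε) (hzs : 0 ≤ zs)
    (hs : s.Inv p ε zs k) {ζ : ℝ}
    (hnear : ε / 4 < p.c * (s.trial - zs) ^ 2 / (4 * s.trial))
    (hneg : ζ < 0 → s.trial < zs) (hnonneg : ¬ ζ < 0 → zs < s.trial) :
    (s.step (ε / p.c) ζ (p.T ε zs s.trial)).Inv p ε zs (k + 1) := by
  have hz0 := hp.z₀_pos
  have hc := hp.c_pos
  obtain ⟨htr, -, -⟩ := hs.trial hp hε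
  have hsam := hs.samples_step hp hε (ε / p.c) ζ
  have hw1 : zs ≤ max zs (p.z₀ / 2) := le_max_left _ _
  have hw2 : p.z₀ / 2 ≤ max zs (p.z₀ / 2) := le_max_right _ _
  have hθ : zs < s.trial → ε / p.c < s.trial := fun h => by
    by_contra! hle
    exact absurd (near_of_le hc htr hzs h.le hle) (not_le.2 hnear)
  obtain ⟨hst, -, ⟨hd, ha, hb, hprev⟩ | ⟨hd, ha, h1, h2, h3, j, hjk, hj1, hjK, hlen⟩⟩ := hs
  · have htr' : s.trial = s.b := by simp [OuterState.trial, hd]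
    by_cases hζ : ζ < 0
    · have hstep : s.step (ε / p.c) ζ (p.T ε zs s.trial) =
          { s with b := 2 * s.b, samples := s.samples + 2 * p.T ε zs s.trial } := by
        simp [OuterState.step, hst, hd, hζ]
      rw [hstep] at hsam ⊢
      refine ⟨hst, hsam, Or.inl ⟨hd, ha, ?_, fun j hj => ?_⟩⟩
      · simp only [hb]; ring
      · obtain rfl : k = j := by omega
        have := hneg hζ
        rwa [htr', hb] at this
    · have hstep : s.step (ε / p.c) ζ (p.T ε zs s.trial) =
          { s with doubling := false, samples := s.samples + 2 * p.T ε zs s.trial } := by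
        simp [OuterState.step, hst, hd, hζ]
      rw [hstep] at hsam ⊢
      have hlt := hnonneg hζ
      have hθ' := hθ hlt
      rw [htr'] at hlt hθ'
      refine ⟨hst, hsam, Or.inr ⟨rfl, ha.ge, ha.trans_le hzs, hlt.le, hθ', k + 1, le_rfl,
        by omega, ?_, ?_⟩⟩
      · rcases k with _ | j
        · exact le_max_left _ _
        · exact hp.lt_K₁ (hprev j rfl)
      -- Initial bisection length: `z₀` if no doubling occurred, otherwise `2 ^ (j+1) * z₀ < 2 z*`;
      -- both are at most `2 w`.
      · simp only [Nat.sub_self, pow_zero, mul_one, ha, hb, sub_zero]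
        rcases k with _ | j
        · simp only [pow_zero, one_mul]; linarith
        · have := hprev j rfl
          rw [pow_succ]
          linarith
  · have htr' : s.trial = (s.a + s.b) / 2 := by simp [OuterState.trial, hd]
    have hpow : (2 : ℝ) ^ (k + 1 - j) = 2 * 2 ^ (k - j) := by
      rw [Nat.succ_sub hjk, pow_succ]; ring
    by_cases hζ : ζ < 0
    · have hlt := hneg hζ
      have hstep : s.step (ε / p.c) ζ (p.T ε zs s.trial) =
          { doubling := false, a := s.trial, b := s.b, stopped := false,
            samples := s.samples + 2 * p.T ε zs s.trial } := by
        simp [OuterState.step, hst, hd, hζ, h3]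
      rw [hstep] at hsam ⊢
      refine ⟨rfl, hsam, Or.inr ⟨rfl, htr.le, hlt.le, h2, h3, j, by omega, hj1, hjK, ?_⟩⟩
      simp only [hpow, htr']
      linarith
    · have hlt := hnonneg hζ
      have hθ' := hθ hlt
      have hstep : s.step (ε / p.c) ζ (p.T ε zs s.trial) =
          { doubling := false, a := s.a, b := s.trial, stopped := false,
            samples := s.samples + 2 * p.T ε zs s.trial } := by
        simp [OuterState.step, hst, hd, hζ, hθ']
      rw [hstep] at hsam ⊢
      refine ⟨rfl, hsam, Or.inr ⟨rfl, ha, h1, hlt.le, hθ', j, by omega, hj1, hjK, ?_⟩⟩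
      simp only [hpow, htr']
      linarith

/-- At the last iteration the trial value is close enough to `zs`. -/
lemma OuterState.Inv.near (hp : p.Valid) (hε : 0 < ε)
    (hs : s.Inv p ε zs k) (hk : k + 1 = p.K ε zs) :
    p.c * (s.trial - zs) ^ 2 / (4 * s.trial) ≤ ε / 4 := by
  have hz0 := hp.z₀_pos
  have hc := hp.c_pos
  obtain ⟨htr, -, -⟩ := hs.trial hp hε
  have hK₁ : 1 ≤ p.K₁ zs := le_max_left _ _
  have hK₂ : 1 ≤ p.K₂ ε zs := le_max_left _ _
  have hK : p.K ε zs = p.K₁ zs + p.K₂ ε zs := rfl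
  obtain ⟨-, -, ⟨hd, -, -, hprev⟩ | ⟨hd, ha, h1, h2, h3, j, hjk, hj1, hjK, hlen⟩⟩ := hs
  · exfalso
    rcases k with _ | j
    · omega
    · have := hp.lt_K₁ (hprev j rfl)
      omega
  · have htr' : s.trial = (s.a + s.b) / 2 := by simp [OuterState.trial, hd]
    have hw : 0 < max zs (p.z₀ / 2) := lt_max_of_lt_right (by positivity)
    -- Bisection began at an iteration `j ≤ K₁`, so before the last trial there have been at least
    -- `K₂ - 1` halvings; this gives half of the bound for `2 ^ K₂`.
    have hpow : 2 * p.c * max zs (p.z₀ / 2) / ε ≤ 2 ^ (k - j) := by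
      have h4 := hp.le_two_pow_K₂ (zs := zs) hε
      have h5 : (2 : ℝ) ^ (p.K₂ ε zs) ≤ 2 ^ (k - j + 1) := pow_le_pow_right₀ one_le_two (by omega)
      rw [pow_succ] at h5
      have : 4 * p.c * max zs (p.z₀ / 2) / ε = 2 * (2 * p.c * max zs (p.z₀ / 2) / ε) := by ring
      linarith
    have hba : s.b - s.a ≤ ε / p.c := by
      have h6 : (s.b - s.a) * (2 * p.c * max zs (p.z₀ / 2) / ε) ≤ 2 * max zs (p.z₀ / 2) :=
        (mul_le_mul_of_nonneg_left hpow (by linarith)).trans hlen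
      rw [le_div_iff₀ hc]
      have h7 : (s.b - s.a) * (2 * p.c * max zs (p.z₀ / 2) / ε) =
        (s.b - s.a) * p.c * (2 * max zs (p.z₀ / 2)) / ε := by ring
      rw [h7, div_le_iff₀ hε, mul_comm (2 * max zs (p.z₀ / 2)) ε] at h6
      exact le_of_mul_le_mul_right h6 (by positivity)
    rw [div_le_div_iff₀ (by positivity) (by norm_num)]
    set q := ε / p.c with hq
    have hεq : ε = p.c * q := by rw [hq]; field_simp
    -- The midpoint is within `q/2` of `z*` and, since `b > q` and `a ≥ 0`, is at least `q/2`. The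
    -- excess is then at most `c q / 8 = ε / 8`.
    have h8 : (s.trial - zs) ^ 2 ≤ (q / 2) ^ 2 := sq_le_sq' (by linarith) (by linarith)
    have h9 : q / 2 ≤ s.trial := by linarith
    have hq0 : 0 < q := by positivity
    rw [hεq]
    have h10 : p.c * (s.trial - zs) ^ 2 ≤ p.c * (q / 2) ^ 2 := by gcongr
    have h11 : p.c * q * (q / 2) ≤ p.c * q * s.trial := by gcongr
    nlinarith [mul_pos hc (mul_pos hq0 hq0)]

/-- The outer method succeeds when all its inner calls behave well. -/
lemma exists_success (hp : p.Valid) (hε : 0 < ε) (hzs : 0 ≤ zs) {st : ℕ → OuterState} {ζ : ℕ → ℝ}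
    {Good : ℕ → Prop}
    (h0 : st 0 = { doubling := true, a := 0, b := p.z₀, stopped := false, samples := 0 })
    (hst : ∀ k, st (k + 1) = (st k).step (ε / p.c) (ζ k) (p.T ε zs (st k).trial))
    (hnear : ∀ k < p.K ε zs, 0 < (st k).trial →
      (p.z₀ ≤ (st k).trial ∨ zs ≤ 2 * (st k).trial) →
      p.c * ((st k).trial - zs) ^ 2 / (4 * (st k).trial) ≤ ε / 4 → Good k)
    (hsign : ∀ k < p.K ε zs, 0 < (st k).trial →
      (p.z₀ ≤ (st k).trial ∨ zs ≤ 2 * (st k).trial) → ¬ Good k →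
      (ζ k < 0 → (st k).trial < zs) ∧ (¬ ζ k < 0 → zs < (st k).trial)) :
    ∃ k < p.K ε zs, (st k).stopped = false ∧ Good k ∧
      (st (k + 1)).samples ≤ 2 * p.K ε zs * ⌈p.Ttilde ε zs⌉₊ := by
  by_contra! hno
  have hK := p.two_le_K ε zs
  have hfail : ∀ k < p.K ε zs, (st k).Inv p ε zs k → ¬ Good k := by
    intro k hk hinv hg
    have h1 := hno k hk hinv.1 hg
    have h2 := hinv.samples_step hp hε (ε / p.c) (ζ k)
    rw [← hst] at h2
    have h3 : 2 * (k + 1) * ⌈p.Ttilde ε zs⌉₊ ≤ 2 * p.K ε zs * ⌈p.Ttilde ε zs⌉₊ := by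
      gcongr; omega
    omega
  have hinv : ∀ k < p.K ε zs, (st k).Inv p ε zs k := by
    intro k
    induction k with
    | zero =>
      intro _
      rw [h0]
      exact ⟨rfl, by simp, Or.inl ⟨rfl, rfl, by simp, fun j hj => by omega⟩⟩
    | succ k ih =>
      intro hk
      have hk' : k < p.K ε zs := by omega
      have hi := ih hk'
      obtain ⟨t1, t2, -⟩ := hi.trial hp hε
      have hng := hfail k hk' hi
      obtain ⟨s1, s2⟩ := hsign k hk' t1 t2 hng
      rw [hst]
      refine hi.step hp hε hzs ?_ s1 s2
      by_contra! hle
      exact hng (hnear k hk' t1 t2 hle)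
  have hlast : p.K ε zs - 1 < p.K ε zs := by omega
  have hi := hinv _ hlast
  obtain ⟨t1, t2, -⟩ := hi.trial hp hε
  exact hfail _ hlast hi (hnear _ hlast t1 t2 (hi.near hp hε (by omega)))

end Outer

/-! ### Random trial values and the union bound -/

section OuterProbability

variable {E Ξ Ω : Type*} [NormedAddCommGroup E] [NormedSpace ℝ E] [FiniteDimensional ℝ E]
  [MeasurableSpace E] [BorelSpace E] [MeasurableSpace Ξ] [mΩ : MeasurableSpace Ω]
  {A : Method E Ξ}

/-- The slope estimate enters the outer loop through its sign alone, so each state has at most two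
successors. -/
lemma OuterState.step_of_neg (s : OuterState) (θ : ℝ) {ζ : ℝ} (h : ζ < 0) (T : ℕ) :
    s.step θ ζ T = s.step θ (-1) T := by
  simp [OuterState.step, h]

lemma OuterState.step_of_nonneg (s : OuterState) (θ : ℝ) {ζ : ℝ} (h : ¬ ζ < 0) (T : ℕ) :
    s.step θ ζ T = s.step θ 0 T := by
  simp [OuterState.step, h]

/-- Only finitely many states can occur before outer iteration `k`. -/
lemma Method.finite_range_state (A : Method E Ξ) (k : ℕ) :
    ∃ R : Finset OuterState, ∀ ξ η : ℕ → ℕ → Ξ, A.state ξ η k ∈ R := by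
  classical
  induction k with
  | zero => exact ⟨{_}, fun ξ η => Finset.mem_singleton_self _⟩
  | succ k ih =>
    obtain ⟨R, hR⟩ := ih
    refine ⟨R.image (fun s => s.step (A.ε / A.p.c) (-1) (A.T s.trial)) ∪
      R.image (fun s => s.step (A.ε / A.p.c) 0 (A.T s.trial)), fun ξ η => ?_⟩
    rw [Finset.mem_union, Finset.mem_image, Finset.mem_image]
    simp only [Method.state]
    by_cases h : A.slope (A.state ξ η k).trial (ξ k) (η k) < 0
    · exact Or.inl ⟨_, hR ξ η, (OuterState.step_of_neg _ _ h _).symm⟩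
    · exact Or.inr ⟨_, hR ξ η, (OuterState.step_of_nonneg _ _ h _).symm⟩

/-- The range is finite, so every set of states can be treated directly, without a σ-algebra on
states. Only samples of outer iterations before `k` are used, as required for the independence
argument. -/
lemma Method.Admissible.measurableSet_state (hA : A.Admissible) {ξ η : Ω → ℕ → ℕ → Ξ} (k : ℕ)
    (hξ : ∀ j < k, ∀ t, Measurable fun ω => ξ ω j t)
    (hη : ∀ j < k, ∀ t, Measurable fun ω => η ω j t) (B : Set OuterState) :
    MeasurableSet {ω | A.state (ξ ω) (η ω) k ∈ B} := by
  induction k generalizing B with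
  | zero =>
    simp only [Method.state]
    exact MeasurableSet.const _
  | succ k ih =>
    obtain ⟨R, hR⟩ := A.finite_range_state k
    have hi := ih (fun j hj => hξ j (by omega)) (fun j hj => hη j (by omega))
    have hslope : ∀ s : OuterState, MeasurableSet {ω | A.slope s.trial (ξ ω k) (η ω k) < 0} :=
      fun s => measurableSet_lt (hA.measurable_smdSlope s.trial _ _ (hξ k (by omega))
        (hη k (by omega))) measurable_const
    have heq : {ω | A.state (ξ ω) (η ω) (k + 1) ∈ B} = ⋃ s ∈ R,
        {ω | A.state (ξ ω) (η ω) k ∈ ({s} : Set OuterState)} ∩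
        (({ω | A.slope s.trial (ξ ω k) (η ω k) < 0} ∩
            {_ω | s.step (A.ε / A.p.c) (-1) (A.T s.trial) ∈ B}) ∪
          ({ω | A.slope s.trial (ξ ω k) (η ω k) < 0}ᶜ ∩
            {_ω | s.step (A.ε / A.p.c) 0 (A.T s.trial) ∈ B})) := by
      ext ω
      simp only [Set.mem_iUnion, Set.mem_inter_iff, Set.mem_union, Set.mem_compl_iff,
        Set.mem_ofPred_eq, Set.mem_singleton_iff, exists_prop]
      have hstep : A.state (ξ ω) (η ω) (k + 1) = (A.state (ξ ω) (η ω) k).step (A.ε / A.p.c)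
        (A.slope (A.state (ξ ω) (η ω) k).trial (ξ ω k) (η ω k))
        (A.T (A.state (ξ ω) (η ω) k).trial) := rfl
      rw [hstep]
      constructor
      · intro h
        refine ⟨_, hR (ξ ω) (η ω), rfl, ?_⟩
        by_cases hn : A.slope (A.state (ξ ω) (η ω) k).trial (ξ ω k) (η ω k) < 0
        · exact Or.inl ⟨hn, by rwa [OuterState.step_of_neg _ _ hn] at h⟩
        · exact Or.inr ⟨hn, by rwa [OuterState.step_of_nonneg _ _ hn] at h⟩
      · rintro ⟨s, -, rfl, ⟨hn, h⟩ | ⟨hn, h⟩⟩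
        · rwa [OuterState.step_of_neg _ _ hn]
        · rwa [OuterState.step_of_nonneg _ _ hn]
    rw [heq]
    exact R.measurableSet_biUnion fun s _ => (hi {s}).inter
      (((hslope s).inter (MeasurableSet.const _)).union
        ((hslope s).compl.inter (MeasurableSet.const _)))

lemma Method.Admissible.measurable_noise (hA : A.Admissible) (z γ : ℝ) (T : ℕ) {ξ : Ω → ℕ → Ξ}
    (hξ : ∀ t, Measurable fun ω => ξ ω t) (v : E × ℝ × ℝ) :
    Measurable fun ω => A.noise z γ T (ξ ω) v := by
  have h : Measurable fun ω => ∑ t ∈ Finset.range T,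
      A.psiForm z v (A.smdIter z (fun _ => γ) (ξ ω) t, ξ ω t) := by
    refine Finset.measurable_fun_sum _ fun t _ => ?_
    exact (hA.measurable_psiForm z v).comp
      ((hA.measurable_smdIter z _ t fun i _ => hξ i).prodMk (hξ t))
  exact h

lemma Method.Admissible.measurableSet_innerGood (hA : A.Admissible) (xs : E) (z : ℝ)
    {ξ η : Ω → ℕ → Ξ} (hξ : ∀ t, Measurable fun ω => ξ ω t)
    (hη : ∀ t, Measurable fun ω => η ω t) :
    MeasurableSet {ω | A.InnerGood xs z (ξ ω) (η ω)} := by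
  have hreg : Measurable fun ω => A.regret z (A.p.γ A.ε A.zs z) (A.T z) (ξ ω) xs (A.Q.f xs) := by
    have h1 : Measurable fun ω => ∑ t ∈ Finset.range (A.T z),
        A.lSq z (A.smdIter z (fun _ => A.p.γ A.ε A.zs z) (ξ ω) t) (ξ ω t) :=
      Finset.measurable_fun_sum _ fun t _ =>
        hA.measurable_lSq z (hA.measurable_smdIter z _ t fun i _ => hξ i) (hξ t)
    have h2 := fun v => (hA.measurable_noise z (A.p.γ A.ε A.zs z) (A.T z) hξ v).norm
    exact (((measurable_const.add (h1.const_mul _)).add (h2 _)).add (h2 _)).const_mul _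
  have hsl : Measurable fun ω => A.slope z (ξ ω) (η ω) := hA.measurable_smdSlope z _ _ hξ hη
  have havg : Measurable fun ω => A.slopeAvg z (A.p.γ A.ε A.zs z) (A.T z) (ξ ω) :=
    (Finset.measurable_fun_sum _ fun t _ => (hA.measurable_slopeMean z).comp
      (hA.measurable_smdIter z _ t fun i _ => hξ i)).const_mul _
  exact (measurableSet_le hreg measurable_const).inter
    (measurableSet_le ((hsl.sub havg).const_mul _).norm measurable_const)

variable {μ : Measure Ω} [IsProbabilityMeasure μ] {S : Bool × ℕ × ℕ → Ω → Ξ}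

/-- The event that outer iteration `k` has a relevant trial value and a badly behaved inner call. -/
def Method.badSet (A : Method E Ξ) (S : Bool × ℕ × ℕ → Ω → Ξ) (xs : E) (k : ℕ) : Set Ω :=
  {ω | A.state (fun k t => S (false, k, t) ω) (fun k t => S (true, k, t) ω) k ∈
      {s : OuterState | 0 < s.trial ∧ (A.p.z₀ ≤ s.trial ∨ A.zs ≤ 2 * s.trial)} ∧
    ¬ A.InnerGood xs
      (A.state (fun k t => S (false, k, t) ω) (fun k t => S (true, k, t) ω) k).trial
      (fun t => S (false, k, t) ω) (fun t => S (true, k, t) ω)}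

lemma Method.Admissible.badSet_spec (hA : A.Admissible) (hS : IsSample S A.Q.law μ) {xs : E}
    (hxs : xs ∈ A.Q.X) (hzs : A.zs = 2 * √(A.Q.g xs)) (k : ℕ) :
    MeasurableSet (A.badSet S xs k) ∧
      μ (A.badSet S xs k) ≤ ENNReal.ofReal (A.p.α / A.p.K A.ε A.zs) := by
  classical
  obtain ⟨R, hR⟩ := A.finite_range_state k
  set st : Ω → OuterState := fun ω =>
    A.state (fun k t => S (false, k, t) ω) (fun k t => S (true, k, t) ω) k with hst
  set Rel : Set OuterState := {s | 0 < s.trial ∧ (A.p.z₀ ≤ s.trial ∨ A.zs ≤ 2 * s.trial)}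
  have hpast : ∀ s : OuterState, MeasurableSet[sigmaOf S {i | i.2.1 < k}] {ω | st ω ∈ ({s} : Set _)} :=
    fun s => hA.measurableSet_state (mΩ := sigmaOf S {i | i.2.1 < k})
      (ξ := fun ω k t => S (false, k, t) ω) (η := fun ω k t => S (true, k, t) ω) k
      (fun j hj t => measurable_sigmaOf (S := S) (i := (false, j, t)) hj)
      (fun j hj t => measurable_sigmaOf (S := S) (i := (true, j, t)) hj) {s}
  have hpres : ∀ s : OuterState, MeasurableSet[sigmaOf S {i | i.2.1 = k}]
      {ω | ¬ A.InnerGood xs s.trial (fun t => S (false, k, t) ω) (fun t => S (true, k, t) ω)} :=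
    fun s => (hA.measurableSet_innerGood (mΩ := sigmaOf S {i | i.2.1 = k}) xs s.trial
      (ξ := fun ω t => S (false, k, t) ω) (η := fun ω t => S (true, k, t) ω)
      (fun t => measurable_sigmaOf (S := S) (i := (false, k, t)) rfl)
      (fun t => measurable_sigmaOf (S := S) (i := (true, k, t)) rfl)).compl
  have hle : ∀ I : Set (Bool × ℕ × ℕ), sigmaOf S I ≤ mΩ := fun I =>
    iSup₂_le fun i _ => (hS.meas i).comap_le
  -- The state is fixed by earlier outer iterations, while the quality of the call at each frozen
  -- trial value is decided by the samples of iteration `k`.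
  have hind : Indep (sigmaOf S {i | i.2.1 < k}) (sigmaOf S {i | i.2.1 = k}) μ :=
    indep_sigmaOf hS.meas hS.indep
      (Set.disjoint_left.2 fun i (h1 : i.2.1 < k) (h2 : i.2.1 = k) => by omega)
  have heq : A.badSet S xs k = ⋃ s ∈ R.filter (· ∈ Rel), {ω | st ω ∈ ({s} : Set _)} ∩
      {ω | ¬ A.InnerGood xs s.trial (fun t => S (false, k, t) ω) (fun t => S (true, k, t) ω)} := by
    ext ω
    simp only [Method.badSet, Set.mem_iUnion, Set.mem_inter_iff, Set.mem_singleton_iff,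
      Set.mem_ofPred_eq, Finset.mem_filter, exists_prop]
    constructor
    · rintro ⟨h1, h2⟩
      exact ⟨st ω, ⟨hR _ _, h1⟩, rfl, h2⟩
    · rintro ⟨s, ⟨-, h1⟩, rfl, h2⟩
      exact ⟨h1, h2⟩
  rw [heq]
  refine ⟨Finset.measurableSet_biUnion _ fun s _ =>
    ((hle _) _ (hpast s)).inter ((hle _) _ (hpres s)), ?_⟩
  set q := ENNReal.ofReal (A.p.α / A.p.K A.ε A.zs)
  calc μ (⋃ s ∈ R.filter (· ∈ Rel), {ω | st ω ∈ ({s} : Set _)} ∩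
      {ω | ¬ A.InnerGood xs s.trial (fun t => S (false, k, t) ω) (fun t => S (true, k, t) ω)})
      ≤ ∑ s ∈ R.filter (· ∈ Rel), μ ({ω | st ω ∈ ({s} : Set _)} ∩
      {ω | ¬ A.InnerGood xs s.trial (fun t => S (false, k, t) ω) (fun t => S (true, k, t) ω)}) :=
        measure_biUnion_finset_le _ _
    _ ≤ ∑ s ∈ R.filter (· ∈ Rel), μ {ω | st ω ∈ ({s} : Set _)} * q := by
        refine Finset.sum_le_sum fun s hs => ?_
        rw [(Indep_iff _ _ _).1 hind _ _ (hpast s) (hpres s)]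
        gcongr
        have hrel : s ∈ Rel := (Finset.mem_filter.1 hs).2
        exact hA.prob_not_innerGood hS hrel.1 k hxs hzs hrel.2
    -- The events of being in different states are disjoint, so summing over states does not
    -- multiply the failure probability.
    _ = μ (⋃ s ∈ R.filter (· ∈ Rel), {ω | st ω ∈ ({s} : Set _)}) * q := by
        rw [← Finset.sum_mul, measure_biUnion_finset]
        · intro s _ s' _ hne
          exact Set.disjoint_left.2 fun ω (h1 : st ω = s) (h2 : st ω = s') => hne (h1 ▸ h2)
        · exact fun s _ => (hle _) _ (hpast s)
    _ ≤ 1 * q := by gcongr; exact prob_le_one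
    _ = q := one_mul q

/-- The main probabilistic statement for an admissible run of the method. -/
lemma Method.Admissible.exists_good (hA : A.Admissible) (hS : IsSample S A.Q.law μ) {xs : E}
    (hxs : xs ∈ A.Q.X) (hmin : IsMinOn (A.Q.h A.p.c) A.Q.X xs) (hzs : A.zs = 2 * √(A.Q.g xs)) :
    ∃ good : Set Ω, MeasurableSet good ∧ ENNReal.ofReal (1 - A.p.α) ≤ μ good ∧
      ∀ ω ∈ good, ∃ k < A.p.K A.ε A.zs,
        (A.state (fun k t => S (false, k, t) ω) (fun k t => S (true, k, t) ω) k).stopped = false ∧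
        (A.Q.h A.p.c (A.xbar (A.state (fun k t => S (false, k, t) ω)
          (fun k t => S (true, k, t) ω) k).trial (fun t => S (false, k, t) ω)) -
            A.Q.h A.p.c xs ≤ A.ε ∧
        (∫ ω', A.Q.h A.p.c (A.xbar (A.state (fun k t => S (false, k, t) ω)
          (fun k t => S (true, k, t) ω) k).trial (fun t => S (false, k, t) ω')) ∂μ) -
            A.Q.h A.p.c xs ≤ A.ε) ∧
        (A.state (fun k t => S (false, k, t) ω) (fun k t => S (true, k, t) ω) (k + 1)).samples ≤
          2 * A.p.K A.ε A.zs * ⌈A.p.Ttilde A.ε A.zs⌉₊ := by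
  have hK := A.p.K_pos A.ε A.zs
  have hα := hA.params.α_pos
  set bad : Set Ω := ⋃ k ∈ Finset.range (A.p.K A.ε A.zs), A.badSet S xs k with hbad
  have hbm : MeasurableSet bad :=
    Finset.measurableSet_biUnion _ fun k _ => (hA.badSet_spec hS hxs hzs k).1
  have hbμ : μ bad ≤ ENNReal.ofReal A.p.α := by
    calc μ bad ≤ ∑ k ∈ Finset.range (A.p.K A.ε A.zs), μ (A.badSet S xs k) :=
          measure_biUnion_finset_le _ _
      _ ≤ ∑ k ∈ Finset.range (A.p.K A.ε A.zs), ENNReal.ofReal (A.p.α / A.p.K A.ε A.zs) :=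
          Finset.sum_le_sum fun k _ => (hA.badSet_spec hS hxs hzs k).2
      _ = ENNReal.ofReal A.p.α := by
          rw [Finset.sum_const, Finset.card_range, nsmul_eq_mul, ← ENNReal.ofReal_natCast,
            ← ENNReal.ofReal_mul hK.le, mul_div_cancel₀ _ hK.ne']
  refine ⟨badᶜ, hbm.compl, ?_, fun ω hω => ?_⟩
  · rw [prob_compl_eq_one_sub hbm, ENNReal.ofReal_sub _ hα.le, ENNReal.ofReal_one]
    exact tsub_le_tsub_left hbμ 1
  · have hgood : ∀ k < A.p.K A.ε A.zs, ω ∉ A.badSet S xs k := fun k hk h =>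
      hω (Set.mem_biUnion (Finset.mem_coe.2 (Finset.mem_range.2 hk)) h)
    have hin : ∀ k < A.p.K A.ε A.zs,
        0 < (A.state (fun k t => S (false, k, t) ω) (fun k t => S (true, k, t) ω) k).trial →
        (A.p.z₀ ≤ (A.state (fun k t => S (false, k, t) ω)
          (fun k t => S (true, k, t) ω) k).trial ∨
        A.zs ≤ 2 * (A.state (fun k t => S (false, k, t) ω)
          (fun k t => S (true, k, t) ω) k).trial) →
        A.InnerGood xs (A.state (fun k t => S (false, k, t) ω)
          (fun k t => S (true, k, t) ω) k).trial
          (fun t => S (false, k, t) ω) (fun t => S (true, k, t) ω) := by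
      intro k hk h1 h2
      by_contra h
      exact hgood k hk ⟨⟨h1, h2⟩, h⟩
    refine exists_success hA.params hA.ε_pos (by rw [hzs]; positivity) (zs := A.zs)
      (st := fun k => A.state (fun k t => S (false, k, t) ω) (fun k t => S (true, k, t) ω) k)
      (ζ := fun k => A.slope (A.state (fun k t => S (false, k, t) ω)
        (fun k t => S (true, k, t) ω) k).trial (fun t => S (false, k, t) ω)
        (fun t => S (true, k, t) ω)) rfl (fun k => rfl) ?_ ?_
    · exact fun k hk h1 h2 => (hA.outcome hS h1 k hxs hmin hzs (hin k hk h1 h2)).1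
    · exact fun k hk h1 h2 => (hA.outcome hS h1 k hxs hmin hzs (hin k hk h1 h2)).2

end OuterProbability

/-! ### Oracle complexity -/

section Complexity

lemma logb_two_le_two_mul {x : ℝ} {y : ℝ} (h : Real.log x ≤ y) (hy : 0 ≤ y) :
    Real.logb 2 x ≤ 2 * y := by
  have h2 := Real.log_two_gt_d9
  rw [Real.logb, div_le_iff₀ (by linarith)]
  nlinarith

/-- Crude but uniform: `log a ≤ a`, `1 / log 2 ≤ 2`, and 1 for the ceiling. -/
lemma ceil_logb_le {a ε x : ℝ} (ha : 0 < a) (hε : 0 < ε) (hε1 : ε ≤ 1) (hx : 0 < x)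
    (hxa : x ≤ a / ε ^ 3) :
    (⌈Real.logb 2 x⌉₊ : ℝ) ≤ (2 * a + 7) * (1 + Real.log (1 / ε)) := by
  have hlog : 0 ≤ Real.log (1 / ε) := Real.log_nonneg (by rw [le_div_iff₀ hε]; linarith)
  have h1 : Real.log x ≤ a + 3 * Real.log (1 / ε) := by
    calc Real.log x ≤ Real.log (a * (1 / ε) ^ 3) := by
          refine Real.log_le_log hx (hxa.trans_eq ?_)
          field_simp
      _ = Real.log a + 3 * Real.log (1 / ε) := by
          rw [Real.log_mul ha.ne' (by positivity), Real.log_pow]; norm_num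
      _ ≤ _ := by gcongr; exact Real.log_le_self ha.le
  have h2 := logb_two_le_two_mul h1 (by positivity)
  have h3 : (⌈Real.logb 2 x⌉₊ : ℝ) ≤ 2 * (a + 3 * Real.log (1 / ε)) + 1 :=
    (Nat.cast_le.2 (Nat.ceil_le_ceil h2)).trans (Nat.ceil_lt_add_one (by positivity)).le
  nlinarith [mul_nonneg ha.le hlog]

variable {p : Params}

/-- `z* ≤ 2 β` bounds `w` and `K₁` independently of the instance, and `ε ≤ 1` lets every power of
`1/ε` be replaced by `ε⁻³`. -/
lemma Params.Valid.exists_K_le (hp : p.Valid) : ∃ κ : ℝ, 0 < κ ∧ ∀ ε zs : ℝ, 0 < ε → ε ≤ 1 →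
    0 ≤ zs → zs ≤ 2 * p.β → (p.K ε zs : ℝ) ≤ κ * (1 + Real.log (1 / ε)) := by
  have hz0 := hp.z₀_pos
  have hc := hp.c_pos
  have hβ := hp.β_nonneg
  set W := max (2 * p.β) (p.z₀ / 2) with hW
  have hW0 : 0 < W := lt_max_of_lt_right (by positivity)
  set a := 32 * p.c ^ 3 * W * (p.β ^ 2 + 4 * p.R ^ 2) + 4 * p.c * W with ha
  have ha0 : 0 < a := by positivity
  refine ⟨(8 * p.β / p.z₀ + 2) + (2 * a + 7), by positivity, fun ε zs hε hε1 hzs hzsβ => ?_⟩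
  have hlog : 0 ≤ Real.log (1 / ε) := Real.log_nonneg (by rw [le_div_iff₀ hε]; linarith)
  have hK₁ : (p.K₁ zs : ℝ) ≤ 8 * p.β / p.z₀ + 2 := by
    unfold Params.K₁
    rw [Nat.cast_max, Nat.cast_one]
    refine max_le (by have : 0 ≤ 8 * p.β / p.z₀ := by positivity
                      linarith) ?_
    have h1 := logb_two_le_two_mul (Real.log_le_self (x := 2 * zs / p.z₀) (by positivity))
      (by positivity)
    refine (Nat.cast_le.2 (Nat.ceil_le_ceil h1)).trans
      ((Nat.ceil_lt_add_one (by positivity)).le.trans ?_)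
    have : 2 * (2 * zs / p.z₀) ≤ 8 * p.β / p.z₀ := by
      rw [← mul_div_assoc]
      exact div_le_div_of_nonneg_right (by linarith) hz0.le
    linarith
  have hw : max zs (p.z₀ / 2) ≤ W := max_le_max_right _ hzsβ
  have hw0 : 0 < max zs (p.z₀ / 2) := lt_max_of_lt_right (by positivity)
  have hε3 : ε ^ 3 ≤ ε := pow_le_of_le_one hε.le hε1 (by norm_num)
  have hdiv : ∀ b : ℝ, 0 ≤ b → b / ε ≤ b / ε ^ 3 := fun b hb => by gcongr
  have hK₂ : (p.K₂ ε zs : ℝ) ≤ (2 * a + 7) * (1 + Real.log (1 / ε)) := by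
    unfold Params.K₂
    rw [Nat.cast_max, Nat.cast_max, Nat.cast_one]
    refine max_le ?_ (max_le ?_ ?_)
    · nlinarith [mul_nonneg ha0.le hlog]
    · refine ceil_logb_le ha0 hε hε1 (by positivity) ?_
      calc 32 * p.c ^ 3 * max zs (p.z₀ / 2) / ε ^ 3 * (p.β ^ 2 + 4 * p.R ^ 2)
            + p.c * max zs (p.z₀ / 2) / ε
          ≤ 32 * p.c ^ 3 * W / ε ^ 3 * (p.β ^ 2 + 4 * p.R ^ 2) + 4 * p.c * W / ε := by
            gcongr
            nlinarith
        _ ≤ 32 * p.c ^ 3 * W / ε ^ 3 * (p.β ^ 2 + 4 * p.R ^ 2) + 4 * p.c * W / ε ^ 3 := by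
            gcongr
        _ = a / ε ^ 3 := by rw [ha]; ring
    · refine ceil_logb_le ha0 hε hε1 (by positivity) ?_
      calc 4 * p.c * max zs (p.z₀ / 2) / ε ≤ 4 * p.c * W / ε := by gcongr
        _ ≤ 4 * p.c * W / ε ^ 3 := hdiv _ (by positivity)
        _ ≤ a / ε ^ 3 := by
            gcongr
            have : 0 ≤ 32 * p.c ^ 3 * W * (p.β ^ 2 + 4 * p.R ^ 2) := by positivity
            linarith
  have hKeq : (p.K ε zs : ℝ) = p.K₁ zs + p.K₂ ε zs := by unfold Params.K; push_cast; rfl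
  have h4 : (0 : ℝ) ≤ 8 * p.β / p.z₀ + 2 := by positivity
  rw [hKeq]
  nlinarith [mul_nonneg h4 hlog]

lemma Params.Valid.exists_Ctilde_le (hp : p.Valid) : ∃ c₃ : ℝ, 0 < c₃ ∧ ∀ ε zs : ℝ,
    p.Ctilde ε zs ≤ c₃ * (p.K ε zs : ℝ) ^ 2 := by
  have hα := hp.α_pos
  have hD := hp.DV_pos
  have hLG := hp.LG_pos
  have hmx : 0 < max 1 (16 * p.β ^ 2 / p.z₀ ^ 2) := lt_max_of_lt_left one_pos
  obtain ⟨c₂, hc₂⟩ : ∃ c₂, c₂ = 128 * max 1 (16 * p.β ^ 2 / p.z₀ ^ 2) *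
        ((p.Mf ^ 4 + 16 * p.R ^ 4) + 4 * p.β ^ 4) / (81 * p.α * p.DV ^ 2 * p.LG ^ 2) := ⟨_, rfl⟩
  have hc₂0 : 0 ≤ c₂ := by rw [hc₂]; positivity
  have hα2 : 0 < 16 / p.α ^ 2 := by positivity
  refine ⟨16 / p.α ^ 2 + c₂, by positivity, fun ε zs => ?_⟩
  have hK1 : (1 : ℝ) ≤ p.K ε zs := by
    have := p.two_le_K ε zs
    exact_mod_cast (by omega : 1 ≤ p.K ε zs)
  unfold Params.Ctilde
  generalize (p.K ε zs : ℝ) = k at hK1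
  refine max_le ?_ ?_
  · calc 16 * k ^ 2 / p.α ^ 2 = 16 / p.α ^ 2 * k ^ 2 := by ring
      _ ≤ (16 / p.α ^ 2 + c₂) * k ^ 2 := by gcongr; linarith
  · calc 128 * k * max 1 (16 * p.β ^ 2 / p.z₀ ^ 2) *
          ((p.Mf ^ 4 + 16 * p.R ^ 4) + 4 * p.β ^ 4) / (81 * p.α * p.DV ^ 2 * p.LG ^ 2)
        = c₂ * k := by rw [hc₂]; ring
      _ ≤ c₂ * k ^ 2 := by gcongr; nlinarith
      _ ≤ (16 / p.α ^ 2 + c₂) * k ^ 2 := by gcongr; linarith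

lemma Params.Valid.le_lowest_trial (hp : p.Valid) : ∃ σ : ℝ, 0 < σ ∧ ∀ ε zs : ℝ, 0 < ε → ε ≤ 1 →
    zs ≤ 2 * p.β → σ * max zs ε ≤ min p.z₀ (max (zs / 2) (ε / (2 * p.c))) := by
  have hz0 := hp.z₀_pos
  have hc := hp.c_pos
  have hc1 := hp.c_le_one
  have hβ := hp.β_nonneg
  have hB0 : 0 < 2 * p.β + 1 := by positivity
  -- The first candidate handles `z₀`, as `max zs ε ≤ 2 β + 1`. The factor `1/2` handles the inner
  -- maximum, as `c ≤ 1` gives `ε / 2 ≤ ε / (2 c)`.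
  refine ⟨min (p.z₀ / (2 * p.β + 1)) (1 / 2), lt_min (by positivity) (by norm_num),
    fun ε zs hε hε1 hzsβ => ?_⟩
  have hm0 : 0 < max zs ε := lt_max_of_lt_right hε
  have hmB : max zs ε ≤ 2 * p.β + 1 := max_le (by linarith) (by linarith)
  refine le_min ?_ ?_
  · calc min (p.z₀ / (2 * p.β + 1)) (1 / 2) * max zs ε
        ≤ p.z₀ / (2 * p.β + 1) * (2 * p.β + 1) :=
          mul_le_mul (min_le_left _ _) hmB hm0.le (by positivity)
      _ = p.z₀ := by field_simp
  · have h1 : min (p.z₀ / (2 * p.β + 1)) (1 / 2) * max zs ε ≤ 1 / 2 * max zs ε :=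
      mul_le_mul_of_nonneg_right (min_le_right _ _) hm0.le
    refine h1.trans ?_
    rcases max_choice zs ε with h | h
    · exact le_max_of_le_left (by rw [h]; linarith)
    · refine le_max_of_le_right ?_
      rw [h, le_div_iff₀ (by positivity)]
      nlinarith

lemma Params.Valid.exists_M_sq_le (hp : p.Valid) : ∃ m₃ : ℝ, 0 ≤ m₃ ∧ ∀ ε zs : ℝ, 0 < ε → ε ≤ 1 →
    zs ≤ 2 * p.β →
    p.M (min p.z₀ (max (zs / 2) (ε / (2 * p.c)))) ^ 2 ≤ m₃ / (max zs ε) ^ 2 := by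
  obtain ⟨σ, hσ, hσle⟩ := hp.le_lowest_trial
  obtain ⟨m₁, hm₁⟩ : ∃ m₁, m₁ = 3 * p.c ^ 2 * (p.LG ^ 2 + (4 * p.Lf ^ 2 + 1) * p.β ^ 2
          + 16 * (4 * (p.Lf ^ 2 + p.σf ^ 2) + 1) * p.R ^ 2) := ⟨_, rfl⟩
  obtain ⟨m₂, hm₂⟩ : ∃ m₂, m₂ = 12 * (p.Lf ^ 2 + p.σf ^ 2) + 8 * p.R ^ 2 + 2 * p.β ^ 2 + 3 :=
    ⟨_, rfl⟩
  have hm₁0 : 0 ≤ m₁ := by rw [hm₁]; positivity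
  have hm₂0 : 0 ≤ m₂ := by rw [hm₂]; positivity
  refine ⟨m₁ / σ ^ 2 + m₂ * (2 * p.β + 1) ^ 2, by positivity, fun ε zs hε hε1 hzsβ => ?_⟩
  have hm0 : 0 < max zs ε := lt_max_of_lt_right hε
  have hβ := hp.β_nonneg
  have hmB : max zs ε ≤ 2 * p.β + 1 := max_le (by linarith) (by linarith)
  have hσz := hσle ε zs hε hε1 hzsβ
  generalize min p.z₀ (max (zs / 2) (ε / (2 * p.c))) = z at hσz
  generalize max zs ε = m at *
  have hz0' : 0 < z := lt_of_lt_of_le (by positivity) hσz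
  have e1 : p.M z ^ 2 = m₁ / z ^ 2 + m₂ := by rw [p.M_sq, hm₁, hm₂]; ring
  have e2 : m₁ / z ^ 2 ≤ m₁ / (σ * m) ^ 2 := by gcongr
  have e3 : m₂ ≤ m₂ * (2 * p.β + 1) ^ 2 / m ^ 2 := by
    rw [le_div_iff₀ (by positivity)]; gcongr
  calc p.M z ^ 2 ≤ m₁ / (σ * m) ^ 2 + m₂ * (2 * p.β + 1) ^ 2 / m ^ 2 := by
        rw [e1]; exact add_le_add e2 e3
    _ = _ := by field_simp

/-- The oracle complexity of the method. -/
lemma Params.Valid.exists_complexity (hp : p.Valid) : ∃ C : ℝ, 0 < C ∧ ∀ ε zs : ℝ, 0 < ε →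
    ε ≤ 1 → 0 ≤ zs → zs ≤ 2 * p.β →
    ((2 * p.K ε zs * ⌈p.Ttilde ε zs⌉₊ : ℕ) : ℝ) ≤
      C * (1 + Real.log (1 / ε)) ^ 3 / ((max zs ε) ^ 2 * ε ^ 2) := by
  obtain ⟨κ, hκ, hKle⟩ := hp.exists_K_le
  obtain ⟨c₃, hc₃, hCle⟩ := hp.exists_Ctilde_le
  obtain ⟨m₃, hm₃, hMle⟩ := hp.exists_M_sq_le
  have hβ := hp.β_nonneg
  have hD := hp.DV_pos
  refine ⟨2 * (81 * c₃ * m₃ * p.DV ^ 2 + (2 * p.β + 1) ^ 2) * κ ^ 3, by positivity,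
    fun ε zs hε hε1 hzs hzsβ => ?_⟩
  have hK := hKle ε zs hε hε1 hzs hzsβ
  have hK1 : (1 : ℝ) ≤ p.K ε zs := by
    have := p.two_le_K ε zs
    exact_mod_cast (by omega : 1 ≤ p.K ε zs)
  have hm0 : 0 < max zs ε := lt_max_of_lt_right hε
  have hmB : max zs ε ≤ 2 * p.β + 1 := max_le (by linarith) (by linarith)
  have hCt := hCle ε zs
  have hM := hMle ε zs hε hε1 hzsβ
  have hCt0 := hp.Ctilde_pos (ε := ε) (zs := zs)
  have hTt0 : 0 ≤ p.Ttilde ε zs := (hp.budget_pos hε _).le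
  have hbud : p.Ttilde ε zs ≤
      81 * (c₃ * (p.K ε zs : ℝ) ^ 2) * (m₃ / (max zs ε) ^ 2) * p.DV ^ 2 / ε ^ 2 := by
    unfold Params.Ttilde Params.budget
    gcongr
  push_cast
  generalize (p.K ε zs : ℝ) = k at *
  generalize max zs ε = m at *
  generalize p.Ttilde ε zs = τ at *
  -- Absorbs the 1 lost in rounding up `T̃`. The total is then `K * K² / (m² ε²)` up to constants,
  -- whence the third power of the logarithm.
  have hone : 1 ≤ (2 * p.β + 1) ^ 2 * k ^ 2 / (m ^ 2 * ε ^ 2) := by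
    rw [le_div_iff₀ (by positivity), one_mul]
    have h1 : m ^ 2 ≤ (2 * p.β + 1) ^ 2 := by gcongr
    have h2 : ε ^ 2 ≤ k ^ 2 := by gcongr; linarith
    gcongr
  have hceil : (⌈τ⌉₊ : ℝ) ≤
      (81 * c₃ * m₃ * p.DV ^ 2 + (2 * p.β + 1) ^ 2) * k ^ 2 / (m ^ 2 * ε ^ 2) := by
    refine (Nat.ceil_lt_add_one hTt0).le.trans ((add_le_add hbud hone).trans_eq ?_)
    field_simp
  have hc₄0 : 0 < 81 * c₃ * m₃ * p.DV ^ 2 + (2 * p.β + 1) ^ 2 := by positivity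
  generalize 81 * c₃ * m₃ * p.DV ^ 2 + (2 * p.β + 1) ^ 2 = c₄ at *
  calc 2 * k * (⌈τ⌉₊ : ℝ) ≤ 2 * k * (c₄ * k ^ 2 / (m ^ 2 * ε ^ 2)) := by gcongr
    _ = 2 * c₄ * k ^ 3 / (m ^ 2 * ε ^ 2) := by ring
    _ ≤ 2 * c₄ * (κ * (1 + Real.log (1 / ε))) ^ 3 / (m ^ 2 * ε ^ 2) := by gcongr
    _ = _ := by ring

end Complexity

end Semideviation

end

/-! ### The theorem -/

open Semideviation in
theorem mainTheorem1 (p : Params) (hp : p.Valid) :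
    ∃ C : ℝ, 0 < C ∧
      ∀ (E : Type*) [NormedAddCommGroup E] [NormedSpace ℝ E] [FiniteDimensional ℝ E]
        [MeasurableSpace E] [BorelSpace E]
        (Ξ : Type*) [MeasurableSpace Ξ]
        (Ω : Type*) [MeasurableSpace Ω] (μ : Measure Ω) [IsProbabilityMeasure μ]
        (Q : Problem E Ξ) (_ : Q.Standing p)
        (_ : Q.FourthMomentBound p.Mf) (_ : Q.SemivarianceLipschitz p.LG)
        -- an optimal solution and the associated value of z
        (xs : E) (_ : xs ∈ Q.X) (_ : IsMinOn (Q.h p.c) Q.X xs)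
        (zs : ℝ) (_ : zs = 2 * √(Q.g xs))
        -- starting point, and the preliminary estimate of f at it
        (x₀ : E) (_ : x₀ ∈ Q.X) (m : ℕ) (_ : 0 < m) (e : Fin m → Ξ)
        (y₀ : ℝ) (_ : y₀ = (∑ i, Q.F x₀ (e i)) / m)
        (_ : ∀ x ∈ Q.X, |Q.f x - y₀| ≤ p.R)
        -- distance generating functions
        (vX : DistGen E) (vY vL : DistGen ℝ)
        (_ : vX.IsValid Q.X p.Lv)
        (_ : vY.IsValid (Set.Icc (y₀ - p.R) (y₀ + p.R)) p.Lv)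
        (_ : vL.IsValid (Set.Icc 0 1) p.Lv)
        -- independent samples: index (false, k, t) for the mirror descent step t of outer
        -- iteration k, index (true, k, t) for the slope estimate at that step
        (S : Bool × ℕ × ℕ → Ω → Ξ) (_ : ∀ i, Measurable (S i))
        (_ : ∀ i, μ.map (S i) = Q.law) (_ : iIndepFun S μ)
        (ε : ℝ) (_ : 0 < ε),
        let A : Method E Ξ :=
          { Q := Q, p := p, ε := ε, zs := zs, vX := vX, vY := vY, vL := vL, x₀ := x₀, y₀ := y₀ }
        let ξ : Ω → ℕ → ℕ → Ξ := fun ω k t => S (false, k, t) ω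
        let η : Ω → ℕ → ℕ → Ξ := fun ω k t => S (true, k, t) ω
        let z : ℕ → Ω → ℝ := fun k ω => (A.state (ξ ω) (η ω) k).trial
        -- with probability at least 1 - α an ε-optimal solution is attained at one of the first K
        -- outer iterations, with at most 2 K T̃ samples drawn up to then
        (∃ good : Set Ω, MeasurableSet good ∧ ENNReal.ofReal (1 - p.α) ≤ μ good ∧
          ∀ ω ∈ good, ∃ k < p.K ε zs,
            (A.state (ξ ω) (η ω) k).stopped = false ∧
            Q.h p.c (A.xbar (z k ω) (ξ ω k)) - Q.h p.c xs ≤ ε ∧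
            (∫ ω', Q.h p.c (A.xbar (z k ω) (ξ ω' k)) ∂μ) - Q.h p.c xs ≤ ε ∧
            (A.state (ξ ω) (η ω) (k + 1)).samples ≤ 2 * p.K ε zs * ⌈p.Ttilde ε zs⌉₊) ∧
        -- the resulting oracle complexity
        (ε ≤ 1 →
          ((2 * p.K ε zs * ⌈p.Ttilde ε zs⌉₊ : ℕ) : ℝ) ≤
            C * (1 + Real.log (1 / ε)) ^ 3 / ((max zs ε) ^ 2 * ε ^ 2)) := by
  obtain ⟨C, hC, hcomp⟩ := hp.exists_complexity
  refine ⟨C, hC, ?_⟩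
  intro E _ _ _ _ _ Ξ _ Ω _ μ _ Q hQ h4 hG xs hxs hmin zs hzs x₀ hx₀ m _ e y₀ _ hf vX vY vL hvX hvY
    hvL S hSm hSl hSi ε hε A ξ η z
  have hA : A.Admissible :=
    { params := hp
      standing := hQ
      fourth := h4
      semivariance := hG
      x₀_mem := hx₀
      f_near := hf
      vX_valid := hvX
      vY_valid := hvY
      vL_valid := hvL
      ε_pos := hε }
  have hS : IsSample S A.Q.law μ := ⟨hSm, hSl, hSi⟩
  constructor
  · obtain ⟨good, hm, hμ, hgood⟩ := hA.exists_good hS hxs hmin hzs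
    refine ⟨good, hm, hμ, fun ω hω => ?_⟩
    obtain ⟨k, hk, h1, ⟨h2, h3⟩, h5⟩ := hgood ω hω
    exact ⟨k, hk, h1, h2, h3, h5⟩
  · intro hε1
    have hβ : zs ≤ 2 * p.β := by
      have h := Real.sqrt_le_sqrt (hA.g_le hxs)
      rw [Real.sqrt_sq hp.β_nonneg] at h
      rw [hzs]
      exact mul_le_mul_of_nonneg_left h zero_le_two
    exact hcomp ε zs hε hε1 (by rw [hzs]; positivity) hβ
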